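/- **Setting.** Let $m\ge 0$, let $B$ be a smooth $4$-manifold, $W$ a compact smooth $m$-manifold, and $M$ a smooth manifold of dimension $5+m$ with a smooth locally trivial fibration $\pi:M\to B$ with fiber $S^1\times W$ and a smooth map $\Phi=(h,f):M\to S^1\times W$ whose restriction to every fiber of $\pi$ is a diffeomorphism onto $S^1\times W$. For $x\in M$ let $V_x=\ker d\pi_x$ be the tangent space of the $\pi$-fiber, $V_x\cap\ker df_x$ the tangent space of the circle $S^1_x$ and $V_x\cap\ker dh_x$ the tangent space of the fiber $W_x$. Let $g$ be a smooth semi-Riemannian metric on $M$ of signature $(-,+,+,+,-,+,\dots,+)$, which is negative definite on the circles $S^1_x$, positive definite on the fibers $W_x$, and of signature $(-,+,+,+)$ on the horizontal spaces $H_x=V_x^{\perp}$; $pr_{H}$ denotes the orthogonal projection on $H_x$. Write $\langle\cdot,\cdot\rangle=g$, let $\nabla$ be the Levi-Civita connection, $Ric(v,w)=\mathrm{tr}(u\mapsto R(u,v)w)$ with $R(U,V)=[\nabla_U,\nabla_V]-\nabla_{[U,V]}$, $S$ the scalar curvature, and $G=2\,Ric-S\,g$. For a $2$-tensor $T$, the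 endomorphism ${}^eT$ is defined by $\langle u,{}^eT(v)\rangle=T(u,v)$, the vector $\nabla\cdot T$ by $(\nabla\cdot T)_j=g^{ki}\nabla_kT_{ij}$ (with the index raised), and $|T|=g^{ik}g^{jl}T_{ij}T_{kl}$. Vectors are identified with covectors by $g$. Let $Y$ be a smooth Killing vector field on $M$ tangent to the circles $S^1_x$ with $\langle Y,Y\rangle=-1$, and let $F=\mathbf d(Y^\flat)$. Let $D\subset M$ be open, $X_0$ a smooth vector field on $D$ and $\mu$ a function on $D$ such that at each point of $D$: $\langle X_0,X_0\rangle=-1$, $\mu>0$, and $-\mu$ is an eigenvalue of the endomorphism $pr_H\circ({}^eG|_{H})$ of $H_x$ with eigenspace the line $\mathbb R X_0\subset H_x$ (a fluid domain). Put $$e=G(X_0,Y),\qquad X=X_0+\frac e\mu Y,\qquad P(u,v)=G(u,v)-G(pr_{\mathrm T}u,\,pr_{\mathrm T}v),$$ where $pr_{\mathrm T}$ is the orthogonal projection on the plane spanned by $X_0$ and $Y$. Suppose that the fluid is perfect and isentropic: ${}^eP(Y)=0$ and $P=p\,(g+X_0\otimes X_0+Y\otimes Y)$ on $D$ for a smooth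 function $p$ on $D$. **Theorem.** At every point of $D$: - Energy conservation: $\nabla\cdot(\mu X_0)+p\,\nabla\cdot X_0=0$. - Charge conservation: $\nabla\cdot(eX)=\nabla\cdot(eX_0)=0$. - $\mu^2X\!\left(\frac e\mu\right)=\mu^2X_0\!\left(\frac e\mu\right)=e\,p\,\nabla\cdot X_0$. - Equation of motion: $(\mu+p)\nabla_{X_0}X_0=e\;{}^eF(X_0)-\mathrm{grad}_g(p)-X_0(p)\,X_0$. - Maxwell equations: $\mathbf dF=0$ and $\nabla\cdot F=e\,X_0+\tfrac12|F|\,Y$; in particular $pr_{H}(\nabla\cdot F)=e\,X_0$. -/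

import Mathlib

open Set Module Bundle VectorField
open scoped Manifold ContDiff Topology

/-! ## Semi-Riemannian geometry on a smooth manifold of dimension `n` -/

namespace KaluzaKlein

instance tangentFiniteDimensional {n : ℕ} {M : Type*} [TopologicalSpace M]
    [ChartedSpace (EuclideanSpace ℝ (Fin n)) M] (x : M) :
    FiniteDimensional ℝ (TangentSpace (𝓡 n) x) :=
  inferInstanceAs (FiniteDimensional ℝ (EuclideanSpace ℝ (Fin n)))

instance tangentT2Space {n : ℕ} {M : Type*} [TopologicalSpace M]
    [ChartedSpace (EuclideanSpace ℝ (Fin n)) M] (x : M) :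
    T2Space (TangentSpace (𝓡 n) x) :=
  inferInstanceAs (T2Space (EuclideanSpace ℝ (Fin n)))

section SemiRiemannian

variable {n : ℕ} {M : Type*} [TopologicalSpace M] [ChartedSpace (EuclideanSpace ℝ (Fin n)) M]

/-- The basis of `T_x M` given by the coordinate vectors at `x` of the preferred chart at `x`. -/
noncomputable def tangentBasis (x : M) : Basis (Fin n) ℝ (TangentSpace (𝓡 n) x) :=
  (EuclideanSpace.basisFun (Fin n) ℝ).toBasis

variable [IsManifold (𝓡 n) ∞ M]

/-- The `i`-th coordinate vector field of the preferred chart at `x`; it is smooth near `x`. -/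
noncomputable def coordField (x : M) (i : Fin n) : ∀ y : M, TangentSpace (𝓡 n) y :=
  FiberBundle.extend (EuclideanSpace ℝ (Fin n)) (tangentBasis x i)

variable (n M) in
/-- A smooth semi-Riemannian metric (of arbitrary signature) on `M`. -/
structure SemiRiemannianMetric where
  /-- the scalar product on each tangent space -/
  inner (x : M) : TangentSpace (𝓡 n) x →L[ℝ] TangentSpace (𝓡 n) x →L[ℝ] ℝ
  symm (x : M) (v w : TangentSpace (𝓡 n) x) : inner x v w = inner x w v
  nondegenerate (x : M) (v : TangentSpace (𝓡 n) x) (hv : ∀ w, inner x v w = 0) : v = 0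
  contMDiff : ContMDiff (𝓡 n)
    ((𝓡 n).prod 𝓘(ℝ, EuclideanSpace ℝ (Fin n) →L[ℝ] EuclideanSpace ℝ (Fin n) →L[ℝ] ℝ)) ∞
    (fun x ↦ TotalSpace.mk' (EuclideanSpace ℝ (Fin n) →L[ℝ] EuclideanSpace ℝ (Fin n) →L[ℝ] ℝ)
      x (inner x))

/-- A vector field is smooth on the set `D`. -/
def SmoothFieldOn (D : Set M) (V : ∀ x : M, TangentSpace (𝓡 n) x) : Prop :=
  ContMDiffOn (𝓡 n) ((𝓡 n).prod 𝓘(ℝ, EuclideanSpace ℝ (Fin n))) ∞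
    (fun x ↦ TotalSpace.mk' (EuclideanSpace ℝ (Fin n)) x (V x)) D

/-- A vector field is differentiable at the point `x`. -/
abbrev DiffFieldAt (V : ∀ x : M, TangentSpace (𝓡 n) x) (x : M) : Prop :=
  MDifferentiableAt (𝓡 n) ((𝓡 n).prod 𝓘(ℝ, EuclideanSpace ℝ (Fin n)))
    (fun y ↦ TotalSpace.mk' (EuclideanSpace ℝ (Fin n)) y (V y)) x

namespace SemiRiemannianMetric

variable (g : SemiRiemannianMetric n M)

/-- The metric at `x` as a bilinear form. -/
noncomputable def bilin (x : M) : LinearMap.BilinForm ℝ (TangentSpace (𝓡 n) x) :=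
  LinearMap.mk₂ ℝ (fun v w ↦ g.inner x v w) (by simp) (by simp) (by simp) (by simp)

lemma bilin_nondegenerate (x : M) : (g.bilin x).Nondegenerate :=
  ⟨fun v hv ↦ g.nondegenerate x v hv,
   fun v hv ↦ g.nondegenerate x v fun w ↦ (g.symm x v w).trans (hv w)⟩

/-- The musical isomorphism from covectors to vectors: `⟨♯α, w⟩ = α w`. -/
noncomputable def sharp (x : M) : Dual ℝ (TangentSpace (𝓡 n) x) ≃ₗ[ℝ] TangentSpace (𝓡 n) x :=
  ((g.bilin x).toDual (g.bilin_nondegenerate x)).symm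

lemma inner_sharp (x : M) (α : Dual ℝ (TangentSpace (𝓡 n) x)) (w : TangentSpace (𝓡 n) x) :
    g.inner x (g.sharp x α) w = α w :=
  LinearMap.BilinForm.apply_toDual_symm_apply (hB := g.bilin_nondegenerate x) α w

/-- The musical isomorphism from vectors to covectors, `v ↦ ⟨v, ·⟩`. -/
noncomputable def flat (x : M) (v : TangentSpace (𝓡 n) x) : Dual ℝ (TangentSpace (𝓡 n) x) :=
  g.bilin x v

/-- The endomorphism `ᵉβ` associated to a bilinear form `β`: `⟨u, ᵉβ v⟩ = β(u, v)`. -/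
noncomputable def endo (x : M) (β : LinearMap.BilinForm ℝ (TangentSpace (𝓡 n) x)) :
    End ℝ (TangentSpace (𝓡 n) x) :=
  (g.sharp x).toLinearMap ∘ₗ β.flip

/-- The metric trace `g^{ij} β_{ij}` of a bilinear form `β`. -/
noncomputable def metricTrace (x : M) (β : LinearMap.BilinForm ℝ (TangentSpace (𝓡 n) x)) : ℝ :=
  LinearMap.trace ℝ _ (g.endo x β)

/-- The right-hand side of the Koszul formula: `⟨∇_X Y, Z⟩` for the Levi-Civita connection. -/
noncomputable def koszul (X Y Z : ∀ x : M, TangentSpace (𝓡 n) x) (x : M) : ℝ :=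
  (1 / 2 : ℝ) *
    (mvfderiv (𝓡 n) (fun y ↦ g.inner y (Y y) (Z y)) x (X x)
      + mvfderiv (𝓡 n) (fun y ↦ g.inner y (Z y) (X y)) x (Y x)
      - mvfderiv (𝓡 n) (fun y ↦ g.inner y (X y) (Y y)) x (Z x)
      + g.inner x (mlieBracket (𝓡 n) X Y x) (Z x)
      - g.inner x (mlieBracket (𝓡 n) Y Z x) (X x)
      + g.inner x (mlieBracket (𝓡 n) Z X x) (Y x))

/-- `v ↦ ∇_v Y` at `x`: the linear map whose value on the coordinate vector `∂_k` is the vector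
`w` with `⟨w, ∂_j⟩ = koszul ∂_k Y ∂_j` for all `j`. -/
noncomputable def leviCivitaAux (Y : ∀ x : M, TangentSpace (𝓡 n) x) (x : M) :
    TangentSpace (𝓡 n) x →L[ℝ] TangentSpace (𝓡 n) x :=
  LinearMap.toContinuousLinearMap
    ((tangentBasis x).constr ℝ fun k ↦
      g.sharp x ((tangentBasis x).constr ℝ fun j ↦
        g.koszul (coordField x k) Y (coordField x j) x))

variable {g}

lemma mdiff_inner {Y Z : ∀ x : M, TangentSpace (𝓡 n) x} {x : M}
    (hY : DiffFieldAt Y x) (hZ : DiffFieldAt Z x) :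
    MDifferentiableAt (𝓡 n) 𝓘(ℝ) (fun y ↦ g.inner y (Y y) (Z y)) x := by
  have h : MDifferentiableAt (𝓡 n) ((𝓡 n).prod 𝓘(ℝ)) (fun m ↦
      TotalSpace.mk' ℝ (E := Bundle.Trivial M ℝ) m (g.inner m (Y m) (Z m))) x := by
    apply MDifferentiableAt.clm_bundle_apply₂ (F₁ := EuclideanSpace ℝ (Fin n))
      (F₂ := EuclideanSpace ℝ (Fin n))
    · exact g.contMDiff.mdifferentiableAt (by simp)
    · exact hY
    · exact hZ
  simp only [mdifferentiableAt_totalSpace] at h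
  exact h.2

lemma koszul_add {X Y Y' Z : ∀ x : M, TangentSpace (𝓡 n) x} {x : M}
    (hX : DiffFieldAt X x) (hY : DiffFieldAt Y x) (hY' : DiffFieldAt Y' x)
    (hZ : DiffFieldAt Z x) :
    g.koszul X (Y + Y') Z x = g.koszul X Y Z x + g.koszul X Y' Z x := by
  have e1 : (fun y ↦ g.inner y ((Y + Y') y) (Z y)) =
    (fun y ↦ g.inner y (Y y) (Z y)) + (fun y ↦ g.inner y (Y' y) (Z y)) := by
    ext y; simp
  have e2 : (fun y ↦ g.inner y (X y) ((Y + Y') y)) =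
    (fun y ↦ g.inner y (X y) (Y y)) + (fun y ↦ g.inner y (X y) (Y' y)) := by
    ext y; simp
  simp only [koszul]
  rw [e1, e2, mvfderiv_add (mdiff_inner hY hZ) (mdiff_inner hY' hZ),
    mvfderiv_add (mdiff_inner hX hY) (mdiff_inner hX hY'),
    mlieBracket_add_left hY hY', mlieBracket_add_right hY hY']
  simp
  ring

lemma koszul_smul {X Y Z : ∀ x : M, TangentSpace (𝓡 n) x} {f : M → ℝ} {x : M}
    (hX : DiffFieldAt X x) (hY : DiffFieldAt Y x) (hZ : DiffFieldAt Z x)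
    (hf : MDifferentiableAt (𝓡 n) 𝓘(ℝ) f x) :
    g.koszul X (f • Y) Z x = f x * g.koszul X Y Z x
      + mvfderiv (𝓡 n) f x (X x) * g.inner x (Y x) (Z x) := by
  have e1 : (fun y ↦ g.inner y ((f • Y) y) (Z y)) =
    f * (fun y ↦ g.inner y (Y y) (Z y)) := by
    ext y; simp
  have e2 : (fun y ↦ g.inner y (X y) ((f • Y) y)) =
    f * (fun y ↦ g.inner y (X y) (Y y)) := by
    ext y; simp
  simp only [koszul]
  rw [e1, e2, mvfderiv_mul hf (mdiff_inner hY hZ), mvfderiv_mul hf (mdiff_inner hX hY),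
    mlieBracket_smul_left hf hY, mlieBracket_smul_right hf hY]
  simp [g.symm x (Y x) (X x)]
  ring

lemma mdiff_coordField (x : M) (i : Fin n) : DiffFieldAt (coordField x i) x :=
  FiberBundle.mdifferentiableAt_extend ..

lemma coordField_self (x : M) (i : Fin n) : coordField x i x = tangentBasis x i :=
  FiberBundle.extend_apply_self ..

variable (g)

/-- The Levi-Civita connection of the metric `g`. -/
noncomputable def leviCivita :
    CovariantDerivative (𝓡 n) (EuclideanSpace ℝ (Fin n)) (fun x : M ↦ TangentSpace (𝓡 n) x) where
  toFun := g.leviCivitaAux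
  isCovariantDerivativeOnUniv :=
    { add := by
        intro Y Y' x hY hY' _
        ext1 v
        refine DFunLike.congr_fun (?_ : (g.leviCivitaAux (Y + Y') x).toLinearMap =
          (g.leviCivitaAux Y x + g.leviCivitaAux Y' x).toLinearMap) v
        refine (tangentBasis x).ext fun k ↦ ?_
        simp only [leviCivitaAux, LinearMap.coe_toContinuousLinearMap,
          ContinuousLinearMap.toLinearMap_add, LinearMap.add_apply, Basis.constr_basis]
        rw [← map_add]
        congr 1
        refine (tangentBasis x).ext fun j ↦ ?_
        simp only [LinearMap.add_apply, Basis.constr_basis]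
        exact koszul_add (mdiff_coordField x k) hY hY' (mdiff_coordField x j)
      leibniz := by
        intro Y f x hY hf _
        ext1 v
        refine DFunLike.congr_fun (?_ : (g.leviCivitaAux (f • Y) x).toLinearMap =
          (f x • g.leviCivitaAux Y x
            + (mvfderiv (𝓡 n) f x).smulRight (Y x)).toLinearMap) v
        refine (tangentBasis x).ext fun k ↦ ?_
        have h : Y x = g.sharp x (g.bilin x (Y x)) :=
          ((g.bilin x).toDual (g.bilin_nondegenerate x)).symm_apply_apply (Y x) |>.symm
        simp only [leviCivitaAux, LinearMap.coe_toContinuousLinearMap,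
          ContinuousLinearMap.toLinearMap_add, ContinuousLinearMap.toLinearMap_smul,
          LinearMap.add_apply, LinearMap.smul_apply, Basis.constr_basis,
          ContinuousLinearMap.coe_coe, ContinuousLinearMap.smulRight_apply]
        conv_rhs => rw [h]
        rw [← LinearEquiv.map_smul (g.sharp x), ← LinearEquiv.map_smul (g.sharp x),
          ← LinearEquiv.map_add (g.sharp x)]
        congr 1
        refine (tangentBasis x).ext fun j ↦ ?_
        simp only [LinearMap.add_apply, LinearMap.smul_apply, Basis.constr_basis, smul_eq_mul]
        rw [koszul_smul (mdiff_coordField x k) hY (mdiff_coordField x j) hf,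
          coordField_self, coordField_self]
        rfl }

/-- The curvature `R(X, Y) Z = ∇_X ∇_Y Z - ∇_Y ∇_X Z - ∇_{[X, Y]} Z`. -/
noncomputable def curvature (X Y Z : ∀ x : M, TangentSpace (𝓡 n) x) (x : M) :
    TangentSpace (𝓡 n) x :=
  g.leviCivita (fun y ↦ g.leviCivita Z y (Y y)) x (X x)
    - g.leviCivita (fun y ↦ g.leviCivita Z y (X y)) x (Y x)
    - g.leviCivita Z x (mlieBracket (𝓡 n) X Y x)

/-- The Ricci curvature `Ric(v, w) = trace (u ↦ R(u, v) w)`, given by its components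
`Ric(∂_i, ∂_j) = ∑ k, dx^k (R(∂_k, ∂_i) ∂_j)`. -/
noncomputable def ricci (x : M) : LinearMap.BilinForm ℝ (TangentSpace (𝓡 n) x) :=
  Matrix.toBilin (tangentBasis x) (Matrix.of fun i j ↦ ∑ k,
    (tangentBasis x).coord k (g.curvature (coordField x k) (coordField x i) (coordField x j) x))

/-- The scalar curvature. -/
noncomputable def scalarCurvature (x : M) : ℝ := g.metricTrace x (g.ricci x)

/-- Twice the Einstein curvature, `G = 2 Ric - S g`. -/
noncomputable def einstein (x : M) : LinearMap.BilinForm ℝ (TangentSpace (𝓡 n) x) :=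
  (2 : ℝ) • g.ricci x - g.scalarCurvature x • g.bilin x

/-- The divergence of a vector field, the trace of `v ↦ ∇_v V`. -/
noncomputable def divergence (V : ∀ x : M, TangentSpace (𝓡 n) x) (x : M) : ℝ :=
  LinearMap.trace ℝ (TangentSpace (𝓡 n) x) (g.leviCivita V x).toLinearMap

/-- The component `(∇_{∂_k} T)(∂_i, ∂_j)` at `x` of the covariant derivative of a 2-tensor. -/
noncomputable def covDerivTensor (T : ∀ x : M, LinearMap.BilinForm ℝ (TangentSpace (𝓡 n) x))
    (x : M) (k i j : Fin n) : ℝ :=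
  mvfderiv (𝓡 n) (fun y ↦ T y (coordField x i y) (coordField x j y)) x (tangentBasis x k)
    - T x (g.leviCivita (coordField x i) x (tangentBasis x k)) (tangentBasis x j)
    - T x (tangentBasis x i) (g.leviCivita (coordField x j) x (tangentBasis x k))

/-- The divergence of a 2-tensor, as a vector field: `(∇·T)_j = g^{ki} (∇_k T)_{ij}`, with the
index `j` raised. -/
noncomputable def divTensor (T : ∀ x : M, LinearMap.BilinForm ℝ (TangentSpace (𝓡 n) x))
    (x : M) : TangentSpace (𝓡 n) x :=
  g.sharp x ((tangentBasis x).constr ℝ fun j ↦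
    g.metricTrace x (Matrix.toBilin (tangentBasis x)
      (Matrix.of fun k i ↦ g.covDerivTensor T x k i j)))

/-- The full contraction `|T| = g^{ik} g^{jl} T_{ij} T_{kl}` of a 2-tensor with itself. -/
noncomputable def contraction (x : M) (T : LinearMap.BilinForm ℝ (TangentSpace (𝓡 n) x)) : ℝ :=
  g.metricTrace x (Matrix.toBilin (tangentBasis x) (Matrix.of fun i k ↦
    g.metricTrace x (Matrix.toBilin (tangentBasis x) (Matrix.of fun j l ↦
      T (tangentBasis x i) (tangentBasis x j) * T (tangentBasis x k) (tangentBasis x l)))))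

/-- The gradient of a function. -/
noncomputable def grad (f : M → ℝ) (x : M) : TangentSpace (𝓡 n) x :=
  g.sharp x (mvfderiv (𝓡 n) f x).toLinearMap

/-- `V` is a Killing vector field: `∇_i V_j + ∇_j V_i = 0`. -/
def IsKilling (V : ∀ x : M, TangentSpace (𝓡 n) x) : Prop :=
  ∀ (x : M) (v w : TangentSpace (𝓡 n) x),
    g.inner x (g.leviCivita V x v) w + g.inner x v (g.leviCivita V x w) = 0

end SemiRiemannianMetric

/-- The exterior derivative of a differential `k`-form, computed in the preferred chart `φ` at
each point `x`: it is `φ^* d ((φ⁻¹)^* α)` at `x`. -/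
noncomputable def extDer {k : ℕ} (α : ∀ x : M, TangentSpace (𝓡 n) x [⋀^Fin k]→L[ℝ] ℝ) (x : M) :
    TangentSpace (𝓡 n) x [⋀^Fin (k + 1)]→L[ℝ] ℝ :=
  (extDeriv (fun u : EuclideanSpace ℝ (Fin n) ↦
      (α ((extChartAt (𝓡 n) x).symm u)).compContinuousLinearMap
        (mfderiv 𝓘(ℝ, EuclideanSpace ℝ (Fin n)) (𝓡 n) (extChartAt (𝓡 n) x).symm u))
    (extChartAt (𝓡 n) x x)).compContinuousLinearMap
      (mfderiv (𝓡 n) 𝓘(ℝ, EuclideanSpace ℝ (Fin n)) (extChartAt (𝓡 n) x) x)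

lemma update_pair_zero {V : Type*} (v w z : V) : Function.update ![v, w] 0 z = ![z, w] := by
  ext i; fin_cases i <;> rfl

lemma update_pair_one {V : Type*} (v w z : V) : Function.update ![v, w] 1 z = ![v, z] := by
  ext i; fin_cases i <;> rfl

/-- A differential 2-form as a field of bilinear forms. -/
noncomputable def formBilin (α : ∀ x : M, TangentSpace (𝓡 n) x [⋀^Fin 2]→L[ℝ] ℝ) (x : M) :
    LinearMap.BilinForm ℝ (TangentSpace (𝓡 n) x) :=
  LinearMap.mk₂ ℝ (fun v w ↦ α x ![v, w])
    (fun v v' w ↦ by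
      have h := (α x).map_update_add ![v, w] 0 v v'
      simpa only [update_pair_zero] using h)
    (fun c v w ↦ by
      have h := (α x).map_update_smul ![v, w] 0 c v
      simpa only [update_pair_zero] using h)
    (fun v w w' ↦ by
      have h := (α x).map_update_add ![v, w] 1 w w'
      simpa only [update_pair_one] using h)
    (fun c v w ↦ by
      have h := (α x).map_update_smul ![v, w] 1 c w
      simpa only [update_pair_one] using h)

/-- The electromagnetic field `F = d(Y^♭)` as a differential 2-form. -/
noncomputable def emForm (g : SemiRiemannianMetric n M) (Y : ∀ x : M, TangentSpace (𝓡 n) x) :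
    ∀ x : M, TangentSpace (𝓡 n) x [⋀^Fin 2]→L[ℝ] ℝ :=
  extDer fun x ↦ ContinuousAlternatingMap.ofSubsingleton ℝ (TangentSpace (𝓡 n) x) ℝ (0 : Fin 1)
    (g.inner x (Y x))

/-- The electromagnetic field `F = d(Y^♭)` as a field of bilinear forms, `F_{ij}`. -/
noncomputable def emTensor (g : SemiRiemannianMetric n M) (Y : ∀ x : M, TangentSpace (𝓡 n) x) :
    ∀ x : M, LinearMap.BilinForm ℝ (TangentSpace (𝓡 n) x) :=
  formBilin (emForm g Y)

end SemiRiemannian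

/-! ## Multi-fiber bundles and the spacetime model -/

/-- An `(S¹, W)`-multi-fiber bundle: a smooth fibration `π : M → B` with fiber `S¹ × W`, with a
smooth map `(h, f) : M → S¹ × W` whose restriction to each fiber of `π` is a diffeomorphism onto
`S¹ × W`. -/
structure MultiFiberBundle (m : ℕ)
    (M : Type*) [TopologicalSpace M] [ChartedSpace (EuclideanSpace ℝ (Fin (5 + m))) M]
    (B : Type*) [TopologicalSpace B] [ChartedSpace (EuclideanSpace ℝ (Fin 4)) B]
    (W : Type*) [TopologicalSpace W] [ChartedSpace (EuclideanSpace ℝ (Fin m)) W] where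
  /-- the projection to classical spacetime -/
  proj : M → B
  /-- the circle component of the fiber map -/
  h : M → Circle
  /-- the `W` component of the fiber map -/
  f : M → W
  proj_smooth : ContMDiff (𝓡 (5 + m)) (𝓡 4) ∞ proj
  h_smooth : ContMDiff (𝓡 (5 + m)) (𝓡 1) ∞ h
  f_smooth : ContMDiff (𝓡 (5 + m)) (𝓡 m) ∞ f
  /-- `proj` is locally trivial with fiber `S¹ × W` -/
  locally_trivial : ∀ b : B, ∃ (U : Set B) (φ : OpenPartialHomeomorph M (B × (Circle × W))),
    b ∈ U ∧ IsOpen U ∧ φ.source = proj ⁻¹' U ∧ φ.target = U ×ˢ univ ∧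
    (∀ x ∈ φ.source, (φ x).1 = proj x) ∧
    ContMDiffOn (𝓡 (5 + m)) ((𝓡 4).prod ((𝓡 1).prod (𝓡 m))) ∞ φ φ.source ∧
    ContMDiffOn ((𝓡 4).prod ((𝓡 1).prod (𝓡 m))) (𝓡 (5 + m)) ∞ φ.symm φ.target
  /-- `(h, f)` restricts to a diffeomorphism of each fiber of `proj` onto `S¹ × W`; `ψ` is the
  inverse diffeomorphism, seen as a smooth map into `M` -/
  fiber_diffeo : ∀ b : B, ∃ ψ : Circle × W → M,
    ContMDiff ((𝓡 1).prod (𝓡 m)) (𝓡 (5 + m)) ∞ ψ ∧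
    (∀ u, proj (ψ u) = b ∧ (h (ψ u), f (ψ u)) = u) ∧
    (∀ x, proj x = b → ψ (h x, f x) = x)

/-- The bilinear form `β` restricted to the subspace `S` has signature with `q` minus signs and
`p` plus signs: `S` has a `β`-orthonormal basis of that type. -/
def HasSignature {V : Type*} [AddCommGroup V] [Module ℝ V] (β : LinearMap.BilinForm ℝ V)
    (S : Submodule ℝ V) (q p : ℕ) : Prop :=
  ∃ b : Basis (Fin q ⊕ Fin p) ℝ S,
    (∀ i j, i ≠ j → β (b i) (b j) = 0) ∧
    (∀ i, β (b (Sum.inl i)) (b (Sum.inl i)) = -1) ∧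
    (∀ i, β (b (Sum.inr i)) (b (Sum.inr i)) = 1)

namespace MultiFiberBundle

variable {m : ℕ}
  {M : Type*} [TopologicalSpace M] [ChartedSpace (EuclideanSpace ℝ (Fin (5 + m))) M]
  {B : Type*} [TopologicalSpace B] [ChartedSpace (EuclideanSpace ℝ (Fin 4)) B]
  {W : Type*} [TopologicalSpace W] [ChartedSpace (EuclideanSpace ℝ (Fin m)) W]
  (𝓑 : MultiFiberBundle m M B W)

/-- The tangent space at `x` of the `π`-fiber through `x`. -/
noncomputable def vertical (x : M) : Submodule ℝ (TangentSpace (𝓡 (5 + m)) x) :=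
  (mfderiv (𝓡 (5 + m)) (𝓡 4) 𝓑.proj x).ker

/-- The tangent space at `x` of the circle `S¹_x`, the part of the `π`-fiber where `f = f x`. -/
noncomputable def circleTangent (x : M) : Submodule ℝ (TangentSpace (𝓡 (5 + m)) x) :=
  𝓑.vertical x ⊓ (mfderiv (𝓡 (5 + m)) (𝓡 m) 𝓑.f x).ker

/-- The tangent space at `x` of `W_x`, the part of the `π`-fiber where `h = h x`. -/
noncomputable def internalTangent (x : M) : Submodule ℝ (TangentSpace (𝓡 (5 + m)) x) :=
  𝓑.vertical x ⊓ (mfderiv (𝓡 (5 + m)) (𝓡 1) 𝓑.h x).ker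

variable [IsManifold (𝓡 (5 + m)) ∞ M] (g : SemiRiemannianMetric (5 + m) M)

/-- The horizontal space `H_x`, the orthogonal of the tangent space of the `π`-fiber. -/
noncomputable def horizontal (x : M) : Submodule ℝ (TangentSpace (𝓡 (5 + m)) x) :=
  (g.bilin x).orthogonal (𝓑.vertical x)

/-- The metric is compatible with the multi-fiber structure, of signature `(-)` on the circles,
`(+, …, +)` on the `W`-fibers, `(-, +, +, +)` on the horizontal spaces, and total signature
`(-, +, +, +, -, +, …, +)`. -/
structure IsSpacetime : Prop where
  circle (x : M) : HasSignature (g.bilin x) (𝓑.circleTangent x) 1 0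
  internal (x : M) : HasSignature (g.bilin x) (𝓑.internalTangent x) 0 m
  horizontal (x : M) : HasSignature (g.bilin x) (𝓑.horizontal g x) 1 3
  total (x : M) : HasSignature (g.bilin x) ⊤ 2 (3 + m)

open scoped Classical in
/-- The orthogonal projection `pr_H` of `T_x M` onto `H_x`, that is, along the tangent space of
the `π`-fiber. In a spacetime the two subspaces are always complementary. -/
noncomputable def horProj (x : M) :
    TangentSpace (𝓡 (5 + m)) x →ₗ[ℝ] 𝓑.horizontal g x :=
  if h : IsCompl (𝓑.horizontal g x) (𝓑.vertical x) then
    (𝓑.horizontal g x).projectionOnto (𝓑.vertical x) h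
  else 0

/-- The electromagnetic potential: a smooth Killing vector field tangent to the circles `S¹_x`
with `⟨Y, Y⟩ = -1`. -/
structure IsPotential (Y : ∀ x : M, TangentSpace (𝓡 (5 + m)) x) : Prop where
  smooth : SmoothFieldOn univ Y
  tangent (x : M) : Y x ∈ 𝓑.circleTangent x
  unit (x : M) : g.inner x (Y x) (Y x) = -1
  killing : g.IsKilling Y

/-- The endomorphism `ᵉG_H = pr_H ∘ ᵉG|_H` of `H_x`. -/
noncomputable def einsteinHor (x : M) : End ℝ (𝓑.horizontal g x) :=
  𝓑.horProj g x ∘ₗ g.endo x (g.einstein x) ∘ₗ (𝓑.horizontal g x).subtype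

/-- `D` is a fluid domain with apparent field `X₀` and energy density `μ`: at each point of `D` the
endomorphism `ᵉG_H` has the eigenvalue `-μ < 0`, with eigenspace the line of the unit timelike
vector `X₀`. -/
structure IsFluidDomain (D : Set M) (X₀ : ∀ x : M, TangentSpace (𝓡 (5 + m)) x) (μ : M → ℝ) :
    Prop where
  isOpen : IsOpen D
  smooth : SmoothFieldOn D X₀
  unit : ∀ x ∈ D, g.inner x (X₀ x) (X₀ x) = -1
  pos : ∀ x ∈ D, 0 < μ x
  eigenspace : ∀ x ∈ D, (End.eigenspace (𝓑.einsteinHor g x) (-μ x)).map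
    (𝓑.horizontal g x).subtype = Submodule.span ℝ {X₀ x}

end MultiFiberBundle

section Fluid

variable {n : ℕ} {M : Type*} [TopologicalSpace M] [ChartedSpace (EuclideanSpace ℝ (Fin n)) M]
  [IsManifold (𝓡 n) ∞ M] (g : SemiRiemannianMetric n M) (Y X₀ : ∀ x : M, TangentSpace (𝓡 n) x)

/-- The charge density `e = G(X₀, Y)`. -/
noncomputable def chargeDensity (x : M) : ℝ := g.einstein x (X₀ x) (Y x)

/-- The vector field of the fluid, `X = X₀ + (e / μ) Y`. -/
noncomputable def fluidField (μ : M → ℝ) (x : M) : TangentSpace (𝓡 n) x :=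
  X₀ x + (chargeDensity g Y X₀ x / μ x) • Y x

/-- The orthogonal projection of `T_x M` onto the time-plane spanned by the orthogonal vectors `X₀`
and `Y` with `⟨X₀, X₀⟩ = ⟨Y, Y⟩ = -1`. -/
noncomputable def timePlaneProj (x : M) : End ℝ (TangentSpace (𝓡 n) x) :=
  -((g.flat x (X₀ x)).smulRight (X₀ x) + (g.flat x (Y x)).smulRight (Y x))

/-- The pressure `P = G - G|_T`, where `G|_T` is the restriction of `G` to the time-plane. -/
noncomputable def pressure (x : M) : LinearMap.BilinForm ℝ (TangentSpace (𝓡 n) x) :=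
  g.einstein x
    - (g.einstein x).compl₁₂ (timePlaneProj g Y X₀ x) (timePlaneProj g Y X₀ x)

/-- The fluid is perfect and isentropic on `D`: `ᵉP(Y) = 0` and
`P = p (g + X₀ ⊗ X₀ + Y ⊗ Y)` with `p` smooth on `D`. -/
structure IsPerfectIsentropic (D : Set M) (p : M → ℝ) : Prop where
  smooth : ContMDiffOn (𝓡 n) 𝓘(ℝ) ∞ p D
  perfect : ∀ x ∈ D, g.endo x (pressure g Y X₀ x) (Y x) = 0
  isentropic : ∀ x ∈ D, ∀ v w : TangentSpace (𝓡 n) x,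
    pressure g Y X₀ x v w = p x * (g.inner x v w + g.flat x (X₀ x) v * g.flat x (X₀ x) w
      + g.flat x (Y x) v * g.flat x (Y x) w)

end Fluid

end KaluzaKlein

open KaluzaKlein

/-! Write `T` for the field X₀ and c = G(Y, Y). The eigenvector condition gives G(T, T) = μ, and T ⟂
Y because T is horizontal and Y vertical. The isentropic condition then determines the whole tensor:
G = (μ+p) T⊗T + e (T⊗Y + Y⊗T) + (c+p) Y⊗Y + p g. Everything else follows from three facts about G
and Y.

The tensor G is divergence free, by the contracted second Bianchi identity (`div_einst`).
Contracting with W gives one scalar equation `div_eq`: W = T yields conservation of energy, W = Y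
conservation of charge, and a general W the equation of motion. The evolution of e/μ combines the
two conservation laws.

The flow of the Killing field Y preserves the metric, hence G (`lie_einst`). Evaluated on T and Y
this shows that μ, e and c are constant along Y and that e [Y, T] = 0; its trace gives Y(p) = 0,
since the dimension is not 2. The equation e [Y, T] = 0 makes the terms e ∇_T Y and e ∇_Y T of
`div_eq` equal, and together they form the Lorentz force.

The second covariant derivative of Y is R(U, Y)V (`hessian`), so its trace is -Ric(Y). As F(V, W) =
2⟨∇_V Y, W⟩, the divergence of F is -2 Ric(Y), which the shape of G turns into e T + (c - S) Y.
Since Y has constant length, c - S = 2 Ric(Y, Y) = |F|/2. The other Maxwell equation is d² = 0.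

These computations are done in `LeviCivitaAlgebra`, where functions form a commutative ring and
fields a module with a frame, so that tensor identities become ring identities. Smooth functions and
fields on the part of D inside a chart domain form such an algebra (`algebraOn`), and the `_val`
lemmas identify its operations with the pointwise definitions of the statement. -/

set_option linter.unusedSectionVars false

/-! ### Curvature and the Bianchi identities over a ring of functions -/

namespace KaluzaKlein

/-- A ring of functions has zero divisors, so 2 is cancelled through the scalar action of ℝ. -/
lemma eq_of_two_mul {A : Type*} [CommRing A] [Algebra ℝ A] {a b : A} (h : 2 * a = 2 * b) :
    a = b := by
  have h1 : (2 : ℝ) • a = (2 : ℝ) • b := by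
    rw [Algebra.smul_def, Algebra.smul_def, map_ofNat]; exact h
  exact smul_right_injective A (two_ne_zero (α := ℝ)) h1

/-- A module `𝔛` of vector fields over a ring `A` of functions with a nondegenerate metric and its
Levi-Civita connection, together with a frame and its dual frame. -/
structure LeviCivitaAlgebra (A 𝔛 ι : Type*) [CommRing A] [AddCommGroup 𝔛] [Module A 𝔛]
    [Fintype ι] [DecidableEq ι] where
  act : 𝔛 →ₗ[A] A →+ A
  nabla : 𝔛 →ₗ[A] 𝔛 →+ 𝔛
  metric : 𝔛 →ₗ[A] 𝔛 →ₗ[A] A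
  frame : ι → 𝔛
  coframe : ι → 𝔛
  act_mul (X : 𝔛) (a b : A) : act X (a * b) = act X a * b + a * act X b
  nabla_smul (X : 𝔛) (a : A) (V : 𝔛) : nabla X (a • V) = act X a • V + a • nabla X V
  symm (V W : 𝔛) : metric V W = metric W V
  compat (X V W : 𝔛) : act X (metric V W) = metric (nabla X V) W + metric V (nabla X W)
  dual (i j : ι) : metric (frame i) (coframe j) = if i = j then 1 else 0
  expand (V : 𝔛) : V = ∑ i, metric V (coframe i) • frame i
  -- The bracket is not a separate datum: it is ∇_X V - ∇_V X, so the torsion vanishes by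
  -- construction and the Jacobi identity becomes the axiom.
  bracket_bracket (X V W : 𝔛) :
    (nabla X (nabla V W - nabla W V) - nabla (nabla V W - nabla W V) X)
      + (nabla V (nabla W X - nabla X W) - nabla (nabla W X - nabla X W) V)
      + (nabla W (nabla X V - nabla V X) - nabla (nabla X V - nabla V X) W) = 0

namespace LeviCivitaAlgebra

variable {A 𝔛 ι : Type*} [CommRing A] [AddCommGroup 𝔛] [Module A 𝔛]
    [Fintype ι] [DecidableEq ι] (L : LeviCivitaAlgebra A 𝔛 ι)

lemma act_one (X : 𝔛) : L.act X 1 = 0 := by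
  have := L.act_mul X 1 1
  simpa using this

lemma eq_of_metric {V W : 𝔛} (h : ∀ Z, L.metric V Z = L.metric W Z) : V = W := by
  rw [L.expand V, L.expand W]
  simp [h]

lemma metric_eq_sum (V W : 𝔛) :
    L.metric V W = ∑ i, L.metric V (L.coframe i) * L.metric (L.frame i) W := by
  conv_lhs => rw [L.expand V]
  simp

lemma expand' (V : 𝔛) : V = ∑ i, L.metric V (L.frame i) • L.coframe i := by
  refine L.eq_of_metric fun Z ↦ ?_
  rw [L.symm V, L.metric_eq_sum]
  simp only [map_sum, LinearMap.sum_apply, map_smul, LinearMap.smul_apply, smul_eq_mul]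
  exact Finset.sum_congr rfl fun i _ ↦ by rw [L.symm V, L.symm Z, mul_comm]

/-- The metric contraction of a bilinear form. -/
def contract (B : 𝔛 →ₗ[A] 𝔛 →ₗ[A] A) : A := ∑ i, B (L.frame i) (L.coframe i)

/-- Both sums equal ∑ ⟨E_i, E_j⟩ B(E^j, E^i), by the symmetry of the metric. -/
lemma contract_comm (B : 𝔛 →ₗ[A] 𝔛 →ₗ[A] A) :
    L.contract B = ∑ i, B (L.coframe i) (L.frame i) := by
  have h (i : ι) : B (L.frame i) (L.coframe i)
      = ∑ j, L.metric (L.frame i) (L.frame j) * B (L.coframe j) (L.coframe i) := by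
    conv_lhs => rw [L.expand' (L.frame i)]
    simp
  have h' (j : ι) : B (L.coframe j) (L.frame j)
      = ∑ i, L.metric (L.frame i) (L.frame j) * B (L.coframe j) (L.coframe i) := by
    conv_lhs => rw [L.expand' (L.frame j)]
    simp [L.symm (L.frame j)]
  simp only [contract, h, h']
  exact Finset.sum_comm

/-- The inverse metric is invariant under every operator that preserves the metric. -/
lemma contract_parallel (δ : 𝔛 →+ 𝔛) (d : A →+ A) (hd : d 1 = 0)
    (h : ∀ V W, d (L.metric V W) = L.metric (δ V) W + L.metric V (δ W))
    (B : 𝔛 →ₗ[A] 𝔛 →ₗ[A] A) :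
    ∑ i, (B (δ (L.frame i)) (L.coframe i) + B (L.frame i) (δ (L.coframe i))) = 0 := by
  -- The pairing of frame and coframe is 0 or 1, so its derivative vanishes: the matrix of δ on the
  -- coframe is minus the transpose of its matrix on the frame.
  have hij (i j : ι) : L.metric (δ (L.coframe i)) (L.frame j)
      = - L.metric (δ (L.frame j)) (L.coframe i) := by
    have h1 := h (L.frame j) (L.coframe i)
    have h2 : d (L.metric (L.frame j) (L.coframe i)) = 0 := by
      rw [L.dual]; split_ifs <;> simp [hd]
    rw [h2, L.symm (L.frame j)] at h1
    linear_combination -h1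
  have h1 (j : ι) : B (δ (L.frame j)) (L.coframe j)
      = ∑ i, L.metric (δ (L.frame j)) (L.coframe i) * B (L.frame i) (L.coframe j) := by
    conv_lhs => rw [L.expand (δ (L.frame j))]
    simp
  have h2 (i : ι) : B (L.frame i) (δ (L.coframe i))
      = ∑ j, - (L.metric (δ (L.frame j)) (L.coframe i) * B (L.frame i) (L.coframe j)) := by
    conv_lhs => rw [L.expand' (δ (L.coframe i))]
    simp [hij]
  rw [Finset.sum_add_distrib]
  simp only [h1, h2]
  rw [Finset.sum_comm, ← Finset.sum_add_distrib]
  refine Finset.sum_eq_zero fun i _ ↦ ?_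
  rw [← Finset.sum_add_distrib]
  exact Finset.sum_eq_zero fun j _ ↦ by ring

/-- The Lie bracket, expressed by the torsion-free connection. -/
def bracket (X V : 𝔛) : 𝔛 := L.nabla X V - L.nabla V X

lemma bracket_smul (X : 𝔛) (a : A) (V : 𝔛) :
    L.bracket X (a • V) = L.act X a • V + a • L.bracket X V := by
  simp only [bracket, L.nabla_smul, map_smul, AddMonoidHom.smul_apply, smul_sub]
  abel

lemma bracket_swap (X V : 𝔛) : L.bracket X V = - L.bracket V X := by
  simp [bracket]

lemma bracket_add (X V W : 𝔛) : L.bracket X (V + W) = L.bracket X V + L.bracket X W := by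
  simp only [bracket, map_add, AddMonoidHom.add_apply]
  abel

lemma bracket_jacobi (X V W : 𝔛) :
    L.bracket X (L.bracket V W) = L.bracket (L.bracket X V) W + L.bracket V (L.bracket X W) := by
  have h := L.bracket_bracket X V W
  have e : L.bracket V (L.bracket X W) = - L.bracket V (L.bracket W X) := by
    rw [L.bracket_swap X W]
    simp only [bracket, map_neg, AddMonoidHom.neg_apply]
    abel
  rw [e, L.bracket_swap (L.bracket X V) W]
  change L.bracket X (L.bracket V W) + L.bracket V (L.bracket W X) + L.bracket W (L.bracket X V)
    = 0 at h
  rw [← sub_eq_zero, ← h]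
  abel

/-- The Jacobi identity for X, V and aZ, expanded by the Leibniz rule; the terms where a is not
differentiated twice cancel. -/
lemma act_smul_bracket (X V : 𝔛) (a : A) (Z : 𝔛) :
    L.act (L.bracket X V) a • Z = (L.act X (L.act V a) - L.act V (L.act X a)) • Z := by
  have h := L.bracket_jacobi X V (a • Z)
  simp only [L.bracket_smul, L.bracket_add, L.bracket_jacobi X V Z, smul_add] at h
  rw [← sub_eq_zero] at h ⊢
  rw [← neg_eq_zero, ← h, sub_smul]
  abel

lemma act_bracket (X V : 𝔛) (a : A) :
    L.act (L.bracket X V) a = L.act X (L.act V a) - L.act V (L.act X a) := by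
  have key (U : 𝔛) : ∀ i, L.metric U (L.coframe i) *
      (L.act (L.bracket X V) a - (L.act X (L.act V a) - L.act V (L.act X a))) = 0 := by
    intro i
    have h := congrArg (fun W ↦ L.metric W U) (L.act_smul_bracket X V a (L.coframe i))
    simp only [map_smul, LinearMap.smul_apply, smul_eq_mul, L.symm (L.coframe i)] at h
    linear_combination h
  -- An empty frame spans the zero module, where both sides vanish; otherwise the pairing of a frame
  -- vector with its dual supplies the coefficient 1.
  rcases isEmpty_or_nonempty ι with hι | ⟨⟨i⟩⟩
  · have z (U : 𝔛) : U = 0 := by rw [L.expand U]; simp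
    rw [z (L.bracket X V), z X, z V]
    simp
  · have h := key (L.frame i) i
    rw [L.dual, if_pos rfl] at h
    linear_combination h

/-- The curvature. -/
def curv (U V W : 𝔛) : 𝔛 :=
  L.nabla U (L.nabla V W) - L.nabla V (L.nabla U W) - L.nabla (L.bracket U V) W

lemma curv_skew (U V W : 𝔛) : L.curv U V W = - L.curv V U W := by
  simp only [curv, bracket, map_sub, AddMonoidHom.sub_apply]
  abel

@[simp] lemma curv_add_right (U V W Z : 𝔛) :
    L.curv U V (W + Z) = L.curv U V W + L.curv U V Z := by
  simp only [curv, map_add]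
  abel

@[simp] lemma curv_smul_right (U V : 𝔛) (a : A) (W : 𝔛) :
    L.curv U V (a • W) = a • L.curv U V W := by
  simp only [curv, L.nabla_smul, map_add, L.act_bracket, sub_smul, smul_sub]
  abel

@[simp] lemma curv_add_left (U V W Z : 𝔛) :
    L.curv (U + V) W Z = L.curv U W Z + L.curv V W Z := by
  simp only [curv, bracket, map_add, map_sub, AddMonoidHom.add_apply, AddMonoidHom.sub_apply]
  abel

@[simp] lemma curv_smul_left (a : A) (U W Z : 𝔛) :
    L.curv (a • U) W Z = a • L.curv U W Z := by
  simp only [curv, bracket, map_smul, map_add, map_sub, AddMonoidHom.add_apply,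
    AddMonoidHom.sub_apply, AddMonoidHom.smul_apply, L.nabla_smul, smul_sub]
  abel

@[simp] lemma curv_add_mid (U V W Z : 𝔛) :
    L.curv U (V + W) Z = L.curv U V Z + L.curv U W Z := by
  rw [curv_skew, curv_add_left, L.curv_skew U V, L.curv_skew U W]; abel

@[simp] lemma curv_smul_mid (a : A) (U V Z : 𝔛) :
    L.curv U (a • V) Z = a • L.curv U V Z := by
  rw [curv_skew, curv_smul_left, L.curv_skew U V]; simp

/-- With zero torsion, the Jacobi identity written out in covariant derivatives is exactly this
cyclic sum. -/
lemma curv_bianchi (U V W : 𝔛) : L.curv U V W + L.curv V W U + L.curv W U V = 0 := by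
  rw [← L.bracket_bracket U V W]
  simp only [curv, bracket, map_sub, AddMonoidHom.sub_apply]
  abel

/-- The covariant curvature tensor. -/
def riem (U V W Z : 𝔛) : A := L.metric (L.curv U V W) Z

lemma riem_skew (U V W Z : 𝔛) : L.riem U V W Z = - L.riem V U W Z := by
  rw [riem, curv_skew]; simp [riem]

lemma riem_bianchi (U V W Z : 𝔛) : L.riem U V W Z + L.riem V W U Z + L.riem W U V Z = 0 := by
  have := congrArg (fun T ↦ L.metric T Z) (L.curv_bianchi U V W)
  simpa [riem] using this

/-- The operator UV - VU - [U, V] kills the function ⟨W, Z⟩; metric compatibility turns this into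
the skewness of R(U, V). -/
lemma riem_skew' (U V W Z : 𝔛) : L.riem U V W Z = - L.riem U V Z W := by
  have h := L.act_bracket U V (L.metric W Z)
  simp only [L.compat, map_add] at h
  simp only [riem, curv, map_sub, LinearMap.sub_apply]
  rw [L.symm (L.nabla U (L.nabla V Z)), L.symm (L.nabla V (L.nabla U Z)),
    L.symm (L.nabla (L.bracket U V) Z)]
  linear_combination -h

/-- The covariant derivative of the curvature. -/
def nablaCurv (X U V W : 𝔛) : 𝔛 :=
  L.nabla X (L.curv U V W) - L.curv (L.nabla X U) V W - L.curv U (L.nabla X V) W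
    - L.curv U V (L.nabla X W)

/-- Nested commutators of the operators ∇ cancel identically; what remains is ∇ along the Jacobi sum
of the brackets, which is zero. -/
lemma nablaCurv_bianchi (X U V W : 𝔛) :
    L.nablaCurv X U V W + L.nablaCurv U V X W + L.nablaCurv V X U W = 0 := by
  have h := congrArg (fun T ↦ L.nabla T W) (L.bracket_bracket X U V)
  simp only [map_add, map_sub, AddMonoidHom.add_apply, AddMonoidHom.sub_apply, map_zero,
    AddMonoidHom.zero_apply] at h
  simp only [nablaCurv, curv, bracket, map_sub, AddMonoidHom.sub_apply]
  rw [← neg_eq_zero, ← h]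
  abel

/-- The covariant derivative of the covariant curvature tensor. -/
def nablaRiem (X U V W Z : 𝔛) : A := L.metric (L.nablaCurv X U V W) Z

lemma nablaRiem_eq (X U V W Z : 𝔛) : L.nablaRiem X U V W Z =
    L.act X (L.riem U V W Z) - L.riem (L.nabla X U) V W Z - L.riem U (L.nabla X V) W Z
      - L.riem U V (L.nabla X W) Z - L.riem U V W (L.nabla X Z) := by
  simp only [nablaRiem, nablaCurv, riem, L.compat, map_sub, LinearMap.sub_apply]
  ring

lemma nablaRiem_bianchi (X U V W Z : 𝔛) :
    L.nablaRiem X U V W Z + L.nablaRiem U V X W Z + L.nablaRiem V X U W Z = 0 := by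
  have := congrArg (fun T ↦ L.metric T Z) (L.nablaCurv_bianchi X U V W)
  simpa [nablaRiem] using this

lemma nablaRiem_skew (X U V W Z : 𝔛) : L.nablaRiem X U V W Z = - L.nablaRiem X V U W Z := by
  simp only [nablaRiem_eq, L.riem_skew V, L.riem_skew (L.nabla X V), map_neg]
  ring

/-- The Ricci curvature. -/
def ric (V W : 𝔛) : A := ∑ i, L.riem (L.frame i) V W (L.coframe i)

@[simp] lemma ric_add_left (V V' W : 𝔛) : L.ric (V + V') W = L.ric V W + L.ric V' W := by
  simp [ric, riem, Finset.sum_add_distrib]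

@[simp] lemma ric_smul_left (a : A) (V W : 𝔛) : L.ric (a • V) W = a * L.ric V W := by
  simp [ric, riem, Finset.mul_sum]

@[simp] lemma ric_add_right (V W W' : 𝔛) : L.ric V (W + W') = L.ric V W + L.ric V W' := by
  simp [ric, riem, Finset.sum_add_distrib]

@[simp] lemma ric_smul_right (a : A) (V W : 𝔛) : L.ric V (a • W) = a * L.ric V W := by
  simp [ric, riem, Finset.mul_sum]

lemma ric_eq_coframe (V W : 𝔛) : L.ric V W = ∑ i, L.riem (L.coframe i) V W (L.frame i) :=
  L.contract_comm (LinearMap.mk₂ A (fun U Z ↦ L.riem U V W Z) (by simp [riem]) (by simp [riem])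
    (by simp [riem]) (by simp [riem]))

/-- A derivation of vector fields that preserves the metric satisfies the Leibniz rule for the
Ricci contraction of the curvature. -/
lemma derivation_ric (δ : 𝔛 →+ 𝔛) (d : A →+ A) (hd : d 1 = 0)
    (h : ∀ V W, d (L.metric V W) = L.metric (δ V) W + L.metric V (δ W)) (V W : 𝔛) :
    d (L.ric V W) = ∑ i, (d (L.riem (L.frame i) V W (L.coframe i))
      - L.riem (δ (L.frame i)) V W (L.coframe i) - L.riem (L.frame i) V W (δ (L.coframe i))) := by
  have := L.contract_parallel δ d hd h (LinearMap.mk₂ A (fun U Z ↦ L.riem U V W Z)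
    (by simp [riem]) (by simp [riem]) (by simp [riem]) (by simp [riem]))
  change ∑ i, (L.riem (δ (L.frame i)) V W (L.coframe i)
    + L.riem (L.frame i) V W (δ (L.coframe i))) = 0 at this
  rw [ric, map_sum, ← sub_zero (∑ i, _), ← this, ← Finset.sum_sub_distrib]
  exact Finset.sum_congr rfl fun i _ ↦ by ring

/-- The covariant derivative of the Ricci curvature. -/
def nablaRic (X V W : 𝔛) : A :=
  L.act X (L.ric V W) - L.ric (L.nabla X V) W - L.ric V (L.nabla X W)

lemma nablaRic_eq (X V W : 𝔛) :
    L.nablaRic X V W = ∑ i, L.nablaRiem X (L.frame i) V W (L.coframe i) := by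
  rw [nablaRic, L.derivation_ric (L.nabla X) (L.act X) (L.act_one X) (L.compat X), ric, ric,
    ← Finset.sum_sub_distrib, ← Finset.sum_sub_distrib]
  exact Finset.sum_congr rfl fun i _ ↦ by rw [nablaRiem_eq]; ring

lemma nablaRic_eq_coframe (X V W : 𝔛) :
    L.nablaRic X V W = ∑ i, L.nablaRiem X (L.coframe i) V W (L.frame i) := by
  rw [nablaRic_eq]
  refine L.contract_comm (LinearMap.mk₂ A (fun U Z ↦ L.nablaRiem X U V W Z) ?_ ?_ ?_ ?_)
  · intros; simp only [nablaRiem_eq, riem, curv_add_left, map_add, LinearMap.add_apply]; ring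
  -- The term X(a) from the product rule cancels the one from ∇_X(aU), so ∇R is linear over
  -- functions in this slot.
  · intros
    simp only [nablaRiem_eq, riem, curv_smul_left, map_smul, LinearMap.smul_apply, L.nabla_smul,
      curv_add_left, map_add, LinearMap.add_apply, smul_eq_mul, L.act_mul]
    ring
  · intros; simp only [nablaRiem, map_add]
  · intros; simp only [nablaRiem, map_smul]

/-- The scalar curvature. -/
def scal : A := ∑ i, L.ric (L.frame i) (L.coframe i)

lemma derivation_scal (δ : 𝔛 →+ 𝔛) (d : A →+ A) (hd : d 1 = 0)
    (h : ∀ V W, d (L.metric V W) = L.metric (δ V) W + L.metric V (δ W)) :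
    d L.scal = ∑ i, (d (L.ric (L.frame i) (L.coframe i))
      - L.ric (δ (L.frame i)) (L.coframe i) - L.ric (L.frame i) (δ (L.coframe i))) := by
  have := L.contract_parallel δ d hd h (LinearMap.mk₂ A (fun U Z ↦ L.ric U Z)
    (by simp) (by simp) (by simp) (by simp))
  simp only [LinearMap.mk₂_apply] at this
  rw [scal, map_sum, ← sub_zero (∑ i, _), ← this, ← Finset.sum_sub_distrib]
  exact Finset.sum_congr rfl fun i _ ↦ by ring

lemma act_scal (X : 𝔛) : L.act X L.scal = ∑ i, L.nablaRic X (L.frame i) (L.coframe i) :=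
  L.derivation_scal (L.nabla X) (L.act X) (L.act_one X) (L.compat X)

/-- The Einstein curvature `2 Ric - S g`. -/
def einst (V W : 𝔛) : A := 2 * L.ric V W - L.scal * L.metric V W

/-- The divergence of a vector field. -/
def div (V : 𝔛) : A := ∑ i, L.metric (L.nabla (L.frame i) V) (L.coframe i)

lemma div_add (V W : 𝔛) : L.div (V + W) = L.div V + L.div W := by
  simp [div, Finset.sum_add_distrib]

lemma act_eq_sum (V : 𝔛) (a : A) :
    L.act V a = ∑ i, L.metric V (L.coframe i) * L.act (L.frame i) a := by
  conv_lhs => rw [L.expand V]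
  simp [AddMonoidHom.finsetSum_apply]

lemma div_smul (a : A) (V : 𝔛) : L.div (a • V) = L.act V a + a * L.div V := by
  simp only [div, L.nabla_smul, L.act_eq_sum V, map_add, LinearMap.add_apply, map_smul,
    LinearMap.smul_apply, smul_eq_mul, Finset.sum_add_distrib, Finset.mul_sum]
  congr 1
  exact Finset.sum_congr rfl fun i _ ↦ by ring

section Symmetries

variable [Algebra ℝ A]

/-- The classical octahedron argument: four first Bianchi sums, combined by skewness in each pair of
slots, leave twice the desired difference. -/
lemma riem_pair (U V W Z : 𝔛) : L.riem U V W Z = L.riem W Z U V := by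
  refine eq_of_two_mul ?_
  linear_combination (L.riem_bianchi U V W Z) + (L.riem_bianchi V W Z U)
    - (L.riem_bianchi W Z U V) - (L.riem_bianchi Z U V W)
    - L.riem_skew' V W U Z - L.riem_skew' W Z U V - L.riem_skew W U V Z + L.riem_skew' U W V Z
    + L.riem_skew' Z U V W + L.riem_skew' U V W Z + L.riem_skew' V Z U W - L.riem_skew V Z W U

lemma ric_comm (V W : 𝔛) : L.ric V W = L.ric W V := by
  rw [ric, L.ric_eq_coframe W V]
  refine Finset.sum_congr rfl fun i _ ↦ ?_
  rw [riem_pair, riem_skew, riem_skew', neg_neg]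

lemma nablaRiem_pair (X U V W Z : 𝔛) : L.nablaRiem X U V W Z = L.nablaRiem X W Z U V := by
  simp only [nablaRiem_eq]
  rw [L.riem_pair U V W Z, L.riem_pair (L.nabla X U), L.riem_pair U (L.nabla X V),
    L.riem_pair U V (L.nabla X W), L.riem_pair U V W (L.nabla X Z)]
  ring

lemma nablaRic_comm (X V W : 𝔛) : L.nablaRic X V W = L.nablaRic X W V := by
  simp only [nablaRic]
  rw [L.ric_comm V W, L.ric_comm (L.nabla X V), L.ric_comm V]
  ring

/-- The contracted second Bianchi identity. -/
lemma two_mul_div_ric (W : 𝔛) :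
    2 * ∑ i, L.nablaRic (L.frame i) (L.coframe i) W = L.act W L.scal := by
  -- The second Bianchi identity for E_i, W, E_j, contracted with E^j and E^i. The outer terms each
  -- sum to the divergence of Ric, the middle one to the derivative of the scalar curvature.
  have h : ∑ i, ∑ j, (L.nablaRiem (L.frame i) (L.coframe j) (L.coframe i) W (L.frame j)
      - L.nablaRiem W (L.frame i) (L.frame j) (L.coframe j) (L.coframe i)
      + L.nablaRiem (L.frame j) (L.frame i) W (L.coframe j) (L.coframe i)) = 0 := by
    refine Finset.sum_eq_zero fun i _ ↦ Finset.sum_eq_zero fun j _ ↦ ?_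
    rw [← L.nablaRiem_bianchi (L.frame i) W (L.frame j) (L.coframe j) (L.coframe i),
      L.nablaRiem_pair (L.frame i) W, L.nablaRiem_skew W (L.frame i)]
    ring
  simp only [Finset.sum_add_distrib, Finset.sum_sub_distrib, ← nablaRic_eq_coframe] at h
  rw [Finset.sum_comm (f := fun i j ↦ L.nablaRiem W _ _ _ _),
    Finset.sum_comm (f := fun i j ↦ L.nablaRiem (L.frame j) _ _ _ _)] at h
  simp only [← nablaRic_eq, ← act_scal] at h
  rw [Finset.sum_congr rfl fun i _ ↦ L.nablaRic_comm (L.frame i) W (L.coframe i)] at h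
  linear_combination h

/-- The Einstein curvature is divergence free. -/
lemma div_einst (W : 𝔛) :
    ∑ i, (L.act (L.frame i) (L.einst (L.coframe i) W)
      - L.einst (L.nabla (L.frame i) (L.coframe i)) W
      - L.einst (L.coframe i) (L.nabla (L.frame i) W)) = 0 := by
  have h (i : ι) : L.act (L.frame i) (L.einst (L.coframe i) W)
      - L.einst (L.nabla (L.frame i) (L.coframe i)) W
      - L.einst (L.coframe i) (L.nabla (L.frame i) W)
      = 2 * L.nablaRic (L.frame i) (L.coframe i) W
        - L.metric W (L.coframe i) * L.act (L.frame i) L.scal := by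
    simp only [einst, nablaRic, two_mul, map_sub, map_add, L.act_mul, L.compat,
      L.symm W (L.coframe i)]
    ring
  simp only [h, Finset.sum_sub_distrib, ← Finset.mul_sum, ← act_eq_sum, two_mul_div_ric, sub_self]

end Symmetries

end LeviCivitaAlgebra
end KaluzaKlein

/-! ### Killing fields and the invariance of curvature -/

namespace KaluzaKlein
namespace LeviCivitaAlgebra

variable {A 𝔛 ι : Type*} [CommRing A] [AddCommGroup 𝔛] [Module A 𝔛]
    [Fintype ι] [DecidableEq ι] (L : LeviCivitaAlgebra A 𝔛 ι)

/-- `Y` is a Killing vector field. -/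
def IsKilling (Y : 𝔛) : Prop :=
  ∀ V W, L.metric (L.nabla V Y) W + L.metric V (L.nabla W Y) = 0

/-- The Lie derivative of vector fields. -/
def lie (Y : 𝔛) : 𝔛 →+ 𝔛 := AddMonoidHom.mk' (L.bracket Y) (L.bracket_add Y)

lemma lie_apply (Y V : 𝔛) : L.lie Y V = L.bracket Y V := rfl

variable {L} {Y : 𝔛}

lemma IsKilling.act_metric (hY : L.IsKilling Y) (V W : 𝔛) :
    L.act Y (L.metric V W) = L.metric (L.bracket Y V) W + L.metric V (L.bracket Y W) := by
  simp only [L.compat, bracket, map_sub, LinearMap.sub_apply]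
  linear_combination hY V W

/-- The derivative along U of the Killing equation, less the Killing equation for the differentiated
arguments. -/
lemma IsKilling.hessian_skew (hY : L.IsKilling Y) (U V W : 𝔛) :
    L.metric (L.nabla U (L.nabla V Y) - L.nabla (L.nabla U V) Y) W
      = - L.metric (L.nabla U (L.nabla W Y) - L.nabla (L.nabla U W) Y) V := by
  have h := congrArg (L.act U) (hY V W)
  simp only [map_add, L.compat, map_zero] at h
  simp only [map_sub, LinearMap.sub_apply]
  have h1 := hY (L.nabla U V) W
  have h2 := hY V (L.nabla U W)
  rw [L.symm V] at h2
  rw [L.symm V] at h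
  rw [L.symm (L.nabla U (L.nabla W Y)), L.symm (L.nabla (L.nabla U W) Y)]
  rw [L.symm (L.nabla (L.nabla U W) Y)] at h2
  rw [L.symm (L.nabla U (L.nabla W Y))] at h
  linear_combination h - h1 - h2

lemma hessian_sub (U V : 𝔛) :
    (L.nabla U (L.nabla V Y) - L.nabla (L.nabla U V) Y)
      - (L.nabla V (L.nabla U Y) - L.nabla (L.nabla V U) Y) = L.curv U V Y := by
  simp only [curv, bracket, map_sub, AddMonoidHom.sub_apply]
  abel

/-- The contraction of the second derivative of a Killing field is minus the Ricci curvature,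
up to the following identity for the full second derivative. -/
lemma IsKilling.hessian [Algebra ℝ A] (hY : L.IsKilling Y) (U V : 𝔛) :
    L.nabla U (L.nabla V Y) - L.nabla (L.nabla U V) Y = L.curv U Y V := by
  refine L.eq_of_metric fun W ↦ eq_of_two_mul ?_
  -- The covariant Hessian of Y is skew in its last two slots, and its skew part in the first two is
  -- curvature. As in the derivation of the Koszul formula, three cyclic copies isolate twice the
  -- Hessian; the first Bianchi identity and pair symmetry simplify the curvature terms.
  have s (U V : 𝔛) (Z : 𝔛) := congrArg (fun T ↦ L.metric T Z) (L.hessian_sub (Y := Y) U V)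
  have s1 := s U V W
  have s2 := s V W U
  have s3 := s W U V
  have k1 := hY.hessian_skew U V W
  have k2 := hY.hessian_skew V W U
  have k3 := hY.hessian_skew W U V
  simp only [map_sub (L.metric) (_ - _) (_ - _), LinearMap.sub_apply (L.metric (_ - _))] at s1 s2 s3
  change _ = L.riem U V Y W at s1
  change _ = L.riem V W Y U at s2
  change _ = L.riem W U Y V at s3
  change _ = 2 * L.riem U Y V W
  have b := L.riem_bianchi U V W Y
  rw [L.riem_skew' U V W Y, L.riem_skew' V W U Y, L.riem_skew' W U V Y] at b
  have c := L.riem_pair U Y V W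
  linear_combination s1 - s2 + s3 - b + k1 - 2 * c + k2 - k3 - 2 * L.riem_skew' V W Y U

/-- The Lie derivative of the connection, evaluated on V and W, is the Hessian of Y at (V, W) plus
R(Y, V)W, and these cancel by `hessian`. -/
lemma IsKilling.lie_nabla [Algebra ℝ A] (hY : L.IsKilling Y) (V W : 𝔛) :
    L.bracket Y (L.nabla V W) = L.nabla (L.bracket Y V) W + L.nabla V (L.bracket Y W) := by
  have h := hY.hessian V W
  have h' : L.curv Y V W + L.curv V Y W = 0 := by rw [L.curv_skew Y V]; abel
  rw [← h] at h'
  rw [← sub_eq_zero, ← h']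
  simp only [curv, bracket, map_sub, AddMonoidHom.sub_apply]
  abel

/-- Curvature is built from ∇ and the bracket, and the Lie derivative along Y satisfies the Leibniz
rule for both, by `lie_nabla` and the Jacobi identity. -/
lemma IsKilling.lie_curv [Algebra ℝ A] (hY : L.IsKilling Y) (U V W : 𝔛) :
    L.bracket Y (L.curv U V W) = L.curv (L.bracket Y U) V W + L.curv U (L.bracket Y V) W
      + L.curv U V (L.bracket Y W) := by
  have sub (V W : 𝔛) : L.bracket Y (V - W) = L.bracket Y V - L.bracket Y W := map_sub (L.lie Y) V W
  have j := congrArg (fun T ↦ L.nabla T W) (L.bracket_jacobi Y U V)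
  simp only [map_add, AddMonoidHom.add_apply] at j
  simp only [curv, sub, hY.lie_nabla, j, map_add]
  abel

lemma IsKilling.lie_riem [Algebra ℝ A] (hY : L.IsKilling Y) (U V W Z : 𝔛) :
    L.act Y (L.riem U V W Z) = L.riem (L.bracket Y U) V W Z + L.riem U (L.bracket Y V) W Z
      + L.riem U V (L.bracket Y W) Z + L.riem U V W (L.bracket Y Z) := by
  simp only [riem, hY.act_metric, hY.lie_curv, map_add, LinearMap.add_apply]

lemma IsKilling.lie_ric [Algebra ℝ A] (hY : L.IsKilling Y) (V W : 𝔛) :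
    L.act Y (L.ric V W) = L.ric (L.bracket Y V) W + L.ric V (L.bracket Y W) := by
  rw [L.derivation_ric (L.lie Y) (L.act Y) (L.act_one Y) hY.act_metric, ric, ric,
    ← Finset.sum_add_distrib]
  refine Finset.sum_congr rfl fun i _ ↦ ?_
  rw [hY.lie_riem, lie_apply, lie_apply]
  ring

lemma IsKilling.act_scal [Algebra ℝ A] (hY : L.IsKilling Y) : L.act Y L.scal = 0 := by
  rw [L.derivation_scal (L.lie Y) (L.act Y) (L.act_one Y) hY.act_metric]
  refine Finset.sum_eq_zero fun i _ ↦ ?_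
  rw [hY.lie_ric, lie_apply, lie_apply]
  ring

lemma IsKilling.lie_einst [Algebra ℝ A] (hY : L.IsKilling Y) (V W : 𝔛) :
    L.act Y (L.einst V W) = L.einst (L.bracket Y V) W + L.einst V (L.bracket Y W) := by
  simp only [einst, two_mul, map_sub, map_add, L.act_mul, hY.act_scal, hY.lie_ric, hY.act_metric]
  ring

/-- The endomorphism V ↦ ∇_V Y is skew, so its trace equals its own negative. -/
lemma IsKilling.div_eq_zero [Algebra ℝ A] (hY : L.IsKilling Y) : L.div Y = 0 := by
  have h := L.contract_comm (LinearMap.mk₂ A (fun U Z ↦ L.metric (L.nabla U Y) Z)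
    (by simp) (by simp) (by simp) (by simp))
  change L.div Y = ∑ i, L.metric (L.nabla (L.coframe i) Y) (L.frame i) at h
  have h2 : L.div Y + ∑ i, L.metric (L.nabla (L.coframe i) Y) (L.frame i) = 0 := by
    rw [div, ← Finset.sum_add_distrib]
    refine Finset.sum_eq_zero fun i _ ↦ ?_
    rw [L.symm (L.nabla (L.coframe i) Y)]
    exact hY _ _
  refine eq_of_two_mul ?_
  linear_combination h + h2

lemma IsKilling.contract_hessian [Algebra ℝ A] (hY : L.IsKilling Y) (W : 𝔛) :
    ∑ i, L.metric (L.nabla (L.frame i) (L.nabla (L.coframe i) Y)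
      - L.nabla (L.nabla (L.frame i) (L.coframe i)) Y) W = - L.ric Y W := by
  rw [ric, ← Finset.sum_neg_distrib]
  refine Finset.sum_congr rfl fun i _ ↦ ?_
  rw [hY.hessian]
  exact L.riem_skew' _ _ _ _

/-- In an abstract ring the constancy of the length r is expressed by its vanishing under every
derivation. -/
lemma metric_nabla_self [Algebra ℝ A] {r : A} (h : L.metric Y Y = r)
    (hr : ∀ V, L.act V r = 0) (V : 𝔛) : L.metric (L.nabla V Y) Y = 0 := by
  have h1 := L.compat V Y Y
  rw [h, hr, L.symm Y] at h1
  refine eq_of_two_mul ?_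
  linear_combination -h1

/-- The Killing equation moves the derivative: ⟨∇_Y Y, W⟩ = -⟨Y, ∇_W Y⟩, which is zero because the
length of Y is constant. -/
lemma IsKilling.nabla_self_self [Algebra ℝ A] (hY : L.IsKilling Y) {r : A}
    (h : L.metric Y Y = r) (hr : ∀ V, L.act V r = 0) : L.nabla Y Y = 0 := by
  refine L.eq_of_metric fun W ↦ ?_
  have h1 := hY Y W
  rw [L.symm Y, metric_nabla_self h hr] at h1
  simpa using h1

/-- Differentiating ⟨∇_V Y, Y⟩ = 0 once more trades the traced Hessian against Y for the square norm
of ∇Y. -/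
lemma IsKilling.ric_self [Algebra ℝ A] (hY : L.IsKilling Y) {r : A} (h : L.metric Y Y = r)
    (hr : ∀ V, L.act V r = 0) :
    L.ric Y Y = ∑ i, L.metric (L.nabla (L.frame i) Y) (L.nabla (L.coframe i) Y) := by
  have h1 := hY.contract_hessian Y
  rw [← neg_eq_iff_eq_neg, ← Finset.sum_neg_distrib] at h1
  rw [← h1]
  refine Finset.sum_congr rfl fun i _ ↦ ?_
  have h2 := congrArg (L.act (L.frame i)) (metric_nabla_self h hr (L.coframe i))
  rw [L.compat, map_zero, L.symm (L.nabla (L.coframe i) Y)] at h2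
  have h3 := metric_nabla_self h hr (L.nabla (L.frame i) (L.coframe i))
  rw [map_sub, LinearMap.sub_apply, h3]
  linear_combination -h2

lemma act_neg_one (V : 𝔛) : L.act V (-1) = 0 := by
  rw [map_neg, L.act_one, neg_zero]

end LeviCivitaAlgebra
end KaluzaKlein

/-! ### The equations of a perfect isentropic fluid -/

namespace KaluzaKlein
namespace LeviCivitaAlgebra

variable {A 𝔛 ι : Type*} [CommRing A] [Algebra ℝ A] [AddCommGroup 𝔛] [Module A 𝔛]
    [Fintype ι] [DecidableEq ι]

/-- The algebraic data of a perfect isentropic fluid with apparent field `T`, potential `Y`, energy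
`μ`, charge `e` and pressure `p`. -/
structure IsPerfectFluid (L : LeviCivitaAlgebra A 𝔛 ι) (T Y : 𝔛) (μ e c p : A) : Prop where
  killing : L.IsKilling Y
  unit_Y : L.metric Y Y = -1
  unit_T : L.metric T T = -1
  ortho : L.metric T Y = 0
  -- Here `c` is G(Y, Y): by the unit and orthogonality conditions, the right side at (Y, Y) is (c +
  -- p) - p.
  einst (V W : 𝔛) : L.einst V W = (μ + p) * L.metric T V * L.metric T W
    + e * (L.metric T V * L.metric Y W + L.metric Y V * L.metric T W)
    + (c + p) * L.metric Y V * L.metric Y W + p * L.metric V W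

namespace IsPerfectFluid

variable {L : LeviCivitaAlgebra A 𝔛 ι} {T Y : 𝔛} {μ e c p : A}
  (h : L.IsPerfectFluid T Y μ e c p)
include h

/-- The invariance of G under Y, expanded. Since the Lie derivatives of g and of Y vanish, only T
and the coefficients are differentiated. -/
lemma lie_eq (V W : 𝔛) :
    (L.act Y μ + L.act Y p) * L.metric T V * L.metric T W
      + (μ + p) * (L.metric (L.bracket Y T) V * L.metric T W
        + L.metric T V * L.metric (L.bracket Y T) W)
      + L.act Y e * (L.metric T V * L.metric Y W + L.metric Y V * L.metric T W)
      + e * (L.metric (L.bracket Y T) V * L.metric Y W + L.metric Y V * L.metric (L.bracket Y T) W)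
      + (L.act Y c + L.act Y p) * L.metric Y V * L.metric Y W
      + L.act Y p * L.metric V W = 0 := by
  have h1 := h.killing.lie_einst V W
  have hYY : L.bracket Y Y = 0 := sub_self _
  simp only [h.einst, map_add, L.act_mul, h.killing.act_metric, hYY, map_zero,
    LinearMap.zero_apply] at h1
  linear_combination h1

lemma metric_bracket_T : L.metric (L.bracket Y T) T = 0 := by
  have h1 := h.killing.act_metric T T
  rw [h.unit_T, L.act_neg_one, L.symm T] at h1
  refine eq_of_two_mul ?_
  linear_combination -h1

lemma metric_bracket_Y : L.metric (L.bracket Y T) Y = 0 := by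
  have h1 := h.killing.act_metric T Y
  have hYY : L.bracket Y Y = 0 := sub_self _
  rw [h.ortho, hYY] at h1
  simpa using h1.symm

/-- Evaluation on the time-plane separates the coefficients: the pressure part of G vanishes there,
so Y(p) drops out and only one coefficient derivative survives at (T, T), (T, Y) and (Y, Y). -/
lemma act_energy : L.act Y μ = 0 := by
  have h1 := h.lie_eq T T
  rw [h.metric_bracket_T, h.unit_T, L.symm Y T, h.ortho] at h1
  linear_combination h1

lemma act_charge : L.act Y e = 0 := by
  have h1 := h.lie_eq T Y
  rw [h.metric_bracket_T, h.metric_bracket_Y, h.unit_T, h.unit_Y, L.symm Y T, h.ortho] at h1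
  linear_combination h1

lemma act_coenergy : L.act Y c = 0 := by
  have h1 := h.lie_eq Y Y
  rw [h.metric_bracket_Y, h.unit_Y, h.ortho] at h1
  linear_combination h1

/-- Pairing the invariance with Y leaves only the bracket term of the mixed part of G. No
cancellation of e is needed, since the bracket enters the motion multiplied by e. -/
lemma charge_smul_bracket : e • L.bracket Y T = 0 := by
  refine L.eq_of_metric fun W ↦ ?_
  have h1 := h.lie_eq Y W
  rw [h.metric_bracket_Y, h.unit_Y, h.ortho, h.act_charge, h.act_coenergy] at h1
  simp only [map_smul, LinearMap.smul_apply, smul_eq_mul, map_zero, LinearMap.zero_apply]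
  linear_combination -h1

/-- In the trace of the invariance, p g contributes dim · Y(p), while T⊗T and Y⊗Y contribute -Y(p)
each; the factor dim - 2 is invertible. -/
lemma act_pressure (hn : Fintype.card ι ≠ 2) : L.act Y p = 0 := by
  have h1 : ∑ i, _ = (0 : A) :=
    Finset.sum_eq_zero fun i _ ↦ h.lie_eq (L.frame i) (L.coframe i)
  have key (a : A) (V W : 𝔛) : ∑ i, a * L.metric V (L.frame i) * L.metric W (L.coframe i)
      = a * L.metric V W := by
    rw [L.symm V W, L.metric_eq_sum W V, Finset.mul_sum]
    exact Finset.sum_congr rfl fun i _ ↦ by rw [L.symm V]; ring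
  have key2 : ∑ i, L.metric (L.frame i) (L.coframe i) = (Fintype.card ι : A) := by
    simp [L.dual]
  simp only [h.act_energy, h.act_charge, h.act_coenergy, mul_add, ← mul_assoc,
    Finset.sum_add_distrib, key, ← Finset.mul_sum, key2] at h1
  rw [L.symm T (L.bracket Y T), h.metric_bracket_T, h.metric_bracket_Y, h.unit_T, h.unit_Y,
    h.ortho] at h1
  have h2 : ((Fintype.card ι : ℝ) - 2) • L.act Y p = 0 := by
    rw [Algebra.smul_def, map_sub, map_ofNat, map_natCast, ← h1]
    rw [L.symm Y (L.bracket Y T), h.metric_bracket_Y, L.symm Y T, h.ortho]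
    ring
  rcases smul_eq_zero.mp h2 with h3 | h3
  · refine absurd ?_ hn
    exact_mod_cast sub_eq_zero.mp h3
  · exact h3

/-- The contraction of ∇·G = 0 with W, each product differentiated in turn. The Y⊗Y part leaves only
Y(p)⟨Y, W⟩, because Y is divergence free and geodesic and c is constant along Y. -/
lemma div_eq (W : 𝔛) :
    (L.act T (μ + p) + (μ + p) * L.div T) * L.metric T W
      + (μ + p) * L.metric (L.nabla T T) W
      + (L.act T e + e * L.div T) * L.metric Y W + e * L.metric (L.nabla T Y) W
      + e * L.metric (L.nabla Y T) W + L.act Y p * L.metric Y W + L.act W p = 0 := by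
  have h1 := L.div_einst W
  have key (a : A) (V : 𝔛) : ∑ i, a * L.metric (L.nabla (L.frame i) V) (L.coframe i)
      = a * L.div V := by rw [div, Finset.mul_sum]
  have key2 (a : A) (U V : 𝔛) : ∑ i, a * L.metric V (L.coframe i) * L.metric (L.nabla (L.frame i) U) W
      = a * L.metric (L.nabla V U) W := by
    conv_rhs => rw [L.expand V]
    simp [AddMonoidHom.finsetSum_apply, Finset.mul_sum, mul_assoc]
  have e1 : ∀ i, L.act (L.frame i) (L.einst (L.coframe i) W)
      - L.einst (L.nabla (L.frame i) (L.coframe i)) W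
      - L.einst (L.coframe i) (L.nabla (L.frame i) W)
      = L.metric T W * (L.metric T (L.coframe i) * L.act (L.frame i) (μ + p))
      + ((μ + p) * L.metric T W) * L.metric (L.nabla (L.frame i) T) (L.coframe i)
      + (μ + p) * L.metric T (L.coframe i) * L.metric (L.nabla (L.frame i) T) W
      + L.metric Y W * (L.metric T (L.coframe i) * L.act (L.frame i) e)
      + L.metric T W * (L.metric Y (L.coframe i) * L.act (L.frame i) e)
      + (e * L.metric Y W) * L.metric (L.nabla (L.frame i) T) (L.coframe i)
      + e * L.metric T (L.coframe i) * L.metric (L.nabla (L.frame i) Y) W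
      + (e * L.metric T W) * L.metric (L.nabla (L.frame i) Y) (L.coframe i)
      + e * L.metric Y (L.coframe i) * L.metric (L.nabla (L.frame i) T) W
      + L.metric Y W * (L.metric Y (L.coframe i) * L.act (L.frame i) (c + p))
      + ((c + p) * L.metric Y W) * L.metric (L.nabla (L.frame i) Y) (L.coframe i)
      + (c + p) * L.metric Y (L.coframe i) * L.metric (L.nabla (L.frame i) Y) W
      + L.metric W (L.coframe i) * L.act (L.frame i) p := by
    intro i
    simp only [h.einst, map_add, L.act_mul, L.compat]
    rw [L.symm (L.coframe i) W, L.symm (L.coframe i) (L.nabla (L.frame i) W)]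
    ring
  have hYY := h.killing.nabla_self_self h.unit_Y L.act_neg_one
  simp only [e1, Finset.sum_add_distrib, key, key2, ← Finset.mul_sum, ← L.act_eq_sum,
    hYY, h.killing.div_eq_zero, h.act_charge, map_zero, LinearMap.zero_apply] at h1
  rw [map_add (L.act Y), h.act_coenergy] at h1
  linear_combination h1

lemma metric_nabla_T (V : 𝔛) : L.metric (L.nabla V T) T = 0 :=
  metric_nabla_self h.unit_T L.act_neg_one V

lemma metric_nabla_Y_T_T : L.metric (L.nabla T Y) T = 0 := by
  have h1 := h.killing T T
  rw [L.symm T] at h1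
  refine eq_of_two_mul ?_
  linear_combination h1

lemma metric_nabla_T_Y (V : 𝔛) : L.metric (L.nabla V T) Y = - L.metric (L.nabla V Y) T := by
  have h1 := L.compat V T Y
  rw [h.ortho, map_zero, L.symm T] at h1
  linear_combination -h1

/-- The component along T: ∇_T T and ∇_Y T are orthogonal to the unit field T, and T(p) from the T⊗T
part cancels T(p) from the gradient. -/
lemma energy_conservation : L.act T μ + μ * L.div T + p * L.div T = 0 := by
  have h1 := h.div_eq T
  rw [h.metric_nabla_T, h.metric_nabla_T, h.metric_nabla_Y_T_T, h.unit_T, L.symm Y T, h.ortho,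
    map_add] at h1
  linear_combination -h1

/-- The component along Y: all accelerations are orthogonal to Y, by the Killing equation and ∇_Y Y
= 0, and the two terms Y(p) cancel. -/
lemma charge_conservation : L.act T e + e * L.div T = 0 := by
  have h1 := h.div_eq Y
  rw [h.metric_nabla_T_Y, h.metric_nabla_T_Y, h.metric_nabla_Y_T_T,
    h.killing.nabla_self_self h.unit_Y L.act_neg_one,
    metric_nabla_self h.unit_Y L.act_neg_one, h.unit_Y, h.ortho] at h1
  simp only [map_zero, LinearMap.zero_apply] at h1
  linear_combination -h1

lemma act_ratio {ν : A} (hν : μ * ν = 1) : L.act Y (e * ν) = 0 := by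
  have h1 : L.act Y (e * ν * μ) = 0 := by
    rw [mul_assoc, mul_comm ν, hν, mul_one, h.act_charge]
  rw [L.act_mul, h.act_energy] at h1
  linear_combination ν * h1 - L.act Y (e * ν) * hν

/-- The quotient rule gives μ T(e) - e T(μ). The conservation laws replace both derivatives by
multiples of div T, and the terms in μ e cancel. -/
lemma ratio_evolution {ν : A} (hν : μ * ν = 1) :
    μ ^ 2 * L.act T (e * ν) = e * p * L.div T := by
  have h1 : L.act T (e * ν * μ) = L.act T e := by
    rw [mul_assoc, mul_comm ν, hν, mul_one]
  rw [L.act_mul] at h1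
  linear_combination μ * h1 + μ * h.charge_conservation - e * h.energy_conservation
    - e * L.act T μ * hν

lemma charge_conservation_fluid {ν : A} (hν : μ * ν = 1) :
    L.div (e • (T + (e * ν) • Y)) = 0 := by
  rw [smul_add, L.div_add, L.div_smul, L.div_smul, L.div_smul, h.charge_conservation,
    h.killing.div_eq_zero, h.act_ratio hν]
  simp [h.act_charge]

/-- Conservation of charge removes the Y component, and that of energy reduces the coefficient of T
to T(p). As e [Y, T] = 0, the mixed terms add up to 2e ∇_T Y, which the Killing equation turns into
the force. -/
lemma motion (hn : Fintype.card ι ≠ 2) (W : 𝔛) :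
    (μ + p) * L.metric (L.nabla T T) W
      = e * (2 * L.metric (L.nabla W Y) T) - L.act W p - L.act T p * L.metric T W := by
  have h1 := h.div_eq W
  have h2 := congrArg (fun V ↦ L.metric V W) h.charge_smul_bracket
  simp only [bracket, smul_sub, map_sub, map_smul, LinearMap.sub_apply, LinearMap.smul_apply,
    smul_eq_mul, map_zero, LinearMap.zero_apply] at h2
  have h3 := h.killing T W
  rw [L.symm T] at h3
  rw [h.act_pressure hn, map_add] at h1
  linear_combination h1 - h2 - L.metric Y W * h.charge_conservation
    - L.metric T W * h.energy_conservation - 2 * e * h3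

lemma two_mul_ric (W : 𝔛) : 2 * L.ric Y W
    = - (e * L.metric T W) - (c - L.scal) * L.metric Y W := by
  have h1 := h.einst Y W
  rw [LeviCivitaAlgebra.einst, h.unit_Y, h.ortho] at h1
  linear_combination h1

/-- G(Y, Y) is not free: c - S = 2 Ric(Y, Y), and `ric_self` expresses this through ∇Y. -/
lemma coenergy_eq : c - L.scal
    = 2 * ∑ i, L.metric (L.nabla (L.frame i) Y) (L.nabla (L.coframe i) Y) := by
  have h1 := h.two_mul_ric Y
  rw [h.killing.ric_self h.unit_Y L.act_neg_one, h.ortho, h.unit_Y] at h1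
  linear_combination -h1

/-- The inhomogeneous Maxwell equation. -/
lemma maxwell (W : 𝔛) :
    ∑ i, 2 * L.metric (L.nabla (L.frame i) (L.nabla (L.coframe i) Y)
      - L.nabla (L.nabla (L.frame i) (L.coframe i)) Y) W
    = e * L.metric T W
      + 2 * (∑ i, L.metric (L.nabla (L.frame i) Y) (L.nabla (L.coframe i) Y)) * L.metric Y W := by
  rw [← Finset.mul_sum, h.killing.contract_hessian, ← h.coenergy_eq]
  linear_combination -h.two_mul_ric W

end IsPerfectFluid

end LeviCivitaAlgebra
end KaluzaKlein

/-! ### The Koszul formula and the properties of the Levi-Civita connection -/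

namespace KaluzaKlein

variable {n : ℕ} {M : Type*} [TopologicalSpace M] [ChartedSpace (EuclideanSpace ℝ (Fin n)) M]
  [IsManifold (𝓡 n) ∞ M]

namespace SemiRiemannianMetric

variable {g : SemiRiemannianMetric n M} {X X' Y Z : ∀ x : M, TangentSpace (𝓡 n) x} {x : M}

lemma koszul_add_left (hX : DiffFieldAt X x) (hX' : DiffFieldAt X' x)
    (hY : DiffFieldAt Y x) (hZ : DiffFieldAt Z x) :
    g.koszul (X + X') Y Z x = g.koszul X Y Z x + g.koszul X' Y Z x := by
  have e1 : (fun y ↦ g.inner y (Z y) ((X + X') y)) =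
    (fun y ↦ g.inner y (Z y) (X y)) + (fun y ↦ g.inner y (Z y) (X' y)) := by
    ext y; simp
  have e2 : (fun y ↦ g.inner y ((X + X') y) (Y y)) =
    (fun y ↦ g.inner y (X y) (Y y)) + (fun y ↦ g.inner y (X' y) (Y y)) := by
    ext y; simp
  simp only [koszul]
  rw [e1, e2, mvfderiv_add (mdiff_inner hZ hX) (mdiff_inner hZ hX'),
    mvfderiv_add (mdiff_inner hX hY) (mdiff_inner hX' hY),
    mlieBracket_add_left hX hX', mlieBracket_add_right hX hX']
  simp
  ring

lemma koszul_smul_left {f : M → ℝ} (hX : DiffFieldAt X x) (hY : DiffFieldAt Y x)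
    (hZ : DiffFieldAt Z x) (hf : MDifferentiableAt (𝓡 n) 𝓘(ℝ) f x) :
    g.koszul (f • X) Y Z x = f x * g.koszul X Y Z x := by
  have e1 : (fun y ↦ g.inner y (Z y) ((f • X) y)) = f * (fun y ↦ g.inner y (Z y) (X y)) := by
    ext y; simp
  have e2 : (fun y ↦ g.inner y ((f • X) y) (Y y)) = f * (fun y ↦ g.inner y (X y) (Y y)) := by
    ext y; simp
  simp only [koszul]
  rw [e1, e2, mvfderiv_mul hf (mdiff_inner hZ hX), mvfderiv_mul hf (mdiff_inner hX hY),
    mlieBracket_smul_left hf hX, mlieBracket_smul_right hf hX]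
  simp [g.symm x (Z x) (X x)]
  ring

lemma koszul_add_koszul (X Y Z : ∀ x : M, TangentSpace (𝓡 n) x) (x : M) :
    g.koszul X Y Z x + g.koszul X Z Y x
      = mvfderiv (𝓡 n) (fun y ↦ g.inner y (Y y) (Z y)) x (X x) := by
  simp only [koszul]
  rw [funext fun y ↦ g.symm y (Z y) (Y y), funext fun y ↦ g.symm y (X y) (Z y),
    funext fun y ↦ g.symm y (Y y) (X y),
    mlieBracket_swap_apply (V := Z) (W := Y), mlieBracket_swap_apply (V := X) (W := Z),
    mlieBracket_swap_apply (V := X) (W := Y)]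
  simp
  ring

lemma koszul_sub_koszul (X Y Z : ∀ x : M, TangentSpace (𝓡 n) x) (x : M) :
    g.koszul X Y Z x - g.koszul Y X Z x = g.inner x (mlieBracket (𝓡 n) X Y x) (Z x) := by
  simp only [koszul]
  rw [funext fun y ↦ g.symm y (Z y) (X y), funext fun y ↦ g.symm y (Y y) (Z y),
    funext fun y ↦ g.symm y (Y y) (X y),
    mlieBracket_swap_apply (V := Y) (W := X), mlieBracket_swap_apply (V := X) (W := Z),
    mlieBracket_swap_apply (V := Z) (W := Y)]
  simp
  ring

/-- Metric compatibility exchanges the last two slots, reducing the claim to additivity in the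
middle one. -/
lemma koszul_add_right {Z' : ∀ x : M, TangentSpace (𝓡 n) x} (hX : DiffFieldAt X x)
    (hY : DiffFieldAt Y x) (hZ : DiffFieldAt Z x) (hZ' : DiffFieldAt Z' x) :
    g.koszul X Y (Z + Z') x = g.koszul X Y Z x + g.koszul X Y Z' x := by
  have h1 := g.koszul_add_koszul X Y (Z + Z') x
  have e1 : (fun y ↦ g.inner y (Y y) ((Z + Z') y)) =
    (fun y ↦ g.inner y (Y y) (Z y)) + (fun y ↦ g.inner y (Y y) (Z' y)) := by
    ext y; simp
  rw [e1, mvfderiv_add (mdiff_inner hY hZ) (mdiff_inner hY hZ'), koszul_add hX hZ hZ' hY,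
    add_apply, ← koszul_add_koszul X Y Z, ← koszul_add_koszul X Y Z'] at h1
  linear_combination h1

lemma koszul_smul_right {f : M → ℝ} (hX : DiffFieldAt X x)
    (hY : DiffFieldAt Y x) (hZ : DiffFieldAt Z x) (hf : MDifferentiableAt (𝓡 n) 𝓘(ℝ) f x) :
    g.koszul X Y (f • Z) x = f x * g.koszul X Y Z x := by
  have h1 := g.koszul_add_koszul X Y (f • Z) x
  have e1 : (fun y ↦ g.inner y (Y y) ((f • Z) y)) = f * (fun y ↦ g.inner y (Y y) (Z y)) := by
    ext y; simp
  rw [e1, mvfderiv_mul hf (mdiff_inner hY hZ), koszul_smul hX hZ hY hf] at h1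
  simp only [add_apply, smul_apply, smul_eq_mul,
    ← koszul_add_koszul X Y Z, g.symm x (Z x)] at h1
  linear_combination h1

lemma eq_of_inner (g : SemiRiemannianMetric n M) {x : M} {v w : TangentSpace (𝓡 n) x}
    (h : ∀ z, g.inner x v z = g.inner x w z) :
    v = w := by
  rw [← sub_eq_zero]
  exact g.nondegenerate x _ fun z ↦ by simp [h]

/-- The Koszul formula for the Levi-Civita connection. -/
lemma inner_leviCivita (hX : DiffFieldAt X x) (hY : DiffFieldAt Y x) (hZ : DiffFieldAt Z x) :
    g.inner x (g.leviCivita Y x (X x)) (Z x) = g.koszul X Y Z x := by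
  -- The connection is defined by its Koszul values on coordinate fields alone. Both sides are
  -- tensorial in X and Z, so agreement on the basis at `x` suffices.
  have h₁ : ∀ Z, DiffFieldAt Z x → TensorialAt (𝓡 n) (EuclideanSpace ℝ (Fin n))
      (fun X ↦ g.koszul X Y Z x) x := fun Z hZ ↦
    ⟨fun hf hX ↦ koszul_smul_left hX hY hZ hf, fun hX hX' ↦ koszul_add_left hX hX' hY hZ⟩
  have h₂ : ∀ X, DiffFieldAt X x → TensorialAt (𝓡 n) (EuclideanSpace ℝ (Fin n))
      (fun Z ↦ g.koszul X Y Z x) x := fun X hX ↦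
    ⟨fun hf hZ ↦ koszul_smul_right hX hY hZ hf, fun hZ hZ' ↦ koszul_add_right hX hY hZ hZ'⟩
  rw [← TensorialAt.mkHom₂_apply h₁ h₂ hX hZ]
  set B := TensorialAt.mkHom₂ (fun X Z ↦ g.koszul X Y Z x) x h₁ h₂ with hB
  have key : (g.bilin x) ∘ₗ (g.leviCivita Y x).toLinearMap
      = (ContinuousLinearMap.coeLM ℝ) ∘ₗ B.toLinearMap := by
    refine (tangentBasis x).ext fun k ↦ (tangentBasis x).ext fun j ↦ ?_
    change g.inner x (g.leviCivitaAux Y x (tangentBasis x k)) (tangentBasis x j)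
      = B (tangentBasis x k) (tangentBasis x j)
    rw [leviCivitaAux, LinearMap.coe_toContinuousLinearMap', Basis.constr_basis, inner_sharp,
      Basis.constr_basis]
    conv_rhs => rw [← coordField_self x k, ← coordField_self x j, hB]
    exact (TensorialAt.mkHom₂_apply h₁ h₂ (mdiff_coordField x k) (mdiff_coordField x j)).symm
  exact DFunLike.congr_fun (DFunLike.congr_fun key (X x)) (Z x)

lemma exists_diffFieldAt (v : TangentSpace (𝓡 n) x) :
    ∃ Z : ∀ x : M, TangentSpace (𝓡 n) x, DiffFieldAt Z x ∧ Z x = v :=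
  ⟨FiberBundle.extend (EuclideanSpace ℝ (Fin n)) v, FiberBundle.mdifferentiableAt_extend ..,
    FiberBundle.extend_apply_self ..⟩

lemma leviCivita_sub (hX : DiffFieldAt X x) (hY : DiffFieldAt Y x) :
    g.leviCivita Y x (X x) - g.leviCivita X x (Y x) = mlieBracket (𝓡 n) X Y x := by
  refine g.eq_of_inner fun z ↦ ?_
  obtain ⟨Z, hZ, rfl⟩ := exists_diffFieldAt z
  rw [map_sub, sub_apply, inner_leviCivita hX hY hZ, inner_leviCivita hY hX hZ,
    koszul_sub_koszul]

lemma mvfderiv_inner (hX : DiffFieldAt X x) (hY : DiffFieldAt Y x) (hZ : DiffFieldAt Z x) :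
    mvfderiv (𝓡 n) (fun y ↦ g.inner y (Y y) (Z y)) x (X x)
      = g.inner x (g.leviCivita Y x (X x)) (Z x) + g.inner x (Y x) (g.leviCivita Z x (X x)) := by
  rw [g.symm x (Y x), inner_leviCivita hX hY hZ, inner_leviCivita hX hZ hY, koszul_add_koszul]

lemma leviCivita_congr {Y' : ∀ x : M, TangentSpace (𝓡 n) x} (hY : DiffFieldAt Y x)
    (h : Y =ᶠ[𝓝 x] Y') : g.leviCivita Y x = g.leviCivita Y' x := by
  refine IsCovariantDerivativeOn.congr_of_eventuallyEq (s := univ)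
    g.leviCivita.isCovariantDerivativeOnUniv hY ?_ Filter.univ_mem h
  refine hY.congr_of_eventuallyEq ?_
  filter_upwards [h] with y hy
  rw [hy]

end SemiRiemannianMetric

end KaluzaKlein

/-! ### Smooth functions and vector fields on an open set -/

namespace KaluzaKlein

variable {n : ℕ} {M : Type*} [TopologicalSpace M] [ChartedSpace (EuclideanSpace ℝ (Fin n)) M]
  [IsManifold (𝓡 n) ∞ M]

lemma isManifold_minSmoothness_two : IsManifold (𝓡 n) (minSmoothness ℝ 2) M := by
  rw [minSmoothness_of_isRCLikeNormedField]
  exact IsManifold.of_le (n := ∞) ENat.LEInfty.out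

lemma isManifold_minSmoothness_three : IsManifold (𝓡 n) (minSmoothness ℝ 3) M := by
  rw [minSmoothness_of_isRCLikeNormedField]
  exact IsManifold.of_le (n := ∞) (by
    simpa using ENat.natCast_le_of_coe_top_le_withTop (N := (∞ : WithTop ℕ∞)) le_rfl 3)

section Smoothness

variable {O : Set M} {X Y : ∀ x : M, TangentSpace (𝓡 n) x} {f : M → ℝ}

/-- A function is smooth on the set `O`. -/
abbrev SmoothFunctionOn (n : ℕ) {M : Type*} [TopologicalSpace M]
    [ChartedSpace (EuclideanSpace ℝ (Fin n)) M] (O : Set M) (f : M → ℝ) : Prop :=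
  ContMDiffOn (𝓡 n) 𝓘(ℝ) ∞ f O

lemma SmoothFieldOn.diffFieldAt (hX : SmoothFieldOn O X) (hO : IsOpen O) {x : M} (hx : x ∈ O) :
    DiffFieldAt X x :=
  ((hX x hx).contMDiffAt (hO.mem_nhds hx)).mdifferentiableAt (by simp)

lemma SmoothFunctionOn.mdifferentiableAt (hf : SmoothFunctionOn n O f) (hO : IsOpen O) {x : M}
    (hx : x ∈ O) : MDifferentiableAt (𝓡 n) 𝓘(ℝ) f x :=
  ((hf x hx).contMDiffAt (hO.mem_nhds hx)).mdifferentiableAt (by simp)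

lemma SmoothFieldOn.mono {O' : Set M} (hX : SmoothFieldOn O X) (h : O' ⊆ O) :
    SmoothFieldOn O' X := ContMDiffOn.mono hX h

lemma SmoothFieldOn.congr (hX : SmoothFieldOn O X) (h : EqOn X Y O) : SmoothFieldOn O Y :=
  ContMDiffOn.congr hX fun y hy ↦ by rw [h hy]

lemma SmoothFieldOn.add (hX : SmoothFieldOn O X) (hY : SmoothFieldOn O Y) :
    SmoothFieldOn O (X + Y) := ContMDiffOn.add_section hX hY

lemma SmoothFieldOn.smul (hf : SmoothFunctionOn n O f) (hX : SmoothFieldOn O X) :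
    SmoothFieldOn O (f • X) := ContMDiffOn.smul_section hf hX

lemma SmoothFieldOn.zero : SmoothFieldOn O (0 : ∀ x : M, TangentSpace (𝓡 n) x) :=
  (contMDiff_zeroSection ℝ (fun x : M ↦ TangentSpace (𝓡 n) x)).contMDiffOn

lemma SmoothFieldOn.sum {ι : Type*} {s : Finset ι} {V : ι → ∀ x : M, TangentSpace (𝓡 n) x}
    (hV : ∀ i ∈ s, SmoothFieldOn O (V i)) : SmoothFieldOn O (fun x ↦ ∑ i ∈ s, V i x) :=
  ContMDiffOn.sum_section hV

lemma SmoothFieldOn.mlieBracket (hX : SmoothFieldOn O X) (hY : SmoothFieldOn O Y)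
    (hO : IsOpen O) : SmoothFieldOn O (mlieBracket (𝓡 n) X Y) := by
  intro x hx
  have : IsManifold (𝓡 n) (((⊤ : ℕ∞) : WithTop ℕ∞) + 1) M :=
    inferInstanceAs (IsManifold (𝓡 n) ∞ M)
  have := isManifold_minSmoothness_two (n := n) (M := M)
  refine (ContMDiffAt.mlieBracket_vectorField (n := (⊤ : ℕ∞)) (m := (⊤ : ℕ∞))
    ((hX x hx).contMDiffAt (hO.mem_nhds hx))
    ((hY x hx).contMDiffAt (hO.mem_nhds hx)) ?_).contMDiffWithinAt
  rw [minSmoothness_of_isRCLikeNormedField]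
  exact le_rfl

lemma SmoothFunctionOn.mvfderiv (hf : SmoothFunctionOn n O f) (hX : SmoothFieldOn O X)
    (hO : IsOpen O) : SmoothFunctionOn n O (fun y ↦ mvfderiv (𝓡 n) f y (X y)) := by
  have h := (ContMDiffOn.contMDiffOn_tangentMapWithin (m := ∞) hf (by simp) hO.uniqueMDiffOn).comp hX
    (fun y hy ↦ hy)
  have h2 := ((contMDiff_snd_tangentBundle_modelSpace ℝ 𝓘(ℝ)).contMDiffOn
    (n := ∞) (s := univ)).comp h (fun y hy ↦ mem_univ _)
  refine h2.congr fun y hy ↦ ?_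
  simp only [Function.comp, tangentMapWithin, mfderivWithin_of_isOpen hO hy]
  rfl

lemma SemiRiemannianMetric.smooth_inner (g : SemiRiemannianMetric n M)
    (hX : SmoothFieldOn O X) (hY : SmoothFieldOn O Y) :
    SmoothFunctionOn n O (fun y ↦ g.inner y (X y) (Y y)) := by
  have h : ContMDiffOn (𝓡 n) ((𝓡 n).prod 𝓘(ℝ)) ∞ (fun m ↦
      TotalSpace.mk' ℝ (E := Bundle.Trivial M ℝ) m (g.inner m (X m) (Y m))) O := by
    apply ContMDiffOn.clm_bundle_apply₂ (F₁ := EuclideanSpace ℝ (Fin n))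
      (F₂ := EuclideanSpace ℝ (Fin n))
    · exact g.contMDiff.contMDiffOn
    · exact hX
    · exact hY
  intro y hy
  have := h y hy
  simp only [contMDiffWithinAt_totalSpace] at this
  exact this.2

lemma SemiRiemannianMetric.smooth_koszul (g : SemiRiemannianMetric n M)
    {Z : ∀ x : M, TangentSpace (𝓡 n) x} (hO : IsOpen O)
    (hX : SmoothFieldOn O X) (hY : SmoothFieldOn O Y) (hZ : SmoothFieldOn O Z) :
    SmoothFunctionOn n O (fun y ↦ g.koszul X Y Z y) := by
  unfold SmoothFunctionOn koszul
  refine contMDiffOn_const.mul (((((ContMDiffOn.add ?_ ?_).sub ?_).add ?_).sub ?_).add ?_)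
  · exact (g.smooth_inner hY hZ).mvfderiv hX hO
  · exact (g.smooth_inner hZ hX).mvfderiv hY hO
  · exact (g.smooth_inner hX hY).mvfderiv hZ hO
  · exact g.smooth_inner (hX.mlieBracket hY hO) hZ
  · exact g.smooth_inner (hY.mlieBracket hZ hO) hX
  · exact g.smooth_inner (hZ.mlieBracket hX hO) hY

lemma mvfderiv_congr {f' : M → ℝ} {x : M} (h : f =ᶠ[𝓝 x] f') :
    mvfderiv (𝓡 n) f x = mvfderiv (𝓡 n) f' x := by
  ext v
  have := h.mfderiv_eq (I := 𝓡 n) (I' := 𝓘(ℝ))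
  change (mfderiv (𝓡 n) 𝓘(ℝ) f x v : ℝ) = mfderiv (𝓡 n) 𝓘(ℝ) f' x v
  exact congrArg (fun T : EuclideanSpace ℝ (Fin n) →L[ℝ] ℝ ↦ T v) this

end Smoothness

section Algebra

/-- The smooth functions on `O`. -/
def smoothFunctions (n : ℕ) {M : Type*} [TopologicalSpace M]
    [ChartedSpace (EuclideanSpace ℝ (Fin n)) M] (O : Set M) : Subalgebra ℝ (O → ℝ) where
  -- Elements live on the subtype, so equality means equality on `O`, while smoothness and
  -- derivatives are those of a function on `M`, arbitrary off `O`.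
  carrier := {f | ∃ F : M → ℝ, SmoothFunctionOn n O F ∧ ∀ y : O, F y = f y}
  mul_mem' := by
    rintro f f' ⟨F, hF, hf⟩ ⟨F', hF', hf'⟩
    exact ⟨F * F', hF.mul hF', fun y ↦ by simp [hf, hf']⟩
  add_mem' := by
    rintro f f' ⟨F, hF, hf⟩ ⟨F', hF', hf'⟩
    exact ⟨F + F', hF.add hF', fun y ↦ by simp [hf, hf']⟩
  algebraMap_mem' r := ⟨fun _ ↦ r, contMDiffOn_const, fun _ ↦ rfl⟩

variable {O : Set M}

/-- The smooth vector fields on `O`. -/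
def smoothFields (n : ℕ) {M : Type*} [TopologicalSpace M]
    [ChartedSpace (EuclideanSpace ℝ (Fin n)) M] [IsManifold (𝓡 n) ∞ M] (O : Set M) :
    Submodule (smoothFunctions n O) (∀ y : O, TangentSpace (𝓡 n) (y : M)) where
  carrier := {V | ∃ F : ∀ x : M, TangentSpace (𝓡 n) x, SmoothFieldOn O F ∧ ∀ y : O, F y = V y}
  zero_mem' := ⟨0, SmoothFieldOn.zero, fun _ ↦ rfl⟩
  add_mem' := by
    rintro f f' ⟨F, hF, hf⟩ ⟨F', hF', hf'⟩
    exact ⟨F + F', hF.add hF', fun y ↦ by simp [hf, hf']⟩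
  smul_mem' := by
    rintro ⟨f, G, hG, hg⟩ f' ⟨F, hF, hf⟩
    exact ⟨G • F, hF.smul hG, fun y ↦ by
      simp only [Pi.smul_apply', hg, hf]; rfl⟩

noncomputable instance smoothFunctionsCommRing : CommRing (smoothFunctions n O) := inferInstance

noncomputable instance smoothFieldsAddCommGroup : AddCommGroup (smoothFields n O) := inferInstance

noncomputable instance smoothFieldsModule : Module (smoothFunctions n O) (smoothFields n O) := inferInstance

noncomputable instance smoothFieldsSMul : SMul (smoothFunctions n O) (smoothFields n O) :=
  smoothFieldsModule.toSMul

namespace smoothFunctions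

/-- The restriction of a smooth function. -/
def mk (F : M → ℝ) (hF : SmoothFunctionOn n O F) : smoothFunctions n O :=
  ⟨fun y ↦ F y, F, hF, fun _ ↦ rfl⟩

/-- A function on `M` whose restriction is the given function. -/
noncomputable def ext (f : smoothFunctions n O) : M → ℝ := Classical.choose f.2

lemma ext_smooth (f : smoothFunctions n O) : SmoothFunctionOn n O (ext f) :=
  (Classical.choose_spec f.2).1

@[simp] lemma ext_apply (f : smoothFunctions n O) (y : O) : ext f y = f.1 y :=
  (Classical.choose_spec f.2).2 y

end smoothFunctions

namespace smoothFields

/-- The restriction of a smooth vector field. -/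
def mk (F : ∀ x : M, TangentSpace (𝓡 n) x) (hF : SmoothFieldOn O F) : smoothFields n O :=
  ⟨fun y ↦ F y, F, hF, fun _ ↦ rfl⟩

/-- A vector field on `M` whose restriction is the given vector field. -/
noncomputable def ext (V : smoothFields n O) : ∀ x : M, TangentSpace (𝓡 n) x :=
  Classical.choose V.2

lemma ext_smooth (V : smoothFields n O) : SmoothFieldOn O (ext V) :=
  (Classical.choose_spec V.2).1

@[simp] lemma ext_apply (V : smoothFields n O) (y : O) : ext V y = V.1 y :=
  (Classical.choose_spec V.2).2 y

end smoothFields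

section Values

variable (y : O)

@[simp] lemma smoothFunctions.add_val (a b : smoothFunctions n O) :
    (a + b).1 y = a.1 y + b.1 y := rfl
@[simp] lemma smoothFunctions.sub_val (a b : smoothFunctions n O) :
    (a - b).1 y = a.1 y - b.1 y := rfl
@[simp] lemma smoothFunctions.mul_val (a b : smoothFunctions n O) :
    (a * b).1 y = a.1 y * b.1 y := rfl
@[simp] lemma smoothFunctions.two_val : (2 : smoothFunctions n O).1 y = 2 := rfl
lemma smoothFunctions.sum_val {ι : Type*} (s : Finset ι) (a : ι → smoothFunctions n O) :
    (∑ i ∈ s, a i).1 y = ∑ i ∈ s, (a i).1 y :=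
  map_sum ((Pi.evalRingHom (fun _ : O ↦ ℝ) y).comp (smoothFunctions n O).val.toRingHom) a s

@[simp] lemma smoothFields.add_val (a b : smoothFields n O) :
    (a + b).1 y = a.1 y + b.1 y := rfl
@[simp] lemma smoothFields.sub_val (a b : smoothFields n O) :
    (a - b).1 y = a.1 y - b.1 y := rfl
@[simp] lemma smoothFields.smul_val (a : smoothFunctions n O) (V : smoothFields n O) :
    (a • V).1 y = a.1 y • V.1 y := rfl
lemma smoothFields.sum_val {ι : Type*} (s : Finset ι) (V : ι → smoothFields n O) :
    (∑ i ∈ s, V i).1 y = ∑ i ∈ s, (V i).1 y :=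
  map_sum ((Pi.evalAddMonoidHom (fun y : O ↦ TangentSpace (𝓡 n) (y : M)) y).comp
    (smoothFields n O).subtype.toAddMonoidHom) V s

end Values

end Algebra

end KaluzaKlein

/-! ### Smooth frames and dual frames over a chart domain -/

namespace KaluzaKlein

variable {n : ℕ} {M : Type*} [TopologicalSpace M] [ChartedSpace (EuclideanSpace ℝ (Fin n)) M]
  [IsManifold (𝓡 n) ∞ M]

section Frame

variable (n) in
/-- The domain of the preferred trivialization of the tangent bundle at `x₀`. -/
abbrev frameDomain (x₀ : M) : Set M :=
  (trivializationAt (EuclideanSpace ℝ (Fin n)) (TangentSpace (𝓡 n)) x₀).baseSet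

/-- The frame of the tangent spaces given by the preferred trivialization at `x₀`. -/
noncomputable def frameBasis (x₀ : M) {y : M} (hy : y ∈ frameDomain n x₀) :
    Basis (Fin n) ℝ (TangentSpace (𝓡 n) y) :=
  (trivializationAt (EuclideanSpace ℝ (Fin n)) (TangentSpace (𝓡 n)) x₀).basisAt
    (EuclideanSpace.basisFun (Fin n) ℝ).toBasis hy

/-- The vector fields of the frame given by the preferred trivialization at `x₀`. -/
noncomputable def frameField (x₀ : M) (i : Fin n) : ∀ y : M, TangentSpace (𝓡 n) y :=
  (trivializationAt (EuclideanSpace ℝ (Fin n)) (TangentSpace (𝓡 n)) x₀).localFrame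
    (EuclideanSpace.basisFun (Fin n) ℝ).toBasis i

lemma frameField_apply {x₀ y : M} (hy : y ∈ frameDomain n x₀) (i : Fin n) :
    frameField x₀ i y = frameBasis x₀ hy i :=
  Trivialization.localFrame_apply_of_mem_baseSet _ _ hy

lemma frameField_smooth (x₀ : M) (i : Fin n) :
    SmoothFieldOn (frameDomain n x₀) (frameField x₀ i) :=
  Trivialization.contMDiffOn_localFrame_baseSet (I := 𝓡 n) ∞ _ _ i

lemma coordField_smooth (x₀ : M) (i : Fin n) :
    SmoothFieldOn (frameDomain n x₀) (coordField x₀ i) := by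
  set t := trivializationAt (EuclideanSpace ℝ (Fin n)) (TangentSpace (𝓡 n) (M := M)) x₀
  rw [SmoothFieldOn, t.contMDiffOn_section_baseSet_iff]
  refine (contMDiffOn_const (c := (t ⟨x₀, tangentBasis x₀ i⟩).2)).congr fun x hx ↦ ?_
  change (t ⟨x, t.symm x (t ⟨x₀, tangentBasis x₀ i⟩).2⟩).2 = _
  rw [t.apply_mk_symm hx]

open scoped Classical in
/-- The dual frame with respect to the metric. -/
noncomputable def coframeField (g : SemiRiemannianMetric n M) (x₀ : M) (i : Fin n) (y : M) :
    TangentSpace (𝓡 n) y :=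
  if hy : y ∈ frameDomain n x₀ then g.sharp y ((frameBasis x₀ hy).coord i) else 0

variable (g : SemiRiemannianMetric n M)

lemma inner_coframeField {x₀ y : M} (hy : y ∈ frameDomain n x₀) (i : Fin n)
    (v : TangentSpace (𝓡 n) y) :
    g.inner y (coframeField g x₀ i y) v = (frameBasis x₀ hy).repr v i := by
  rw [coframeField, dif_pos hy, g.inner_sharp]
  rfl

lemma sum_inner_coframeField {x₀ y : M} (hy : y ∈ frameDomain n x₀) (v : TangentSpace (𝓡 n) y) :
    v = ∑ i, g.inner y v (coframeField g x₀ i y) • frameField x₀ i y := by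
  conv_lhs => rw [← (frameBasis x₀ hy).sum_repr v]
  simp only [frameField_apply hy, g.symm y v, inner_coframeField g hy]

lemma eq_of_inner_frameField {x₀ y : M} (hy : y ∈ frameDomain n x₀) {v w : TangentSpace (𝓡 n) y}
    (h : ∀ i, g.inner y v (frameField x₀ i y) = g.inner y w (frameField x₀ i y)) : v = w := by
  refine g.eq_of_inner fun z ↦ ?_
  rw [sum_inner_coframeField g hy z]
  simp [h]

lemma smoothFunctions.isUnit {O : Set M} {f : smoothFunctions n O} (hf : ∀ y, f.1 y ≠ 0) :
    IsUnit f := by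
  refine IsUnit.of_mul_eq_one (smoothFunctions.mk (fun y ↦ (smoothFunctions.ext f y)⁻¹)
    (ContMDiffOn.inv₀ (smoothFunctions.ext_smooth f) fun y hy ↦ ?_)) ?_
  · rw [smoothFunctions.ext_apply f ⟨y, hy⟩]; exact hf _
  · ext y
    change f.1 y * (smoothFunctions.ext f y)⁻¹ = 1
    rw [smoothFunctions.ext_apply]
    exact mul_inv_cancel₀ (hf y)

/-- The coframe is the inverse Gram matrix applied to the frame. Nondegeneracy makes the Gram
determinant a nowhere zero smooth function, hence a unit, so the inverse has smooth entries. -/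
lemma coframeField_smooth (x₀ : M) (i : Fin n) :
    SmoothFieldOn (frameDomain n x₀) (coframeField g x₀ i) := by
  let G : Matrix (Fin n) (Fin n) (smoothFunctions n (frameDomain n x₀)) := Matrix.of fun i j ↦
    smoothFunctions.mk (fun y ↦ g.inner y (frameField x₀ i y) (frameField x₀ j y))
      (g.smooth_inner (frameField_smooth x₀ i) (frameField_smooth x₀ j))
  have hG : IsUnit G.det := by
    refine smoothFunctions.isUnit fun y ↦ ?_
    let φ : smoothFunctions n (frameDomain n x₀) →+* ℝ :=
      (Pi.evalRingHom (fun _ ↦ ℝ) y).comp (smoothFunctions n (frameDomain n x₀)).val.toRingHom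
    change φ G.det ≠ 0
    rw [RingHom.map_det]
    have h := (LinearMap.BilinForm.nondegenerate_iff_det_ne_zero (frameBasis x₀ y.2)).mp
      (g.bilin_nondegenerate y)
    convert! h using 2
    ext i j
    change g.inner y (frameField x₀ i y) (frameField x₀ j y)
      = LinearMap.BilinForm.toMatrix (frameBasis x₀ y.2) (g.bilin y) i j
    rw [LinearMap.BilinForm.toMatrix_apply, frameField_apply y.2, frameField_apply y.2]
    rfl
  have hs : SmoothFieldOn (frameDomain n x₀) (fun y ↦ ∑ j, (smoothFunctions.ext (G⁻¹ i j) • frameField x₀ j) y) :=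
    SmoothFieldOn.sum fun j _ ↦ (frameField_smooth x₀ j).smul (smoothFunctions.ext_smooth (G⁻¹ i j))
  refine hs.congr fun y hy ↦ eq_of_inner_frameField g hy fun k ↦ ?_
  have h1 := congrArg (fun A : Matrix (Fin n) (Fin n) (smoothFunctions n (frameDomain n x₀)) ↦
    (A i k).1 ⟨y, hy⟩) (Matrix.nonsing_inv_mul G hG)
  simp only [Matrix.mul_apply, smoothFunctions.sum_val, smoothFunctions.mul_val] at h1
  rw [inner_coframeField g hy, frameField_apply hy, Basis.repr_self]
  simp only [Pi.smul_apply', map_sum, map_smul, sum_apply, smul_apply, smul_eq_mul,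
    smoothFunctions.ext_apply _ ⟨y, hy⟩]
  rw [← frameField_apply hy]
  refine h1.trans ?_
  rw [Matrix.one_apply, Finsupp.single_apply]
  simp only [eq_comm (a := k)]
  split_ifs <;> rfl

end Frame

end KaluzaKlein

/-! ### The Levi-Civita algebra of an open set -/

namespace KaluzaKlein

variable {n : ℕ} {M : Type*} [TopologicalSpace M] [ChartedSpace (EuclideanSpace ℝ (Fin n)) M]
  [IsManifold (𝓡 n) ∞ M]

namespace SemiRiemannianMetric

variable (g : SemiRiemannianMetric n M) {x₀ : M} {O : Set M}

lemma smooth_of_inner_frameField (hx : O ⊆ frameDomain n x₀) {W : ∀ x : M, TangentSpace (𝓡 n) x}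
    (h : ∀ i, SmoothFunctionOn n O (fun y ↦ g.inner y (W y) (frameField x₀ i y))) :
    SmoothFieldOn O W := by
  have hs : SmoothFieldOn O (fun y ↦ ∑ i,
      ((fun y ↦ g.inner y (W y) (frameField x₀ i y)) • coframeField g x₀ i) y) :=
    SmoothFieldOn.sum fun i _ ↦ SmoothFieldOn.smul (h i) ((coframeField_smooth g x₀ i).mono hx)
  refine hs.congr fun y hy ↦ eq_of_inner_frameField g (hx hy) fun k ↦ ?_
  simp only [Pi.smul_apply', map_sum, map_smul, sum_apply, smul_apply, smul_eq_mul,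
    inner_coframeField g (hx hy)]
  simp only [frameField_apply (hx hy), Basis.repr_self, Finsupp.single_apply]
  simp

/-- The definition of the connection uses a different chart at every point, so smoothness is read
off from the Koszul formula against one smooth frame. -/
lemma smooth_leviCivita (hO : IsOpen O) (hx : O ⊆ frameDomain n x₀)
    {X Y : ∀ x : M, TangentSpace (𝓡 n) x} (hX : SmoothFieldOn O X) (hY : SmoothFieldOn O Y) :
    SmoothFieldOn O (fun y ↦ g.leviCivita Y y (X y)) := by
  refine g.smooth_of_inner_frameField hx fun i ↦ ?_
  have hE := (frameField_smooth x₀ i).mono hx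
  refine ContMDiffOn.congr (g.smooth_koszul hO hX hY hE) fun y hy ↦ ?_
  exact inner_leviCivita (hX.diffFieldAt hO hy) (hY.diffFieldAt hO hy) (hE.diffFieldAt hO hy)

lemma leviCivita_congr_of_eqOn (hO : IsOpen O) {X Y : ∀ x : M, TangentSpace (𝓡 n) x}
    (hX : SmoothFieldOn O X) (h : EqOn X Y O) {y : M} (hy : y ∈ O) :
    g.leviCivita X y = g.leviCivita Y y :=
  leviCivita_congr (hX.diffFieldAt hO hy) (h.eventuallyEq_of_mem (hO.mem_nhds hy))

/-- The derivative of a function on `O` along a vector field. -/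
noncomputable def actOn (hO : IsOpen O) :
    smoothFields n O →ₗ[smoothFunctions n O] smoothFunctions n O →+ smoothFunctions n O where
  toFun X := AddMonoidHom.mk' (fun f ↦ smoothFunctions.mk
      (fun y ↦ mvfderiv (𝓡 n) (smoothFunctions.ext f) y (smoothFields.ext X y))
      ((smoothFunctions.ext_smooth f).mvfderiv (smoothFields.ext_smooth X) hO)) fun f f' ↦ by
    ext ⟨y, hy⟩
    change mvfderiv (𝓡 n) (smoothFunctions.ext (f + f')) y (smoothFields.ext X y)
      = mvfderiv (𝓡 n) (smoothFunctions.ext f) y (smoothFields.ext X y)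
        + mvfderiv (𝓡 n) (smoothFunctions.ext f') y (smoothFields.ext X y)
    have h : EqOn (smoothFunctions.ext (f + f')) (smoothFunctions.ext f + smoothFunctions.ext f') O :=
      fun z hz ↦ by
        simp only [Pi.add_apply, smoothFunctions.ext_apply _ ⟨z, hz⟩, smoothFunctions.add_val]
    rw [mvfderiv_congr (h.eventuallyEq_of_mem (hO.mem_nhds hy)),
      mvfderiv_add ((smoothFunctions.ext_smooth f).mdifferentiableAt hO hy)
        ((smoothFunctions.ext_smooth f').mdifferentiableAt hO hy)]
    rfl
  map_add' X X' := by
    ext f y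
    change mvfderiv (𝓡 n) (smoothFunctions.ext f) y (smoothFields.ext (X + X') y)
      = mvfderiv (𝓡 n) (smoothFunctions.ext f) y (smoothFields.ext X y)
        + mvfderiv (𝓡 n) (smoothFunctions.ext f) y (smoothFields.ext X' y)
    simp
  map_smul' a X := by
    ext f y
    change mvfderiv (𝓡 n) (smoothFunctions.ext f) y (smoothFields.ext (a • X) y)
      = a.1 y * mvfderiv (𝓡 n) (smoothFunctions.ext f) y (smoothFields.ext X y)
    simp

/-- Since `O` is open, the derivative at its points does not depend on the chosen extension. -/
lemma actOn_val (hO : IsOpen O) (X : smoothFields n O) (f : smoothFunctions n O) {F : M → ℝ}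
    (hF : ∀ z : O, F z = f.1 z) (y : O) :
    (actOn hO X f).1 y = mvfderiv (𝓡 n) F y (X.1 y) := by
  change mvfderiv (𝓡 n) (smoothFunctions.ext f) y (smoothFields.ext X y) = _
  have h : EqOn (smoothFunctions.ext f) F O := fun z hz ↦ by
    rw [hF ⟨z, hz⟩, smoothFunctions.ext_apply _ ⟨z, hz⟩]
  rw [mvfderiv_congr (h.eventuallyEq_of_mem (hO.mem_nhds y.2)), smoothFields.ext_apply]

/-- The Levi-Civita connection on the vector fields on `O`. -/
noncomputable def nablaOn (hO : IsOpen O) (hx : O ⊆ frameDomain n x₀) :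
    smoothFields n O →ₗ[smoothFunctions n O] smoothFields n O →+ smoothFields n O where
  toFun X := AddMonoidHom.mk' (fun V ↦ smoothFields.mk
      (fun y ↦ g.leviCivita (smoothFields.ext V) y (smoothFields.ext X y))
      (g.smooth_leviCivita hO hx (smoothFields.ext_smooth X) (smoothFields.ext_smooth V)))
      fun V V' ↦ by
    ext1
    funext ⟨y, hy⟩
    change g.leviCivita (smoothFields.ext (V + V')) y (smoothFields.ext X y)
      = g.leviCivita (smoothFields.ext V) y (smoothFields.ext X y)
        + g.leviCivita (smoothFields.ext V') y (smoothFields.ext X y)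
    have h : EqOn (smoothFields.ext (V + V')) (smoothFields.ext V + smoothFields.ext V') O :=
      fun z hz ↦ by
        simp only [Pi.add_apply, smoothFields.ext_apply _ ⟨z, hz⟩, smoothFields.add_val]
        rfl
    rw [g.leviCivita_congr_of_eqOn hO (smoothFields.ext_smooth _) h hy,
      g.leviCivita.isCovariantDerivativeOnUniv.add
        ((smoothFields.ext_smooth V).diffFieldAt hO hy)
        ((smoothFields.ext_smooth V').diffFieldAt hO hy)]
    rfl
  map_add' X X' := by
    ext1 V
    ext1
    funext y
    change g.leviCivita (smoothFields.ext V) y (smoothFields.ext (X + X') y)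
      = g.leviCivita (smoothFields.ext V) y (smoothFields.ext X y)
        + g.leviCivita (smoothFields.ext V) y (smoothFields.ext X' y)
    simp
  map_smul' a X := by
    ext1 V
    ext1
    funext y
    change g.leviCivita (smoothFields.ext V) y (smoothFields.ext (a • X) y)
      = a.1 y • g.leviCivita (smoothFields.ext V) y (smoothFields.ext X y)
    simp

lemma nablaOn_val (hO : IsOpen O) (hx : O ⊆ frameDomain n x₀) (X V : smoothFields n O)
    {F : ∀ x : M, TangentSpace (𝓡 n) x} (hF : ∀ z : O, F z = V.1 z) (y : O) :
    (g.nablaOn hO hx X V).1 y = g.leviCivita F y (X.1 y) := by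
  change g.leviCivita (smoothFields.ext V) y (smoothFields.ext X y) = _
  have h : EqOn (smoothFields.ext V) F O := fun z hz ↦ by
    rw [hF ⟨z, hz⟩, smoothFields.ext_apply _ ⟨z, hz⟩]
  rw [g.leviCivita_congr_of_eqOn hO (smoothFields.ext_smooth _) h y.2, smoothFields.ext_apply]

/-- The metric on the vector fields on `O`. -/
noncomputable def metricOn (O : Set M) :
    smoothFields n O →ₗ[smoothFunctions n O] smoothFields n O →ₗ[smoothFunctions n O]
      smoothFunctions n O :=
  LinearMap.mk₂ _ (fun V W ↦ smoothFunctions.mk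
      (fun y ↦ g.inner y (smoothFields.ext V y) (smoothFields.ext W y))
      (g.smooth_inner (smoothFields.ext_smooth V) (smoothFields.ext_smooth W)))
    (fun V V' W ↦ by
      ext y
      change g.inner y _ _ = g.inner y _ _ + g.inner y _ _
      simp)
    (fun a V W ↦ by
      ext y
      change g.inner y _ _ = a.1 y * g.inner y _ _
      simp)
    (fun V W W' ↦ by
      ext y
      change g.inner y _ _ = g.inner y _ _ + g.inner y _ _
      simp)
    (fun a V W ↦ by
      ext y
      change g.inner y _ _ = a.1 y * g.inner y _ _
      simp)

lemma metricOn_val (V W : smoothFields n O) (y : O) :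
    (g.metricOn O V W).1 y = g.inner y (V.1 y) (W.1 y) := by
  change g.inner y (smoothFields.ext V y) (smoothFields.ext W y) = _
  rw [smoothFields.ext_apply, smoothFields.ext_apply]

lemma nablaOn_sub_val (hO : IsOpen O) (hx : O ⊆ frameDomain n x₀) (X V : smoothFields n O)
    {F F' : ∀ x : M, TangentSpace (𝓡 n) x} (hF : ∀ z : O, F z = X.1 z)
    (hF' : ∀ z : O, F' z = V.1 z) (y : O) :
    (g.nablaOn hO hx X V - g.nablaOn hO hx V X).1 y = mlieBracket (𝓡 n) F F' y := by
  have h : EqOn (smoothFields.ext X) F O := fun z hz ↦ by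
    rw [hF ⟨z, hz⟩, smoothFields.ext_apply _ ⟨z, hz⟩]
  have h' : EqOn (smoothFields.ext V) F' O := fun z hz ↦ by
    rw [hF' ⟨z, hz⟩, smoothFields.ext_apply _ ⟨z, hz⟩]
  have e := leviCivita_sub (g := g) ((smoothFields.ext_smooth X).diffFieldAt hO y.2)
    ((smoothFields.ext_smooth V).diffFieldAt hO y.2)
  rw [(h.eventuallyEq_of_mem (hO.mem_nhds y.2)).mlieBracket_vectorField_eq
    (h'.eventuallyEq_of_mem (hO.mem_nhds y.2))] at e
  exact e

lemma mlieBracket_ext_jacobi (hO : IsOpen O) (X V W : smoothFields n O) (y : O) :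
    mlieBracket (𝓡 n) (smoothFields.ext X)
        (mlieBracket (𝓡 n) (smoothFields.ext V) (smoothFields.ext W)) y
      + mlieBracket (𝓡 n) (smoothFields.ext V)
        (mlieBracket (𝓡 n) (smoothFields.ext W) (smoothFields.ext X)) y
      + mlieBracket (𝓡 n) (smoothFields.ext W)
        (mlieBracket (𝓡 n) (smoothFields.ext X) (smoothFields.ext V)) y = 0 := by
  have := isManifold_minSmoothness_three (n := n) (M := M)
  have smooth2 (V : smoothFields n O) (y : O) :
      ContMDiffAt (𝓡 n) ((𝓡 n).prod 𝓘(ℝ, EuclideanSpace ℝ (Fin n))) (minSmoothness ℝ 2)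
        (fun x ↦ TotalSpace.mk' (EuclideanSpace ℝ (Fin n)) x (smoothFields.ext V x)) y := by
    rw [minSmoothness_of_isRCLikeNormedField]
    exact ((smoothFields.ext_smooth V y y.2).contMDiffAt (hO.mem_nhds y.2)).of_le
      ENat.LEInfty.out
  rw [leibniz_identity_mlieBracket_apply (smooth2 X y) (smooth2 V y) (smooth2 W y),
    mlieBracket_swap (V := smoothFields.ext W) (W := smoothFields.ext X),
    mlieBracket_swap_apply (V := smoothFields.ext W)]
  have hd := ((smoothFields.ext_smooth X).mlieBracket (smoothFields.ext_smooth W)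
    hO).diffFieldAt hO y.2
  have e := mlieBracket_const_smul_right (I := 𝓡 n) (c := (-1 : ℝ)) (V := smoothFields.ext V) hd
  rw [neg_one_smul, neg_one_smul] at e
  rw [e]
  abel

/-- By vanishing torsion the differences of covariant derivatives are Lie brackets of fields, for
which the Jacobi identity is known. -/
lemma nablaOn_jacobi (hO : IsOpen O) (hx : O ⊆ frameDomain n x₀) (X V W : smoothFields n O) :
    (g.nablaOn hO hx X (g.nablaOn hO hx V W - g.nablaOn hO hx W V)
        - g.nablaOn hO hx (g.nablaOn hO hx V W - g.nablaOn hO hx W V) X)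
      + (g.nablaOn hO hx V (g.nablaOn hO hx W X - g.nablaOn hO hx X W)
        - g.nablaOn hO hx (g.nablaOn hO hx W X - g.nablaOn hO hx X W) V)
      + (g.nablaOn hO hx W (g.nablaOn hO hx X V - g.nablaOn hO hx V X)
        - g.nablaOn hO hx (g.nablaOn hO hx X V - g.nablaOn hO hx V X) W) = 0 := by
  ext1
  funext y
  have b (V W : smoothFields n O) (z : O) :
      mlieBracket (𝓡 n) (smoothFields.ext V) (smoothFields.ext W) z
        = (g.nablaOn hO hx V W - g.nablaOn hO hx W V).1 z :=
    (g.nablaOn_sub_val hO hx V W (smoothFields.ext_apply V) (smoothFields.ext_apply W) z).symm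
  have c (X V W : smoothFields n O) :=
    g.nablaOn_sub_val hO hx X (g.nablaOn hO hx V W - g.nablaOn hO hx W V)
      (smoothFields.ext_apply X)
      (F' := mlieBracket (𝓡 n) (smoothFields.ext V) (smoothFields.ext W)) (b V W) y
  rw [smoothFields.add_val, smoothFields.add_val, c X V W, c V W X, c W X V]
  exact mlieBracket_ext_jacobi hO X V W y

/-- The smooth vector fields on an open set with a frame form a Levi-Civita algebra. -/
noncomputable def algebraOn (hO : IsOpen O) (hx : O ⊆ frameDomain n x₀) :
    LeviCivitaAlgebra (smoothFunctions n O) (smoothFields n O) (Fin n) where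
  act := actOn hO
  nabla := g.nablaOn hO hx
  metric := g.metricOn O
  frame i := smoothFields.mk (frameField x₀ i) ((frameField_smooth x₀ i).mono hx)
  coframe i := smoothFields.mk (coframeField g x₀ i) ((coframeField_smooth g x₀ i).mono hx)
  act_mul X a b := by
    ext y
    rw [actOn_val hO X (a * b) (F := smoothFunctions.ext a * smoothFunctions.ext b) (fun z ↦ by simp),
      mvfderiv_mul ((smoothFunctions.ext_smooth a).mdifferentiableAt hO y.2)
        ((smoothFunctions.ext_smooth b).mdifferentiableAt hO y.2), smoothFunctions.add_val,
      smoothFunctions.mul_val, smoothFunctions.mul_val,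
      actOn_val hO X a (smoothFunctions.ext_apply a), actOn_val hO X b (smoothFunctions.ext_apply b)]
    simp
    ring
  nabla_smul X a V := by
    ext1
    funext y
    rw [g.nablaOn_val hO hx X (a • V) (F := smoothFunctions.ext a • smoothFields.ext V)
        (fun z ↦ by simp),
      g.leviCivita.isCovariantDerivativeOnUniv.leibniz
        ((smoothFields.ext_smooth V).diffFieldAt hO y.2)
        ((smoothFunctions.ext_smooth a).mdifferentiableAt hO y.2), smoothFields.add_val,
      smoothFields.smul_val, smoothFields.smul_val,
      actOn_val hO X a (smoothFunctions.ext_apply a),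
      g.nablaOn_val hO hx X V (smoothFields.ext_apply V)]
    simp
    abel
  symm V W := by
    ext y
    rw [metricOn_val, metricOn_val, g.symm]
  compat X V W := by
    ext y
    rw [actOn_val hO X _ (F := fun y ↦ g.inner y (smoothFields.ext V y) (smoothFields.ext W y))
      (fun z ↦ rfl), smoothFunctions.add_val, metricOn_val, metricOn_val,
      g.nablaOn_val hO hx X V (smoothFields.ext_apply V),
      g.nablaOn_val hO hx X W (smoothFields.ext_apply W), ← smoothFields.ext_apply X,
      mvfderiv_inner ((smoothFields.ext_smooth X).diffFieldAt hO y.2)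
        ((smoothFields.ext_smooth V).diffFieldAt hO y.2)
        ((smoothFields.ext_smooth W).diffFieldAt hO y.2), smoothFields.ext_apply V,
      smoothFields.ext_apply W]
  dual i j := by
    ext y
    rw [metricOn_val, g.symm]
    change g.inner y (coframeField g x₀ j y) (frameField x₀ i y) = _
    rw [inner_coframeField g (hx y.2), frameField_apply (hx y.2), Basis.repr_self,
      Finsupp.single_apply]
    split_ifs <;> rfl
  expand V := by
    ext1
    funext y
    rw [smoothFields.sum_val]
    simp only [smoothFields.smul_val, metricOn_val]
    exact sum_inner_coframeField g (hx y.2) (V.1 y)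
  bracket_bracket := g.nablaOn_jacobi hO hx

end SemiRiemannianMetric

end KaluzaKlein

/-! ### Algebraic tensors and their pointwise values -/

namespace KaluzaKlein

variable {n : ℕ} {M : Type*} [TopologicalSpace M] [ChartedSpace (EuclideanSpace ℝ (Fin n)) M]
  [IsManifold (𝓡 n) ∞ M]

lemma toBilin_basis {E : Type*} [AddCommGroup E] [Module ℝ E] (b : Basis (Fin n) ℝ E)
    (A : Matrix (Fin n) (Fin n) ℝ) (i j : Fin n) : Matrix.toBilin b A (b i) (b j) = A i j := by
  rw [← LinearMap.BilinForm.toMatrix_apply, LinearMap.BilinForm.toMatrix_toBilin]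

namespace LeviCivitaAlgebra

variable {A 𝔛 ι : Type*} [CommRing A] [AddCommGroup 𝔛] [Module A 𝔛] [Fintype ι] [DecidableEq ι]
  (L : LeviCivitaAlgebra A 𝔛 ι) (B : 𝔛 →ₗ[A] 𝔛 →ₗ[A] A)

/-- The product of the values of a bilinear map. -/
def tensorProd (U V : 𝔛) : 𝔛 →ₗ[A] 𝔛 →ₗ[A] A := (LinearMap.mul A A).compl₁₂ (B U) (B V)

/-- The contraction of the second index of a bilinear map with itself. -/
def contractProd : 𝔛 →ₗ[A] 𝔛 →ₗ[A] A :=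
  ∑ j, (LinearMap.mul A A).compl₁₂ (B.flip (L.frame j)) (B.flip (L.coframe j))

lemma contractProd_apply (U V : 𝔛) :
    L.contractProd B U V = L.contract (tensorProd B U V) := by
  simp [contractProd, contract, tensorProd]

lemma contract_contractProd : L.contract (L.contractProd B)
    = ∑ i, ∑ j, B (L.frame i) (L.frame j) * B (L.coframe i) (L.coframe j) := by
  simp [contractProd, contract]

end LeviCivitaAlgebra

namespace SemiRiemannianMetric

variable (g : SemiRiemannianMetric n M) {x₀ : M} {O : Set M} (hO : IsOpen O)
  (hx : O ⊆ frameDomain n x₀)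

section Values

variable (y : O)

lemma algebraOn_act_val (X : smoothFields n O) (f : smoothFunctions n O) {F : M → ℝ}
    (hF : ∀ z : O, F z = f.1 z) :
    ((g.algebraOn hO hx).act X f).1 y = mvfderiv (𝓡 n) F y (X.1 y) := actOn_val hO X f hF y

lemma algebraOn_nabla_val (X V : smoothFields n O) {F : ∀ x : M, TangentSpace (𝓡 n) x}
    (hF : ∀ z : O, F z = V.1 z) :
    ((g.algebraOn hO hx).nabla X V).1 y = g.leviCivita F y (X.1 y) :=
  g.nablaOn_val hO hx X V hF y

lemma algebraOn_metric_val (V W : smoothFields n O) :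
    ((g.algebraOn hO hx).metric V W).1 y = g.inner y (V.1 y) (W.1 y) := g.metricOn_val V W y

lemma algebraOn_frame_val (i : Fin n) :
    ((g.algebraOn hO hx).frame i).1 y = frameBasis x₀ (hx y.2) i := frameField_apply (hx y.2) i

lemma algebraOn_coframe_val (i : Fin n) :
    ((g.algebraOn hO hx).coframe i).1 y = coframeField g x₀ i y := rfl

include g hO hx in
/-- The value of a tensorial operation at a point depends only on the value of its argument. -/
lemma tensorial_val (B : smoothFields n O →ₗ[smoothFunctions n O] smoothFunctions n O)
    {V W : smoothFields n O} (h : V.1 y = W.1 y) : (B V).1 y = (B W).1 y := by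
  rw [(g.algebraOn hO hx).expand V, (g.algebraOn hO hx).expand W]
  simp only [map_sum, map_smul, smoothFunctions.sum_val, smul_eq_mul, smoothFunctions.mul_val,
    algebraOn_metric_val, h]

include g hO hx in
lemma tensorial_val_field (B : smoothFields n O →ₗ[smoothFunctions n O] smoothFields n O)
    {V W : smoothFields n O} (h : V.1 y = W.1 y) : (B V).1 y = (B W).1 y := by
  rw [(g.algebraOn hO hx).expand V, (g.algebraOn hO hx).expand W]
  simp only [map_sum, map_smul, smoothFields.sum_val, smoothFields.smul_val,
    algebraOn_metric_val, h]

/-- The linear combination with constant coefficients of vector fields. -/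
noncomputable def constComb (c : Fin n → ℝ) (C : Fin n → smoothFields n O) : smoothFields n O :=
  ∑ i, algebraMap ℝ (smoothFunctions n O) (c i) • C i

lemma constComb_val (c : Fin n → ℝ) (C : Fin n → smoothFields n O) :
    (constComb c C).1 y = ∑ i, c i • (C i).1 y := by
  rw [constComb, smoothFields.sum_val]
  rfl

variable (b : Basis (Fin n) ℝ (TangentSpace (𝓡 n) (y : M))) (C : Fin n → smoothFields n O)
  (hC : ∀ i, (C i).1 y = b i)
include hC

lemma constComb_repr (v : TangentSpace (𝓡 n) (y : M)) : (constComb (b.repr v) C).1 y = v := by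
  rw [constComb_val]
  simp only [hC]
  exact b.sum_repr v

include hO hx g in
lemma linear_val (B : smoothFields n O →ₗ[smoothFunctions n O] smoothFields n O)
    (T : End ℝ (TangentSpace (𝓡 n) (y : M))) (h : ∀ i, T (b i) = (B (C i)).1 y)
    (V : smoothFields n O) : T (V.1 y) = (B V).1 y := by
  rw [g.tensorial_val_field hO hx y B (constComb_repr y b C hC (V.1 y)).symm]
  conv_lhs => rw [← b.sum_repr (V.1 y)]
  simp only [constComb, map_sum, map_smul, smoothFields.sum_val, smoothFields.smul_val, h]
  rfl

include hO hx g in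
-- The pointwise tensors are given by components in the coordinate basis at `y`, the algebraic ones
-- by the frame at `x₀`. Function-linearity carries an equality of components to all fields.
lemma bilin_val (B : smoothFields n O →ₗ[smoothFunctions n O] smoothFields n O
      →ₗ[smoothFunctions n O] smoothFunctions n O)
    (β : LinearMap.BilinForm ℝ (TangentSpace (𝓡 n) (y : M)))
    (h : ∀ i j, β (b i) (b j) = (B (C i) (C j)).1 y) (V W : smoothFields n O) :
    β (V.1 y) (W.1 y) = (B V W).1 y := by
  rw [g.tensorial_val hO hx y (B V) (constComb_repr y b C hC (W.1 y)).symm]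
  have h1 := g.tensorial_val hO hx y (B.flip (constComb (b.repr (W.1 y)) C))
    (constComb_repr y b C hC (V.1 y)).symm
  simp only [LinearMap.flip_apply] at h1
  rw [h1]
  conv_lhs => rw [← b.sum_repr (V.1 y), ← b.sum_repr (W.1 y)]
  simp only [constComb, map_sum, map_smul, LinearMap.sum_apply, LinearMap.smul_apply,
    smoothFunctions.sum_val, h, smul_eq_mul, smoothFunctions.mul_val]
  rfl

end Values

variable (y : O)

lemma trace_eq_sum {y : M} (hy : y ∈ frameDomain n x₀) (T : End ℝ (TangentSpace (𝓡 n) y)) :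
    LinearMap.trace ℝ _ T
      = ∑ i, g.inner y (T (frameBasis x₀ hy i)) (coframeField g x₀ i y) := by
  rw [LinearMap.trace_eq_matrix_trace ℝ (frameBasis x₀ hy), Matrix.trace]
  refine Finset.sum_congr rfl fun i _ ↦ ?_
  rw [Matrix.diag_apply, LinearMap.toMatrix_apply, g.symm, inner_coframeField g hy]

lemma contract_val (B : smoothFields n O →ₗ[smoothFunctions n O] smoothFields n O
      →ₗ[smoothFunctions n O] smoothFunctions n O)
    (β : LinearMap.BilinForm ℝ (TangentSpace (𝓡 n) (y : M)))
    (h : ∀ V W : smoothFields n O, β (V.1 y) (W.1 y) = (B V W).1 y) :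
    g.metricTrace y β = ((g.algebraOn hO hx).contract B).1 y := by
  -- The endomorphism of β takes its argument from the second slot, so the trace has the coframe
  -- vector in the first.
  rw [LeviCivitaAlgebra.contract_comm, smoothFunctions.sum_val, metricTrace,
    g.trace_eq_sum (hx y.2)]
  refine Finset.sum_congr rfl fun i _ ↦ ?_
  rw [← h, algebraOn_frame_val, algebraOn_coframe_val, endo]
  exact g.inner_sharp _ _ _

lemma curv_val (U V W : smoothFields n O) {FU FV FW : ∀ x : M, TangentSpace (𝓡 n) x}
    (hU : ∀ z : O, FU z = U.1 z) (hV : ∀ z : O, FV z = V.1 z) (hW : ∀ z : O, FW z = W.1 z) :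
    ((g.algebraOn hO hx).curv U V W).1 y = g.curvature FU FV FW y := by
  rw [LeviCivitaAlgebra.curv, smoothFields.sub_val, smoothFields.sub_val, curvature,
    g.algebraOn_nabla_val hO hx y U _ (F := fun z ↦ g.leviCivita FW z (FV z)),
    g.algebraOn_nabla_val hO hx y V _ (F := fun z ↦ g.leviCivita FW z (FU z)),
    g.algebraOn_nabla_val hO hx y _ W hW, hU, hV]
  · congr 2
    exact g.nablaOn_sub_val hO hx U V hU hV y
  · intro z
    rw [g.algebraOn_nabla_val hO hx z U W hW, hU]
  · intro z
    rw [g.algebraOn_nabla_val hO hx z V W hW, hV]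

/-- The Ricci curvature as a bilinear map on vector fields. -/
noncomputable def ricOn : smoothFields n O →ₗ[smoothFunctions n O] smoothFields n O
      →ₗ[smoothFunctions n O] smoothFunctions n O :=
  LinearMap.mk₂ _ (g.algebraOn hO hx).ric (by simp) (by simp) (by simp) (by simp)

/-- The coordinate fields at `y`, on an open set in the domain of the coordinates. -/
noncomputable def coordOn {y : M} (hy : O ⊆ frameDomain n y) (i : Fin n) : smoothFields n O :=
  smoothFields.mk (coordField y i) ((coordField_smooth y i).mono hy)

lemma coordOn_val (hy : O ⊆ frameDomain n (y : M)) (i : Fin n) :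
    (coordOn hy i).1 y = tangentBasis (y : M) i := coordField_self _ _

/-- Both sides are the trace of U ↦ R(U, V)W, computed in two bases. The inclusion `hy` makes the
coordinate fields at `y` smooth on all of `O`. -/
lemma ricci_val_aux (hy : O ⊆ frameDomain n (y : M)) (V W : smoothFields n O) :
    g.ricci y (V.1 y) (W.1 y) = ((g.algebraOn hO hx).ric V W).1 y := by
  refine g.bilin_val hO hx y (tangentBasis (y : M)) (coordOn hy) (coordOn_val y hy)
    (g.ricOn hO hx) _ (fun i j ↦ ?_) V W
  change g.ricci y (tangentBasis (y : M) i) (tangentBasis (y : M) j)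
    = ((g.algebraOn hO hx).ric (coordOn hy i) (coordOn hy j)).1 y
  rw [ricci, toBilin_basis, Matrix.of_apply]
  let φ : smoothFields n O →ₗ[smoothFunctions n O] smoothFields n O :=
    { toFun := fun U ↦ (g.algebraOn hO hx).curv U (coordOn hy i) (coordOn hy j)
      map_add' := by simp
      map_smul' := by simp }
  let T : End ℝ (TangentSpace (𝓡 n) (y : M)) :=
    (tangentBasis (y : M)).constr ℝ fun k ↦ (φ (coordOn hy k)).1 y
  have hT := g.linear_val hO hx y (tangentBasis (y : M)) (coordOn hy) (coordOn_val y hy) φ T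
    (fun k ↦ Basis.constr_basis ..)
  have h1 : LinearMap.trace ℝ _ T = ∑ k, (tangentBasis (y : M)).coord k
      (g.curvature (coordField (y : M) k) (coordField (y : M) i) (coordField (y : M) j) y) := by
    rw [LinearMap.trace_eq_matrix_trace ℝ (tangentBasis (y : M)), Matrix.trace]
    refine Finset.sum_congr rfl fun k _ ↦ ?_
    rw [Matrix.diag_apply, LinearMap.toMatrix_apply, Basis.constr_basis,
      ← g.curv_val hO hx y (coordOn hy k) (coordOn hy i) (coordOn hy j) (fun _ ↦ rfl)
        (fun _ ↦ rfl) (fun _ ↦ rfl)]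
    rfl
  rw [← h1, g.trace_eq_sum (hx y.2), LeviCivitaAlgebra.ric, smoothFunctions.sum_val]
  refine Finset.sum_congr rfl fun k _ ↦ ?_
  rw [← g.algebraOn_frame_val hO hx, hT, LeviCivitaAlgebra.riem, algebraOn_metric_val]
  rfl

/-- The right side does not mention `O`, so it allows the domain to be shrunk. -/
lemma ric_val (V W : smoothFields n O) {FV FW : ∀ x : M, TangentSpace (𝓡 n) x}
    (hV : ∀ z : O, FV z = V.1 z) (hW : ∀ z : O, FW z = W.1 z) :
    ((g.algebraOn hO hx).ric V W).1 y
      = ∑ i, g.inner y (g.curvature (frameField x₀ i) FV FW y) (coframeField g x₀ i y) := by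
  rw [LeviCivitaAlgebra.ric, smoothFunctions.sum_val]
  refine Finset.sum_congr rfl fun k _ ↦ ?_
  rw [LeviCivitaAlgebra.riem, algebraOn_metric_val, algebraOn_coframe_val,
    g.curv_val hO hx y _ V W (FU := frameField x₀ k) (fun _ ↦ rfl) hV hW]

/-- Shrinking `O` to its intersection with the chart domain at `y` changes neither side. -/
lemma ricci_val (V W : smoothFields n O) :
    g.ricci y (V.1 y) (W.1 y) = ((g.algebraOn hO hx).ric V W).1 y := by
  have hO' : IsOpen (O ∩ frameDomain n (y : M)) := hO.inter (Trivialization.open_baseSet _)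
  have hy : (y : M) ∈ O ∩ frameDomain n (y : M) :=
    ⟨y.2, FiberBundle.mem_baseSet_trivializationAt' _⟩
  let V' : smoothFields n (O ∩ frameDomain n (y : M)) :=
    smoothFields.mk (smoothFields.ext V) ((smoothFields.ext_smooth V).mono inter_subset_left)
  let W' : smoothFields n (O ∩ frameDomain n (y : M)) :=
    smoothFields.mk (smoothFields.ext W) ((smoothFields.ext_smooth W).mono inter_subset_left)
  have h := g.ricci_val_aux hO' (inter_subset_left.trans hx) ⟨y, hy⟩ inter_subset_right V' W'
  rw [g.ric_val hO' (inter_subset_left.trans hx) ⟨y, hy⟩ V' W' (FV := smoothFields.ext V)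
    (FW := smoothFields.ext W) (fun _ ↦ rfl) (fun _ ↦ rfl)] at h
  rw [g.ric_val hO hx y V W (smoothFields.ext_apply V) (smoothFields.ext_apply W), ← h]
  change _ = g.ricci y (smoothFields.ext V y) (smoothFields.ext W y)
  rw [smoothFields.ext_apply, smoothFields.ext_apply]

lemma scalarCurvature_val : g.scalarCurvature y = (g.algebraOn hO hx).scal.1 y :=
  g.contract_val hO hx y (g.ricOn hO hx) (g.ricci y) (g.ricci_val hO hx y)

lemma einstein_val (V W : smoothFields n O) :
    g.einstein y (V.1 y) (W.1 y) = ((g.algebraOn hO hx).einst V W).1 y := by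
  rw [LeviCivitaAlgebra.einst, smoothFunctions.sub_val, smoothFunctions.mul_val,
    smoothFunctions.mul_val, ← g.ricci_val hO hx, ← g.scalarCurvature_val hO hx,
    algebraOn_metric_val]
  rfl

lemma divergence_val (V : smoothFields n O) {F : ∀ x : M, TangentSpace (𝓡 n) x}
    (hF : ∀ z : O, F z = V.1 z) :
    g.divergence F y = ((g.algebraOn hO hx).div V).1 y := by
  rw [divergence, g.trace_eq_sum (hx y.2), LeviCivitaAlgebra.div, smoothFunctions.sum_val]
  refine Finset.sum_congr rfl fun k _ ↦ ?_
  rw [algebraOn_metric_val, g.algebraOn_nabla_val hO hx y _ V hF, algebraOn_frame_val]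
  rfl

variable (B : smoothFields n O →ₗ[smoothFunctions n O] smoothFields n O
      →ₗ[smoothFunctions n O] smoothFunctions n O)
    (T : ∀ x : M, LinearMap.BilinForm ℝ (TangentSpace (𝓡 n) x))
    (hT : ∀ (z : O) (V W : smoothFields n O), T z (V.1 z) (W.1 z) = (B V W).1 z)
include hT

lemma covDerivTensor_val (hy : O ⊆ frameDomain n (y : M)) (k i j : Fin n) :
    g.covDerivTensor T y k i j = ((g.algebraOn hO hx).act (coordOn hy k)
      (B (coordOn hy i) (coordOn hy j))
      - B ((g.algebraOn hO hx).nabla (coordOn hy k) (coordOn hy i)) (coordOn hy j)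
      - B (coordOn hy i) ((g.algebraOn hO hx).nabla (coordOn hy k) (coordOn hy j))).1 y := by
  rw [smoothFunctions.sub_val, smoothFunctions.sub_val, ← hT, ← hT,
    g.algebraOn_act_val hO hx y _ _ (F := fun z ↦ T z (coordField (y : M) i z)
      (coordField (y : M) j z)) (fun z ↦ hT z (coordOn hy i) (coordOn hy j)),
    g.algebraOn_nabla_val hO hx y _ _ (F := coordField (y : M) i) (fun _ ↦ rfl),
    g.algebraOn_nabla_val hO hx y _ _ (F := coordField (y : M) j) (fun _ ↦ rfl),
    coordOn_val, coordOn_val, coordOn_val]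
  rfl

lemma divTensor_val (hy : O ⊆ frameDomain n (y : M)) (j : Fin n) :
    g.inner y (g.divTensor T y) (tangentBasis (y : M) j)
      = (∑ i, ((g.algebraOn hO hx).act ((g.algebraOn hO hx).frame i)
          (B ((g.algebraOn hO hx).coframe i) (coordOn hy j))
        - B ((g.algebraOn hO hx).nabla ((g.algebraOn hO hx).frame i)
          ((g.algebraOn hO hx).coframe i)) (coordOn hy j)
        - B ((g.algebraOn hO hx).coframe i)
          ((g.algebraOn hO hx).nabla ((g.algebraOn hO hx).frame i) (coordOn hy j)))).1 y := by
  rw [divTensor, g.inner_sharp, Basis.constr_basis]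
  set L := g.algebraOn hO hx with hL
  -- With the last slot fixed, ∇T is bilinear over functions in the other two, so its metric trace
  -- may be taken in the frame instead of the coordinate basis.
  let N : smoothFields n O →ₗ[smoothFunctions n O] smoothFields n O
      →ₗ[smoothFunctions n O] smoothFunctions n O :=
    LinearMap.mk₂ _ (fun U V ↦ L.act U (B V (coordOn hy j)) - B (L.nabla U V) (coordOn hy j)
      - B V (L.nabla U (coordOn hy j)))
      (fun U U' V ↦ by simp only [map_add, AddMonoidHom.add_apply, LinearMap.add_apply]; ring)
      (fun a U V ↦ by
        simp only [map_smul, AddMonoidHom.smul_apply, LinearMap.smul_apply, smul_eq_mul]; ring)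
      (fun U V V' ↦ by simp only [map_add, LinearMap.add_apply]; ring)
      (fun a U V ↦ by
        simp only [map_smul, map_add, LinearMap.add_apply, LinearMap.smul_apply, smul_eq_mul,
          L.act_mul, L.nabla_smul]
        ring)
  change _ = (L.contract N).1 y
  rw [hL]
  refine g.contract_val hO hx y N _ fun V W ↦ ?_
  refine g.bilin_val hO hx y (tangentBasis (y : M)) (coordOn hy) (coordOn_val y hy) N _
    (fun k i ↦ ?_) V W
  rw [toBilin_basis, Matrix.of_apply, g.covDerivTensor_val hO hx y B T hT hy]
  rfl

lemma contraction_val (hy : O ⊆ frameDomain n (y : M)) :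
    g.contraction y (T y) = (∑ i, ∑ j, B ((g.algebraOn hO hx).frame i)
        ((g.algebraOn hO hx).frame j) * B ((g.algebraOn hO hx).coframe i)
          ((g.algebraOn hO hx).coframe j)).1 y := by
  rw [contraction, ← LeviCivitaAlgebra.contract_contractProd]
  refine g.contract_val hO hx y _ _ fun V W ↦ ?_
  refine g.bilin_val hO hx y (tangentBasis (y : M)) (coordOn hy) (coordOn_val y hy) _ _
    (fun i k ↦ ?_) V W
  rw [toBilin_basis, Matrix.of_apply, LeviCivitaAlgebra.contractProd_apply]
  refine g.contract_val hO hx y _ _ fun V W ↦ ?_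
  refine g.bilin_val hO hx y (tangentBasis (y : M)) (coordOn hy) (coordOn_val y hy) _ _
    (fun j l ↦ ?_) V W
  rw [toBilin_basis, Matrix.of_apply]
  simp only [← coordOn_val y hy, hT]
  rfl

end SemiRiemannianMetric

end KaluzaKlein

/-! ### The exterior derivative in charts and the form F -/

namespace KaluzaKlein

variable {n : ℕ} {M : Type*} [TopologicalSpace M] [ChartedSpace (EuclideanSpace ℝ (Fin n)) M]
  [IsManifold (𝓡 n) ∞ M]

/-- The vector field with constant components `v` in the preferred chart at `x`. -/
noncomputable def chartField (x : M) (v : EuclideanSpace ℝ (Fin n)) :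
    ∀ y : M, TangentSpace (𝓡 n) y :=
  fun y ↦ (trivializationAt (EuclideanSpace ℝ (Fin n)) (TangentSpace (𝓡 n)) x).symm y v

lemma chartField_smooth (x : M) (v : EuclideanSpace ℝ (Fin n)) :
    SmoothFieldOn (frameDomain n x) (chartField x v) := by
  set t := trivializationAt (EuclideanSpace ℝ (Fin n)) (TangentSpace (𝓡 n) (M := M)) x
  rw [SmoothFieldOn, t.contMDiffOn_section_baseSet_iff]
  refine (contMDiffOn_const (c := v)).congr fun y hy ↦ ?_
  change (t ⟨y, t.symm y v⟩).2 = _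
  rw [t.apply_mk_symm hy]

lemma frameDomain_eq (x : M) : frameDomain n x = (extChartAt (𝓡 n) x).source := by
  simp [frameDomain]

/-- The expression of a differential form in the preferred chart at `x`. -/
noncomputable def chartForm {k : ℕ} (α : ∀ x : M, TangentSpace (𝓡 n) x [⋀^Fin k]→L[ℝ] ℝ) (x : M)
    (u : EuclideanSpace ℝ (Fin n)) : EuclideanSpace ℝ (Fin n) [⋀^Fin k]→L[ℝ] ℝ :=
  (α ((extChartAt (𝓡 n) x).symm u)).compContinuousLinearMap
        (mfderiv 𝓘(ℝ, EuclideanSpace ℝ (Fin n)) (𝓡 n) (extChartAt (𝓡 n) x).symm u)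

lemma extDer_eq {k : ℕ} (α : ∀ x : M, TangentSpace (𝓡 n) x [⋀^Fin k]→L[ℝ] ℝ) (x : M) :
    extDer α x = (extDeriv (chartForm α x) (extChartAt (𝓡 n) x x)).compContinuousLinearMap
      (mfderiv (𝓡 n) 𝓘(ℝ, EuclideanSpace ℝ (Fin n)) (extChartAt (𝓡 n) x) x) := rfl

lemma mfderiv_extChartAt_symm_apply (x : M) {u : EuclideanSpace ℝ (Fin n)}
    (hu : u ∈ (extChartAt (𝓡 n) x).target) (v : EuclideanSpace ℝ (Fin n)) :
    mfderiv 𝓘(ℝ, EuclideanSpace ℝ (Fin n)) (𝓡 n) (extChartAt (𝓡 n) x).symm u v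
      = chartField x v ((extChartAt (𝓡 n) x).symm u) := by
  have hx : (extChartAt (𝓡 n) x).symm u ∈ frameDomain n x := by
    rw [frameDomain_eq]
    exact (extChartAt (𝓡 n) x).map_target hu
  have h := TangentBundle.symmL_trivializationAt (I := 𝓡 n) (x₀ := x)
    (x := (extChartAt (𝓡 n) x).symm u)
    (by simpa using (extChartAt (𝓡 n) x).map_target hu)
  rw [ModelWithCorners.range_eq_univ, mfderivWithin_univ,
    (extChartAt (𝓡 n) x).right_inv hu] at h
  exact ((Trivialization.symmL_apply _ hx v).symm.trans (DFunLike.congr_fun h v)).symm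

lemma minSmoothness_two_le : minSmoothness ℝ 2 ≤ ∞ := by
  rw [minSmoothness_of_isRCLikeNormedField]
  exact WithTop.coe_le_coe.2 le_top

section Form

variable {k : ℕ} (α : ∀ x : M, TangentSpace (𝓡 n) x [⋀^Fin k]→L[ℝ] ℝ)

lemma pullback_congr {a b : EuclideanSpace ℝ (Fin n) → M} {u : EuclideanSpace ℝ (Fin n)}
    (h : a =ᶠ[𝓝 u] b) :
    ((α (a u)).compContinuousLinearMap (mfderiv 𝓘(ℝ, EuclideanSpace ℝ (Fin n)) (𝓡 n) a u) :
      EuclideanSpace ℝ (Fin n) [⋀^Fin k]→L[ℝ] ℝ)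
      = (α (b u)).compContinuousLinearMap
        (mfderiv 𝓘(ℝ, EuclideanSpace ℝ (Fin n)) (𝓡 n) b u) := by
  -- The two forms live on tangent spaces at a priori different points; evaluating on vectors of the
  -- model space makes them comparable.
  have h1 : ∀ {z z' : M}, z = z' → ∀ v : Fin k → EuclideanSpace ℝ (Fin n), α z v = α z' v := by
    rintro z _ rfl v
    rfl
  ext v
  refine (h1 h.self_of_nhds _).trans ?_
  rw [h.mfderiv_eq]
  rfl

lemma mdifferentiableAt_extChartAt_of_mem {x y : M} (hy : y ∈ frameDomain n x) :
    MDifferentiableAt (𝓡 n) 𝓘(ℝ, EuclideanSpace ℝ (Fin n)) (extChartAt (𝓡 n) x) y :=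
  mdifferentiableAt_extChartAt (by rwa [frameDomain_eq, extChartAt_source] at hy)

lemma mdifferentiableAt_extChartAt_symm {x : M} {u : EuclideanSpace ℝ (Fin n)}
    (hu : u ∈ (extChartAt (𝓡 n) x).target) :
    MDifferentiableAt 𝓘(ℝ, EuclideanSpace ℝ (Fin n)) (𝓡 n) (extChartAt (𝓡 n) x).symm u := by
  have h := mdifferentiableWithinAt_extChartAt_symm (I := 𝓡 n) hu
  rwa [ModelWithCorners.range_eq_univ, mdifferentiableWithinAt_univ] at h

/-- The change of coordinates of differential forms. -/
lemma chartForm_eventuallyEq {x y : M} (hy : y ∈ frameDomain n x) :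
    chartForm α y =ᶠ[𝓝 (extChartAt (𝓡 n) y y)] fun u ↦
      (chartForm α x ((extChartAt (𝓡 n) x ∘ (extChartAt (𝓡 n) y).symm) u)).compContinuousLinearMap
        (fderiv ℝ (extChartAt (𝓡 n) x ∘ (extChartAt (𝓡 n) y).symm) u) := by
  have hy' : y ∈ (extChartAt (𝓡 n) x).source := frameDomain_eq (n := n) x ▸ hy
  have h1 : ∀ᶠ u in 𝓝 (extChartAt (𝓡 n) y y), (extChartAt (𝓡 n) y).symm u ∈ frameDomain n x := by
    refine (continuousAt_extChartAt_symm y).preimage_mem_nhds ?_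
    rw [extChartAt_to_inv]
    exact (Trivialization.open_baseSet _).mem_nhds hy
  have h2 : (extChartAt (𝓡 n) y).target ∈ 𝓝 (extChartAt (𝓡 n) y y) := extChartAt_target_mem_nhds y
  filter_upwards [h1.eventually_nhds, h2] with u hu hu2
  have h3 : (extChartAt (𝓡 n) y).symm =ᶠ[𝓝 u]
      (extChartAt (𝓡 n) x).symm ∘ (extChartAt (𝓡 n) x ∘ (extChartAt (𝓡 n) y).symm) := by
    filter_upwards [hu] with z hz
    rw [frameDomain_eq] at hz
    exact ((extChartAt (𝓡 n) x).left_inv hz).symm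
  have h4 := hu.self_of_nhds
  have h5 : extChartAt (𝓡 n) x ((extChartAt (𝓡 n) y).symm u) ∈ (extChartAt (𝓡 n) x).target :=
    (extChartAt (𝓡 n) x).map_source (frameDomain_eq (n := n) x ▸ h4)
  rw [chartForm, pullback_congr α h3, mfderiv_comp u (mdifferentiableAt_extChartAt_symm h5)
    ((mdifferentiableAt_extChartAt_of_mem h4).comp u (mdifferentiableAt_extChartAt_symm hu2)),
    mfderiv_eq_fderiv]
  rfl

lemma contDiffAt_coordChange {x y : M} (hy : y ∈ frameDomain n x) :
    ContDiffAt ℝ ∞ (extChartAt (𝓡 n) x ∘ (extChartAt (𝓡 n) y).symm) (extChartAt (𝓡 n) y y) := by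
  rw [← contMDiffAt_iff_contDiffAt]
  refine ContMDiffAt.comp (I' := 𝓡 n) _ ?_ ?_
  · rw [extChartAt_to_inv]
    exact contMDiffAt_extChartAt' (by rwa [frameDomain_eq, extChartAt_source] at hy)
  · exact (contMDiffOn_extChartAt_symm y).contMDiffAt (extChartAt_target_mem_nhds y)

/-- The exterior derivative may be computed in any of the preferred charts. -/
lemma extDer_eq_of_mem {x y : M} (hy : y ∈ frameDomain n x)
    (hα : DifferentiableAt ℝ (chartForm α x) (extChartAt (𝓡 n) x y)) :
    extDer α y = (extDeriv (chartForm α x) (extChartAt (𝓡 n) x y)).compContinuousLinearMap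
      (mfderiv (𝓡 n) 𝓘(ℝ, EuclideanSpace ℝ (Fin n)) (extChartAt (𝓡 n) x) y) := by
  have h := (extChartAt_to_inv (I := 𝓡 n) y)
  rw [extDer_eq, (chartForm_eventuallyEq α hy).extDeriv_eq,
    extDeriv_pullback (r := ∞) (by simpa [h] using hα) (contDiffAt_coordChange hy)
      minSmoothness_two_le]
  have h1 : (extChartAt (𝓡 n) x ∘ (extChartAt (𝓡 n) y).symm) ∘ extChartAt (𝓡 n) y
      =ᶠ[𝓝 y] extChartAt (𝓡 n) x := by
    filter_upwards [extChartAt_source_mem_nhds (I := 𝓡 n) y] with z hz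
    exact congrArg (extChartAt (𝓡 n) x) ((extChartAt (𝓡 n) y).left_inv hz)
  rw [← h1.mfderiv_eq, mfderiv_comp y _
    (mdifferentiableAt_extChartAt_of_mem (FiberBundle.mem_baseSet_trivializationAt' y)),
    mfderiv_eq_fderiv, Function.comp_apply, h]
  · rfl
  · rw [mdifferentiableAt_iff_differentiableAt]
    exact (contDiffAt_coordChange hy).differentiableAt (by simp)

/-- The second exterior derivative is zero. -/
lemma extDer_extDer {x : M}
    (hα : ContDiffOn ℝ ∞ (chartForm α x) (extChartAt (𝓡 n) x).target) :
    extDer (extDer α) x = 0 := by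
  have h2 : (extChartAt (𝓡 n) x).target ∈ 𝓝 (extChartAt (𝓡 n) x x) := extChartAt_target_mem_nhds x
  -- The exterior derivative at each nearby point uses that point's own chart. Transporting it to
  -- the chart at `x` reduces the claim to d² = 0 in the model space.
  have h : chartForm (extDer α) x =ᶠ[𝓝 (extChartAt (𝓡 n) x x)] extDeriv (chartForm α x) := by
    filter_upwards [h2] with u hu
    have h3 := (extChartAt (𝓡 n) x).map_target hu
    rw [← frameDomain_eq] at h3
    have h4 := (extChartAt (𝓡 n) x).right_inv hu
    have h5 : DifferentiableAt ℝ (chartForm α x) u :=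
      (hα.contDiffAt ((isOpen_extChartAt_target x).mem_nhds hu)).differentiableAt (by simp)
    rw [chartForm, extDer_eq_of_mem α h3 (by rwa [h4])]
    have h6 : mfderiv (𝓡 n) 𝓘(ℝ, EuclideanSpace ℝ (Fin n)) (extChartAt (𝓡 n) x)
        ((extChartAt (𝓡 n) x).symm u) ∘L mfderiv 𝓘(ℝ, EuclideanSpace ℝ (Fin n)) (𝓡 n)
          (extChartAt (𝓡 n) x).symm u = ContinuousLinearMap.id ℝ _ := by
      have := mfderiv_extChartAt_comp_mfderivWithin_extChartAt_symm (I := 𝓡 n) hu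
      rwa [ModelWithCorners.range_eq_univ, mfderivWithin_univ] at this
    ext v
    have h7 : ∀ w : EuclideanSpace ℝ (Fin n),
      mfderiv (𝓡 n) 𝓘(ℝ, EuclideanSpace ℝ (Fin n)) (extChartAt (𝓡 n) x)
        ((extChartAt (𝓡 n) x).symm u) (mfderiv 𝓘(ℝ, EuclideanSpace ℝ (Fin n)) (𝓡 n)
          (extChartAt (𝓡 n) x).symm u w) = w := fun w ↦ DFunLike.congr_fun h6 w
    refine (congrArg (extDeriv (chartForm α x) (extChartAt (𝓡 n) x ((extChartAt (𝓡 n) x).symm u)))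
      (funext fun i ↦ h7 (v i))).trans ?_
    rw [h4]
  rw [extDer_eq, h.extDeriv_eq,
    extDeriv_extDeriv_apply (r := ∞) (hα.contDiffAt h2) minSmoothness_two_le]
  rfl

end Form

section Potential

variable (g : SemiRiemannianMetric n M) (Y : ∀ x : M, TangentSpace (𝓡 n) x)

/-- The 1-form associated to a vector field by the metric. -/
noncomputable def flatForm (x : M) : TangentSpace (𝓡 n) x [⋀^Fin 1]→L[ℝ] ℝ :=
  ContinuousAlternatingMap.ofSubsingleton ℝ (TangentSpace (𝓡 n) x) ℝ (0 : Fin 1) (g.inner x (Y x))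

lemma emForm_eq : emForm g Y = extDer (flatForm g Y) := rfl

lemma chartForm_flatForm_apply {x : M} {u : EuclideanSpace ℝ (Fin n)}
    (hu : u ∈ (extChartAt (𝓡 n) x).target) (v : Fin 1 → EuclideanSpace ℝ (Fin n)) :
    chartForm (flatForm g Y) x u v = (fun y ↦ g.inner y (Y y) (chartField x (v 0) y))
      ((extChartAt (𝓡 n) x).symm u) := by
  change _ = g.inner _ (Y _) (chartField x (v 0) _)
  rw [← mfderiv_extChartAt_symm_apply x hu]
  rfl

variable {Y} (hY : SmoothFieldOn univ Y)
include hY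

/-- A 1-form on the model space is smooth once its values on constant vectors are, and these are
inner products of smooth fields read in the chart. -/
lemma chartForm_flatForm_contDiffOn (x : M) :
    ContDiffOn ℝ ∞ (chartForm (flatForm g Y) x) (extChartAt (𝓡 n) x).target := by
  let E := EuclideanSpace ℝ (Fin n)
  let J := ContinuousAlternatingMap.ofSubsingletonLIE (𝕜 := ℝ) (E := E) (F := ℝ) (0 : Fin 1)
  have h : ContDiffOn ℝ ∞ (fun u ↦ J.symm (chartForm (flatForm g Y) x u))
      (extChartAt (𝓡 n) x).target := by
    rw [contDiffOn_clm_apply]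
    intro v
    have h1 : ContDiffOn ℝ ∞ ((fun y ↦ g.inner y (Y y) (chartField x v y)) ∘
        (extChartAt (𝓡 n) x).symm) (extChartAt (𝓡 n) x).target := by
      rw [← contMDiffOn_iff_contDiffOn]
      refine (g.smooth_inner (hY.mono (subset_univ _)) (chartField_smooth x v)).comp
        (contMDiffOn_extChartAt_symm x) fun u hu ↦ ?_
      rw [mem_preimage, frameDomain_eq]
      exact (extChartAt (𝓡 n) x).map_target hu
    refine h1.congr fun u hu ↦ ?_
    exact chartForm_flatForm_apply g Y hu fun _ ↦ v
  refine (J.contDiff.comp_contDiffOn h).congr fun u _ ↦ ?_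
  exact (J.apply_symm_apply _).symm

/-- The homogeneous Maxwell equation. -/
lemma extDer_emForm (x : M) : extDer (emForm g Y) x = 0 :=
  extDer_extDer _ (chartForm_flatForm_contDiffOn g hY x)

omit hY in
lemma chartField_self (x : M) (v : EuclideanSpace ℝ (Fin n)) : chartField x v x = v := by
  have h := mfderiv_extChartAt_symm_apply x (mem_extChartAt_target (I := 𝓡 n) x) v
  have h2 := mfderivWithin_range_extChartAt_symm (I := 𝓡 n) (x := x)
  rw [ModelWithCorners.range_eq_univ, mfderivWithin_univ] at h2
  rw [h2] at h
  have h3 : ∀ {y : M}, y = x → (chartField x v y : EuclideanSpace ℝ (Fin n)) = chartField x v x := by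
    rintro _ rfl
    rfl
  exact (h3 (extChartAt_to_inv (I := 𝓡 n) x)).symm.trans h.symm

omit hY [ChartedSpace (EuclideanSpace ℝ (Fin n)) M] [IsManifold (𝓡 n) ∞ M] in
lemma lieBracketWithin_eq_zero {E : Type*} [NormedAddCommGroup E] [NormedSpace ℝ E]
    {V W : E → E} {u v w : E} {s : Set E} (hV : V =ᶠ[𝓝 u] fun _ ↦ v) (hW : W =ᶠ[𝓝 u] fun _ ↦ w)
    (hs : s = univ) : lieBracketWithin ℝ V W s u = 0 := by
  rw [hs, lieBracketWithin_univ, hV.lieBracket_vectorField_eq hW]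
  simp [lieBracket]

omit hY in
-- The pullbacks of both fields to the chart are constant.
lemma mlieBracket_chartField (x : M) (v w : EuclideanSpace ℝ (Fin n)) :
    mlieBracket (𝓡 n) (chartField x v) (chartField x w) x = 0 := by
  have h (v : EuclideanSpace ℝ (Fin n)) : mpullbackWithin 𝓘(ℝ, EuclideanSpace ℝ (Fin n)) (𝓡 n)
      (extChartAt (𝓡 n) x).symm (chartField x v) (range (𝓡 n))
      =ᶠ[𝓝 (extChartAt (𝓡 n) x x)] fun _ ↦ v := by
    filter_upwards [extChartAt_target_mem_nhds (I := 𝓡 n) x] with u hu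
    have h1 := isInvertible_mfderivWithin_extChartAt_symm hu
    rw [mpullbackWithin_apply]
    have h2 := mfderiv_extChartAt_symm_apply x hu v
    rw [← mfderivWithin_univ, ← ModelWithCorners.range_eq_univ (𝓡 n)] at h2
    rw [← h2]
    exact h1.inverse_apply_self v
  rw [mlieBracket, mlieBracketWithin_apply]
  refine (congrArg _ (lieBracketWithin_eq_zero (h v) (h w) ?_)).trans (map_zero _)
  rw [preimage_univ, univ_inter, ModelWithCorners.range_eq_univ]

/-- Differentiating ⟨Y, ·⟩ on constant-coefficient fields and skewing: the terms ⟨Y, ∇_v w⟩ cancel,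
because such fields commute and the torsion is zero. -/
lemma emTensor_apply (x : M) (v w : TangentSpace (𝓡 n) x) :
    emTensor g Y x v w = g.inner x (g.leviCivita Y x v) w - g.inner x (g.leviCivita Y x w) v := by
  have hY' : DiffFieldAt Y x := hY.diffFieldAt isOpen_univ (mem_univ x)
  have hd : DifferentiableAt ℝ (chartForm (flatForm g Y) x) (extChartAt (𝓡 n) x x) :=
    ((chartForm_flatForm_contDiffOn g hY x).contDiffAt
      (extChartAt_target_mem_nhds x)).differentiableAt (by simp)
  have hc (v : EuclideanSpace ℝ (Fin n)) : DiffFieldAt (chartField x v) x :=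
    (chartField_smooth x v).diffFieldAt (Trivialization.open_baseSet _)
      (FiberBundle.mem_baseSet_trivializationAt' x)
  have key (v w : EuclideanSpace ℝ (Fin n)) (z : Fin 1 → EuclideanSpace ℝ (Fin n)) (hz : z 0 = w) :
      fderiv ℝ (fun u ↦ chartForm (flatForm g Y) x u z) (extChartAt (𝓡 n) x x) v
        = g.inner x (g.leviCivita Y x v) w
          + g.inner x (Y x) (g.leviCivita (chartField x w) x v) := by
    have h1 : (fun u ↦ chartForm (flatForm g Y) x u z) =ᶠ[𝓝 (extChartAt (𝓡 n) x x)]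
        (fun y ↦ g.inner y (Y y) (chartField x w y)) ∘ (extChartAt (𝓡 n) x).symm := by
      filter_upwards [extChartAt_target_mem_nhds (I := 𝓡 n) x] with u hu
      rw [chartForm_flatForm_apply g Y hu, hz]
      rfl
    have h2 := SemiRiemannianMetric.mvfderiv_inner (g := g) (hc v) hY' (hc w)
    rw [chartField_self, chartField_self] at h2
    have h3 := (SemiRiemannianMetric.mdiff_inner (g := g) hY' (hc w)).mfderiv
    rw [ModelWithCorners.range_eq_univ, fderivWithin_univ] at h3
    rw [← h2, h1.fderiv_eq]
    exact (DFunLike.congr_fun h3 v).symm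
  have hs (v w : EuclideanSpace ℝ (Fin n)) : g.leviCivita (chartField x w) x v
      = g.leviCivita (chartField x v) x w := by
    have hs := SemiRiemannianMetric.leviCivita_sub (g := g) (hc v) (hc w)
    rw [mlieBracket_chartField, chartField_self, chartField_self] at hs
    exact sub_eq_zero.1 hs
  have h0 : emTensor g Y x v w
      = extDeriv (chartForm (flatForm g Y) x) (extChartAt (𝓡 n) x x) ![v, w] := by
    change emForm g Y x ![v, w] = _
    rw [emForm_eq, extDer_eq, mfderiv_extChartAt_self]
    rfl
  rw [h0, extDeriv_apply hd, Fin.sum_univ_two]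
  -- Deleting entry 0 of the pair leaves the derivative along `v` evaluated on `w`; deleting entry 1
  -- exchanges the two, with a minus sign.
  refine (congrArg₂ (fun a b : ℝ ↦ (-1 : ℤ) ^ 0 • a + (-1 : ℤ) ^ 1 • b)
    (key v w (Fin.removeNth 0 ![v, w]) rfl) (key w v (Fin.removeNth 1 ![v, w]) rfl)).trans ?_
  rw [hs v w]
  simp only [pow_zero, one_smul, pow_one, neg_smul]
  ring

end Potential

end KaluzaKlein

/-! ### From the fluid on D to the algebraic fluid -/

namespace KaluzaKlein

namespace LeviCivitaAlgebra

variable {A 𝔛 ι : Type*} [CommRing A] [AddCommGroup 𝔛] [Module A 𝔛] [Fintype ι] [DecidableEq ι]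
  (L : LeviCivitaAlgebra A 𝔛 ι)

/-- The exterior derivative of the covector field of a Killing field. -/
def killingForm (Y : 𝔛) : 𝔛 →ₗ[A] 𝔛 →ₗ[A] A :=
  LinearMap.mk₂ A (fun V W ↦ 2 * L.metric (L.nabla V Y) W)
    (fun V V' W ↦ by simp [mul_add])
    (fun a V W ↦ by simp [mul_left_comm])
    (fun V W W' ↦ by simp [mul_add])
    (fun a V W ↦ by simp [mul_left_comm])

@[simp] lemma killingForm_apply (Y V W : 𝔛) :
    L.killingForm Y V W = 2 * L.metric (L.nabla V Y) W := rfl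

/-- Each factor carries a 2, and the sum over the second index reassembles an inner product. -/
lemma sum_killingForm_mul (Y : 𝔛) :
    ∑ i, ∑ j, L.killingForm Y (L.frame i) (L.frame j) * L.killingForm Y (L.coframe i) (L.coframe j)
      = 4 * ∑ i, L.metric (L.nabla (L.frame i) Y) (L.nabla (L.coframe i) Y) := by
  rw [Finset.mul_sum]
  refine Finset.sum_congr rfl fun i _ ↦ ?_
  rw [L.symm, L.metric_eq_sum, Finset.mul_sum]
  refine Finset.sum_congr rfl fun j _ ↦ ?_
  rw [L.symm (L.frame j), killingForm_apply, killingForm_apply]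
  ring

/-- The covariant derivative of F is twice the Hessian of Y, so its trace falls under
`IsPerfectFluid.maxwell`. -/
lemma killingForm_nabla (Y W U V : 𝔛) :
    L.act U (L.killingForm Y V W) - L.killingForm Y (L.nabla U V) W
        - L.killingForm Y V (L.nabla U W)
      = 2 * L.metric (L.nabla U (L.nabla V Y) - L.nabla (L.nabla U V) Y) W := by
  have h2 : L.act U (2 * L.metric (L.nabla V Y) W) = 2 * L.act U (L.metric (L.nabla V Y) W) := by
    rw [two_mul, map_add, two_mul]
  simp only [killingForm_apply, h2, L.compat, map_sub, LinearMap.sub_apply]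
  ring

end LeviCivitaAlgebra

variable {n : ℕ} {M : Type*} [TopologicalSpace M] [ChartedSpace (EuclideanSpace ℝ (Fin n)) M]
  [IsManifold (𝓡 n) ∞ M]

/-- A perfect isentropic fluid with apparent field `X₀`, energy density `μ` and pressure `p` on the
open set `D`, on a manifold with the potential `Y`. -/
structure IsPerfectFluidOn (g : SemiRiemannianMetric n M) (Y X₀ : ∀ x : M, TangentSpace (𝓡 n) x)
    (D : Set M) (μ p : M → ℝ) : Prop where
  smooth_Y : SmoothFieldOn univ Y
  unit_Y (x : M) : g.inner x (Y x) (Y x) = -1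
  killing : g.IsKilling Y
  isOpen : IsOpen D
  smooth_X : SmoothFieldOn D X₀
  unit_X : ∀ x ∈ D, g.inner x (X₀ x) (X₀ x) = -1
  ortho : ∀ x ∈ D, g.inner x (X₀ x) (Y x) = 0
  ne_zero : ∀ x ∈ D, μ x ≠ 0
  energy : ∀ x ∈ D, g.einstein x (X₀ x) (X₀ x) = μ x
  perfect : IsPerfectIsentropic g Y X₀ D p

namespace IsPerfectFluidOn

variable {g : SemiRiemannianMetric n M} {Y X₀ : ∀ x : M, TangentSpace (𝓡 n) x} {D : Set M}
  {μ p : M → ℝ} (h : IsPerfectFluidOn g Y X₀ D μ p) (x₀ : M)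

variable (n D) in
/-- The part of the fluid domain in the domain of a chart. -/
abbrev chartDomain : Set M := D ∩ frameDomain n x₀

section
include h

lemma isOpen_chartDomain : IsOpen (chartDomain n D x₀) :=
  h.isOpen.inter (Trivialization.open_baseSet _)

/-- The Levi-Civita algebra of vector fields on the chart domain. -/
noncomputable abbrev algebra : LeviCivitaAlgebra (smoothFunctions n (chartDomain n D x₀))
    (smoothFields n (chartDomain n D x₀)) (Fin n) :=
  g.algebraOn (h.isOpen_chartDomain x₀) inter_subset_right

/-- The restriction of the potential. -/
def potential : smoothFields n (chartDomain n D x₀) :=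
  smoothFields.mk Y (h.smooth_Y.mono (subset_univ _))

/-- The restriction of the apparent field. -/
def apparent : smoothFields n (chartDomain n D x₀) :=
  smoothFields.mk X₀ (h.smooth_X.mono inter_subset_left)

/-- The restriction of the pressure. -/
def press : smoothFunctions n (chartDomain n D x₀) :=
  smoothFunctions.mk p (h.perfect.smooth.mono inter_subset_left)

/-- The restriction of the energy density. -/
noncomputable def energyOn : smoothFunctions n (chartDomain n D x₀) :=
  -- No smoothness of μ is assumed: it follows from μ = G(X₀, X₀), whose right side is visibly
  -- smooth.
  (h.algebra x₀).einst (h.apparent x₀) (h.apparent x₀)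

/-- The restriction of the charge density. -/
noncomputable def chargeOn : smoothFunctions n (chartDomain n D x₀) :=
  (h.algebra x₀).einst (h.apparent x₀) (h.potential x₀)

end

variable (z : chartDomain n D x₀)

lemma potential_val : (h.potential x₀).1 z = Y z := rfl

lemma apparent_val : (h.apparent x₀).1 z = X₀ z := rfl

lemma press_val : (h.press x₀).1 z = p z := rfl

lemma energyOn_val : (h.energyOn x₀).1 z = μ z := by
  rw [energyOn, ← g.einstein_val]
  exact h.energy z z.2.1

lemma chargeOn_val : (h.chargeOn x₀).1 z = chargeDensity g Y X₀ z := by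
  rw [chargeOn, ← g.einstein_val]
  rfl

lemma einst_symm (V W : smoothFields n (chartDomain n D x₀)) :
    (h.algebra x₀).einst V W = (h.algebra x₀).einst W V := by
  rw [LeviCivitaAlgebra.einst, LeviCivitaAlgebra.einst, LeviCivitaAlgebra.ric_comm,
    (h.algebra x₀).symm]

lemma isPerfectFluid : (h.algebra x₀).IsPerfectFluid (h.apparent x₀) (h.potential x₀)
    (h.energyOn x₀) (h.chargeOn x₀)
    ((h.algebra x₀).einst (h.potential x₀) (h.potential x₀)) (h.press x₀) where
  killing V W := by
    ext z
    rw [smoothFunctions.add_val, g.algebraOn_metric_val, g.algebraOn_metric_val,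
      g.algebraOn_nabla_val _ _ z V _ (F := Y) (fun _ ↦ rfl),
      g.algebraOn_nabla_val _ _ z W _ (F := Y) (fun _ ↦ rfl)]
    exact h.killing z (V.1 z) (W.1 z)
  unit_Y := by
    ext z
    rw [g.algebraOn_metric_val]
    exact h.unit_Y z
  unit_T := by
    ext z
    rw [g.algebraOn_metric_val]
    exact h.unit_X z z.2.1
  ortho := by
    ext z
    rw [g.algebraOn_metric_val]
    exact h.ortho z z.2.1
  einst V W := by
    ext z
    -- The definition of the pressure is solved for G: the time-plane projection expands into the
    -- components μ, e and c, and the isentropic pressure supplies the rest.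
    have h1 := h.perfect.isentropic z z.2.1 (V.1 z) (W.1 z)
    have h2 : g.einstein z (Y z) (X₀ z) = chargeDensity g Y X₀ z := by
      rw [← h.chargeOn_val, chargeOn, h.einst_symm, ← g.einstein_val]
      rfl
    have h3 : ((h.algebra x₀).einst (h.potential x₀) (h.potential x₀)).1 z
      = g.einstein z (Y z) (Y z) := (g.einstein_val _ _ z _ _).symm
    have h4 (v : TangentSpace (𝓡 n) (z : M)) : timePlaneProj g Y X₀ z v
      = -(g.inner z (X₀ z) v • X₀ z + g.inner z (Y z) v • Y z) := rfl
    have h5 (v : TangentSpace (𝓡 n) (z : M)) : g.flat z (X₀ z) v = g.inner z (X₀ z) v := rfl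
    have h6 (v : TangentSpace (𝓡 n) (z : M)) : g.flat z (Y z) v = g.inner z (Y z) v := rfl
    have h7 : g.einstein z (X₀ z) (Y z) = chargeDensity g Y X₀ z := rfl
    rw [pressure, LinearMap.sub_apply, LinearMap.sub_apply, LinearMap.compl₁₂_apply, h4, h4,
      h5, h5, h6, h6] at h1
    simp only [map_neg, map_add, map_smul, LinearMap.neg_apply, LinearMap.add_apply,
      LinearMap.smul_apply, smul_eq_mul, h2, h7, h.energy z z.2.1] at h1
    simp only [smoothFunctions.add_val, smoothFunctions.mul_val, h3, energyOn_val, chargeOn_val,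
      press_val, g.algebraOn_metric_val, apparent_val, potential_val, ← g.einstein_val]
    linear_combination h1

lemma exists_inv : ∃ ν, h.energyOn x₀ * ν = 1 ∧ ∀ z, ν.1 z = (μ z)⁻¹ := by
  obtain ⟨ν, hν⟩ := (smoothFunctions.isUnit (f := h.energyOn x₀) fun z ↦ by
    rw [energyOn_val]; exact h.ne_zero z z.2.1).exists_right_inv
  refine ⟨ν, hν, fun z ↦ eq_inv_of_mul_eq_one_right ?_⟩
  have := congrArg (fun f ↦ f.1 z) hν
  simpa [energyOn_val] using this

/-- By the Killing equation the two terms of F in `emTensor_apply` are equal, whence the factor 2.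
-/
lemma emTensor_val (V W : smoothFields n (chartDomain n D x₀)) :
    emTensor g Y z (V.1 z) (W.1 z)
      = ((h.algebra x₀).killingForm (h.potential x₀) V W).1 z := by
  rw [emTensor_apply g h.smooth_Y, LeviCivitaAlgebra.killingForm_apply, smoothFunctions.mul_val,
    g.algebraOn_metric_val, g.algebraOn_nabla_val _ _ z V _ (F := Y) (fun _ ↦ rfl),
    smoothFunctions.two_val]
  have := h.killing z (V.1 z) (W.1 z)
  rw [g.symm z (V.1 z)] at this
  linear_combination -this

end IsPerfectFluidOn

end KaluzaKlein

/-! ### The fluid equations at the points of D -/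

namespace KaluzaKlein

variable {n : ℕ} {M : Type*} [TopologicalSpace M] [ChartedSpace (EuclideanSpace ℝ (Fin n)) M]
  [IsManifold (𝓡 n) ∞ M]

namespace IsPerfectFluidOn

variable {g : SemiRiemannianMetric n M} {Y X₀ : ∀ x : M, TangentSpace (𝓡 n) x} {D : Set M}
  {μ p : M → ℝ} (h : IsPerfectFluidOn g Y X₀ D μ p) {x : M} (hx : x ∈ D)

lemma mem_chartDomain (hx : x ∈ D) : x ∈ chartDomain n D x :=
  ⟨hx, FiberBundle.mem_baseSet_trivializationAt' x⟩

include h hx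

lemma energy_conservation :
    g.divergence (fun y ↦ μ y • X₀ y) x + p x * g.divergence X₀ x = 0 := by
  let y : chartDomain n D x := ⟨x, mem_chartDomain hx⟩
  have h1 := congrArg (fun f ↦ f.1 y) (h.isPerfectFluid x).energy_conservation
  -- T(μ) + μ div T is regrouped as the divergence of μT.
  rw [← LeviCivitaAlgebra.div_smul] at h1
  simp only [smoothFunctions.add_val, smoothFunctions.mul_val] at h1
  rw [← g.divergence_val _ _ y (h.energyOn x • h.apparent x) (F := fun y ↦ μ y • X₀ y)
    (fun z ↦ by rw [smoothFields.smul_val, h.energyOn_val]; rfl),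
    ← g.divergence_val _ _ y (h.apparent x) (F := X₀) (fun _ ↦ rfl)] at h1
  exact h1

lemma charge_conservation :
    g.divergence (fun y ↦ chargeDensity g Y X₀ y • X₀ y) x = 0 := by
  let y : chartDomain n D x := ⟨x, mem_chartDomain hx⟩
  have h1 := congrArg (fun f ↦ f.1 y) (h.isPerfectFluid x).charge_conservation
  rw [← LeviCivitaAlgebra.div_smul] at h1
  rw [g.divergence_val (h.isOpen_chartDomain x) inter_subset_right y
    (h.chargeOn x • h.apparent x)
    (fun z ↦ by rw [smoothFields.smul_val, h.chargeOn_val]; rfl)]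
  exact h1

lemma charge_conservation_fluid :
    g.divergence (fun y ↦ chargeDensity g Y X₀ y • fluidField g Y X₀ μ y) x = 0 := by
  let y : chartDomain n D x := ⟨x, mem_chartDomain hx⟩
  obtain ⟨ν, hν, hν'⟩ := h.exists_inv x
  have h1 := congrArg (fun f ↦ f.1 y) ((h.isPerfectFluid x).charge_conservation_fluid hν)
  rw [g.divergence_val (h.isOpen_chartDomain x) inter_subset_right y
    (h.chargeOn x • (h.apparent x + (h.chargeOn x * ν) • h.potential x))
    (fun z ↦ by
      rw [smoothFields.smul_val, smoothFields.add_val, smoothFields.smul_val,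
        smoothFunctions.mul_val, h.chargeOn_val, hν', ← div_eq_mul_inv]; rfl)]
  exact h1

lemma ratio_evolution :
    μ x ^ 2 * mvfderiv (𝓡 n) (fun y ↦ chargeDensity g Y X₀ y / μ y) x (X₀ x)
      = chargeDensity g Y X₀ x * p x * g.divergence X₀ x := by
  let y : chartDomain n D x := ⟨x, mem_chartDomain hx⟩
  obtain ⟨ν, hν, hν'⟩ := h.exists_inv x
  have h1 := congrArg (fun f ↦ f.1 y) ((h.isPerfectFluid x).ratio_evolution hν)
  simp only [pow_two, smoothFunctions.mul_val] at h1
  rw [g.algebraOn_act_val _ _ y _ (h.chargeOn x * ν) (F := fun y ↦ chargeDensity g Y X₀ y / μ y)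
    (fun z ↦ by rw [smoothFunctions.mul_val, h.chargeOn_val, hν', div_eq_mul_inv]),
    ← g.divergence_val _ _ y (h.apparent x) (F := X₀) (fun _ ↦ rfl), h.energyOn_val,
    h.chargeOn_val] at h1
  rw [pow_two]
  exact h1

lemma ratio_evolution_fluid :
    μ x ^ 2 * mvfderiv (𝓡 n) (fun y ↦ chargeDensity g Y X₀ y / μ y) x (fluidField g Y X₀ μ x)
      = chargeDensity g Y X₀ x * p x * g.divergence X₀ x := by
  let y : chartDomain n D x := ⟨x, mem_chartDomain hx⟩
  obtain ⟨ν, hν, hν'⟩ := h.exists_inv x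
  have h1 := congrArg (fun f ↦ f.1 y) ((h.isPerfectFluid x).act_ratio hν)
  rw [g.algebraOn_act_val _ _ y _ (h.chargeOn x * ν) (F := fun y ↦ chargeDensity g Y X₀ y / μ y)
    (fun z ↦ by rw [smoothFunctions.mul_val, h.chargeOn_val, hν', div_eq_mul_inv])] at h1
  have h2 : mvfderiv (𝓡 n) (fun y ↦ chargeDensity g Y X₀ y / μ y) x (Y x) = 0 := h1
  rw [fluidField, map_add, map_smul, h2, smul_zero, add_zero, h.ratio_evolution hx]

lemma motion (hn : n ≠ 2) : (μ x + p x) • g.leviCivita X₀ x (X₀ x)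
    = chargeDensity g Y X₀ x • g.endo x (emTensor g Y x) (X₀ x)
      - g.grad p x - mvfderiv (𝓡 n) p x (X₀ x) • X₀ x := by
  let y : chartDomain n D x := ⟨x, mem_chartDomain hx⟩
  refine eq_of_inner_frameField g (x₀ := x) y.2.2 fun i ↦ ?_
  change g.inner x _ (frameField x i x) = g.inner x _ (frameField x i x)
  let W := (h.algebra x).frame i
  have h1 := congrArg (fun f ↦ f.1 y) ((h.isPerfectFluid x).motion (by simpa using hn) W)
  have h2 := h.emTensor_val x y W (h.apparent x)
  rw [LeviCivitaAlgebra.killingForm_apply] at h2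
  simp only [smoothFunctions.add_val, smoothFunctions.sub_val, smoothFunctions.mul_val,
    h.energyOn_val, h.chargeOn_val, h.press_val] at h1
  rw [smoothFunctions.mul_val] at h2
  rw [← h2, g.algebraOn_metric_val, g.algebraOn_metric_val,
    g.algebraOn_nabla_val _ _ y _ _ (F := X₀) (fun _ ↦ rfl),
    g.algebraOn_act_val _ _ y W (h.press x) (F := p) (fun _ ↦ rfl),
    g.algebraOn_act_val _ _ y (h.apparent x) (h.press x) (F := p) (fun _ ↦ rfl)] at h1
  have h3 : g.inner x (g.endo x (emTensor g Y x) (X₀ x)) (frameField x i x)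
      = emTensor g Y x (frameField x i x) (X₀ x) := g.inner_sharp x _ _
  have h4 : g.inner x (g.grad p x) (frameField x i x) = mvfderiv (𝓡 n) p x (frameField x i x) :=
    g.inner_sharp x _ _
  simp only [map_sub, map_smul, sub_apply, smul_apply,
    smul_eq_mul, h3, h4]
  exact h1

lemma maxwell : g.divTensor (emTensor g Y) x
    = chargeDensity g Y X₀ x • X₀ x + (1 / 2 * g.contraction x (emTensor g Y x)) • Y x := by
  let y : chartDomain n D x := ⟨x, mem_chartDomain hx⟩
  -- Both sides are tested on the coordinate basis, on which the divergence of a 2-tensor is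
  -- defined.
  have h0 : ∀ {v w : TangentSpace (𝓡 n) x}, (∀ j, g.inner x v (tangentBasis x j)
      = g.inner x w (tangentBasis x j)) → v = w := fun {v w} hvw ↦
    g.eq_of_inner fun z ↦ DFunLike.congr_fun
      ((tangentBasis x).ext hvw : g.bilin x v = g.bilin x w) z
  refine h0 fun j ↦ ?_
  have h1 := g.divTensor_val (h.isOpen_chartDomain x) inter_subset_right y
    ((h.algebra x).killingForm (h.potential x)) (emTensor g Y) (h.emTensor_val x)
    inter_subset_right j
  have h2 := g.contraction_val (h.isOpen_chartDomain x) inter_subset_right y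
    ((h.algebra x).killingForm (h.potential x)) (emTensor g Y) (h.emTensor_val x)
    inter_subset_right
  simp only [LeviCivitaAlgebra.killingForm_nabla, (h.isPerfectFluid x).maxwell] at h1
  rw [LeviCivitaAlgebra.sum_killingForm_mul, smoothFunctions.mul_val] at h2
  simp only [smoothFunctions.add_val, smoothFunctions.mul_val, h.chargeOn_val,
    g.algebraOn_metric_val] at h1
  have h3 : g.contraction x (emTensor g Y x) = 4 * _ := h2
  rw [h3]
  simp only [map_add, map_smul, add_apply, smul_apply, smul_eq_mul]
  refine h1.trans ?_
  rw [show (SemiRiemannianMetric.coordOn inter_subset_right j).1 y = tangentBasis x j from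
    SemiRiemannianMetric.coordOn_val y inter_subset_right j]
  change chargeDensity g Y X₀ x * g.inner x (X₀ x) (tangentBasis x j)
    + 2 * _ * g.inner x (Y x) (tangentBasis x j) = _
  ring

end IsPerfectFluidOn

/-! ### Horizontal and vertical spaces; the eigenvalue condition -/

namespace MultiFiberBundle

variable {m : ℕ} {M : Type*} [TopologicalSpace M]
  [ChartedSpace (EuclideanSpace ℝ (Fin (5 + m))) M] [IsManifold (𝓡 (5 + m)) ∞ M]
  {B : Type*} [TopologicalSpace B] [ChartedSpace (EuclideanSpace ℝ (Fin 4)) B]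
  {W : Type*} [TopologicalSpace W] [ChartedSpace (EuclideanSpace ℝ (Fin m)) W]
  {𝓑 : MultiFiberBundle m M B W} {g : SemiRiemannianMetric (5 + m) M}

lemma inner_eq_zero {x : M} {v w : TangentSpace (𝓡 (5 + m)) x} (hv : v ∈ 𝓑.horizontal g x)
    (hw : w ∈ 𝓑.vertical x) : g.inner x v w = 0 :=
  (g.symm x v w).trans (hv w hw)

/-- An orthogonal basis with nonzero squares makes the restricted form nondegenerate: pairing with
each basis vector kills the corresponding coordinate. -/
lemma eq_zero_of_hasSignature {V : Type*} [AddCommGroup V] [Module ℝ V]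
    {β : LinearMap.BilinForm ℝ V} {S : Submodule ℝ V} {q p : ℕ} (h : HasSignature β S q p) {v : V}
    (hv : v ∈ S) (hv' : ∀ w ∈ S, β v w = 0) : v = 0 := by
  obtain ⟨b, h0, h1, h2⟩ := h
  have h3 (i : Fin q ⊕ Fin p) : β (b i) (b i) ≠ 0 := by
    rcases i with i | i
    · rw [h1]; norm_num
    · rw [h2]; norm_num
  have h4 : (⟨v, hv⟩ : S) = 0 := by
    refine b.ext_elem fun j ↦ ?_
    have h5 := hv' (b j) (b j).2
    have h6 : v = ∑ i, b.repr ⟨v, hv⟩ i • (b i : V) := by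
      have := congrArg Subtype.val (b.sum_repr ⟨v, hv⟩)
      rw [Submodule.coe_sum] at this
      exact this.symm
    rw [h6, map_sum, LinearMap.sum_apply, Finset.sum_eq_single j] at h5
    · rw [map_smul, LinearMap.smul_apply, smul_eq_mul] at h5
      simpa using (mul_eq_zero.1 h5).resolve_right (h3 j)
    · intro i _ hi
      rw [map_smul, LinearMap.smul_apply, h0 i j hi, smul_zero]
    · simp
  exact congrArg Subtype.val h4

variable (hg : 𝓑.IsSpacetime g)
include hg

/-- In finite dimension it suffices that the intersection is zero: a vertical and horizontal vector
is orthogonal to all of H, on which the metric is nondegenerate. -/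
lemma IsSpacetime.isCompl (x : M) : IsCompl (𝓑.horizontal g x) (𝓑.vertical x) := by
  refine ((LinearMap.BilinForm.isCompl_orthogonal_iff_disjoint fun v w hvw ↦ ?_).2
    (Submodule.disjoint_def.2 fun v hv hv' ↦ ?_)).symm
  · exact (g.symm x w v).trans hvw
  · exact eq_zero_of_hasSignature (hg.horizontal x) hv' fun w hw ↦ hw v hv

lemma IsSpacetime.horProj_horizontal {x : M} (v : 𝓑.horizontal g x) : 𝓑.horProj g x v = v := by
  rw [horProj, dif_pos (hg.isCompl x)]
  exact Submodule.projectionOnto_apply_left _ v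

lemma IsSpacetime.horProj_vertical {x : M} {v : TangentSpace (𝓡 (5 + m)) x}
    (hv : v ∈ 𝓑.vertical x) : 𝓑.horProj g x v = 0 := by
  rw [horProj, dif_pos (hg.isCompl x)]
  exact Submodule.projectionOnto_apply_right _ ⟨v, hv⟩

lemma IsSpacetime.inner_horProj {x : M} {v : TangentSpace (𝓡 (5 + m)) x}
    (hv : v ∈ 𝓑.horizontal g x) (w : TangentSpace (𝓡 (5 + m)) x) :
    g.inner x v (𝓑.horProj g x w) = g.inner x v w := by
  obtain ⟨a, ha, b, hb, rfl⟩ := Submodule.mem_sup.1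
    ((hg.isCompl x).sup_eq_top ▸ Submodule.mem_top : w ∈ 𝓑.horizontal g x ⊔ 𝓑.vertical x)
  have h1 := hg.horProj_horizontal ⟨a, ha⟩
  rw [map_add, hg.horProj_vertical hb, h1, map_add, inner_eq_zero hv hb]
  simp

variable {D : Set M} {X₀ : ∀ x : M, TangentSpace (𝓡 (5 + m)) x} {μ : M → ℝ}

omit hg in
lemma IsFluidDomain.mem_horizontal (hD : 𝓑.IsFluidDomain g D X₀ μ) {x : M} (hx : x ∈ D) :
    X₀ x ∈ 𝓑.horizontal g x := by
  have h := (hD.eigenspace x hx).symm ▸ Submodule.mem_span_singleton_self (R := ℝ) (X₀ x)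
  obtain ⟨v, -, hv⟩ := Submodule.mem_map.1 h
  exact hv ▸ v.2

/-- Pairing with the horizontal X₀ does not see the projection, so G(X₀, X₀) = -μ⟨X₀, X₀⟩; the unit
timelike norm restores the sign. -/
lemma IsFluidDomain.einstein_self (hD : 𝓑.IsFluidDomain g D X₀ μ) {x : M} (hx : x ∈ D) :
    g.einstein x (X₀ x) (X₀ x) = μ x := by
  have h := (hD.eigenspace x hx).symm ▸ Submodule.mem_span_singleton_self (R := ℝ) (X₀ x)
  obtain ⟨v, hv, hv'⟩ := Submodule.mem_map.1 h
  rw [End.mem_eigenspace_iff] at hv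
  have h1 : 𝓑.horProj g x (g.endo x (g.einstein x) (X₀ x)) = -μ x • v := by
    rw [← hv, ← hv']
    rfl
  have h2 : g.einstein x (X₀ x) (X₀ x)
      = g.inner x (g.endo x (g.einstein x) (X₀ x)) (X₀ x) :=
    (g.inner_sharp x ((g.einstein x).flip (X₀ x)) (X₀ x)).symm
  have h3 : (v : TangentSpace (𝓡 (5 + m)) x) = X₀ x := hv'
  rw [h2, g.symm, ← hg.inner_horProj (hD.mem_horizontal hx), h1, Submodule.coe_smul, h3, map_smul,
    hD.unit x hx]
  simp

lemma IsFluidDomain.isPerfectFluidOn {Y : ∀ x : M, TangentSpace (𝓡 (5 + m)) x}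
    (hY : 𝓑.IsPotential g Y) (hD : 𝓑.IsFluidDomain g D X₀ μ) {p : M → ℝ}
    (hp : IsPerfectIsentropic g Y X₀ D p) : IsPerfectFluidOn g Y X₀ D μ p where
  smooth_Y := hY.smooth
  unit_Y := hY.unit
  killing := hY.killing
  isOpen := hD.isOpen
  smooth_X := hD.smooth
  unit_X := hD.unit
  ortho _ hx := inner_eq_zero (hD.mem_horizontal hx) (hY.tangent _).1
  ne_zero _ hx := (hD.pos _ hx).ne'
  energy _ hx := hD.einstein_self hg hx
  perfect := hp

end MultiFiberBundle

end KaluzaKlein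

theorem mainTheorem5 {m : ℕ}
    {M : Type*} [TopologicalSpace M] [T2Space M] [SecondCountableTopology M]
    [ChartedSpace (EuclideanSpace ℝ (Fin (5 + m))) M] [IsManifold (𝓡 (5 + m)) ∞ M]
    {B : Type*} [TopologicalSpace B] [T2Space B] [SecondCountableTopology B]
    [ChartedSpace (EuclideanSpace ℝ (Fin 4)) B] [IsManifold (𝓡 4) ∞ B]
    {W : Type*} [TopologicalSpace W] [T2Space W] [CompactSpace W]
    [ChartedSpace (EuclideanSpace ℝ (Fin m)) W] [IsManifold (𝓡 m) ∞ W]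
    (𝓑 : MultiFiberBundle m M B W)
    (g : SemiRiemannianMetric (5 + m) M) (hg : 𝓑.IsSpacetime g)
    (Y : ∀ x : M, TangentSpace (𝓡 (5 + m)) x) (hY : 𝓑.IsPotential g Y)
    (D : Set M) (X₀ : ∀ x : M, TangentSpace (𝓡 (5 + m)) x) (μ : M → ℝ)
    (hD : 𝓑.IsFluidDomain g D X₀ μ)
    (p : M → ℝ) (hp : IsPerfectIsentropic g Y X₀ D p) :
    ∀ x ∈ D,
      -- energy conservation
      g.divergence (fun y ↦ μ y • X₀ y) x + p x * g.divergence X₀ x = 0 ∧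
      -- charge conservation
      g.divergence (fun y ↦ chargeDensity g Y X₀ y • fluidField g Y X₀ μ y) x = 0 ∧
      g.divergence (fun y ↦ chargeDensity g Y X₀ y • X₀ y) x = 0 ∧
      -- evolution of the ratio of charge to energy
      μ x ^ 2 * mvfderiv (𝓡 (5 + m)) (fun y ↦ chargeDensity g Y X₀ y / μ y) x
          (fluidField g Y X₀ μ x)
        = chargeDensity g Y X₀ x * p x * g.divergence X₀ x ∧
      μ x ^ 2 * mvfderiv (𝓡 (5 + m)) (fun y ↦ chargeDensity g Y X₀ y / μ y) x (X₀ x)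
        = chargeDensity g Y X₀ x * p x * g.divergence X₀ x ∧
      -- equation of motion
      (μ x + p x) • g.leviCivita X₀ x (X₀ x)
        = chargeDensity g Y X₀ x • g.endo x (emTensor g Y x) (X₀ x)
          - g.grad p x - mvfderiv (𝓡 (5 + m)) p x (X₀ x) • X₀ x ∧
      -- Maxwell equations
      extDer (emForm g Y) x = 0 ∧
      g.divTensor (emTensor g Y) x
        = chargeDensity g Y X₀ x • X₀ x + (1 / 2 * g.contraction x (emTensor g Y x)) • Y x ∧
      (𝓑.horProj g x (g.divTensor (emTensor g Y) x) : TangentSpace (𝓡 (5 + m)) x)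
        = chargeDensity g Y X₀ x • X₀ x := by
  intro x hx
  have h := hD.isPerfectFluidOn hg hY hp
  -- The side condition of the equation of motion is 5 + m ≠ 2, needed for Y(p) = 0.
  refine ⟨h.energy_conservation hx, h.charge_conservation_fluid hx, h.charge_conservation hx,
    h.ratio_evolution_fluid hx, h.ratio_evolution hx, h.motion hx (by omega),
    extDer_emForm g hY.smooth x, h.maxwell hx, ?_⟩
  -- The horizontal projection fixes X₀ and kills the vertical field Y, leaving only the current e
  -- X₀.
  have h1 := hg.horProj_horizontal ⟨X₀ x, hD.mem_horizontal hx⟩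
  rw [h.maxwell hx, map_add, map_smul, map_smul, hg.horProj_vertical (hY.tangent x).1, h1]
  simp
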